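/- Let $d\ge 1$ and $q\in\mathbb{N}^d$, and put $[0,q]=\{k\in\mathbb{Z}^d : 0\le k_i\le q_i\}$, $[-q,q]=\{t\in\mathbb{Z}^d : |t_i|\le q_i\}$, $Q+1=\prod_i(q_i+1)$ and $2N+1=\prod_i(2q_i+1)$. The autocovariance map sends $a=(a_k)_{k\in[0,q]}\in\mathbb{C}^{Q+1}$ to $\gamma\in\mathbb{C}^{N+1}$ with coordinates $$\gamma(t)=\sum_{k,\,k+t\in[0,q]}a_k a_{k+t},\qquad t\in[-q,q],\ t\succeq 0,$$ where $\succeq$ is the lexicographic order. The autocovariance variety $\mathcal{MA}_q\subseteq\mathbb{P}^N$ is the image of the induced rational map $\mathbb{P}^Q\dashrightarrow\mathbb{P}^N$ over $\mathbb{C}$. The Euclidean distance (ED) degree of an irreducible affine variety $X\subseteq\mathbb{C}^n$ is the number of critical points of $x\mapsto\sum_i(x_i-u_i)^2$ on the nonsingular locus of $X$, i.e. of nonsingular points $x\in X$ with $\sum_i(u_i-x_i)v_i=0$ for all $v$ in the tangent space of $X$ at $x$, for generic $u\in\mathbb{C}^n$ (all $u$ outside a proper Zariski closed subset). The ED degree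 of a projective variety is that of its affine cone. **Proposition.** If $d=1$, then the ED degree of $\mathcal{MA}_q$ is $1$ for every $q$. The ED degree of $\mathcal{MA}_{(1,1)}$ is $16$. -/

import Mathlib

noncomputable section

/-- The index set `[0, q]` of the coefficients of a moving average polynomial of order `q`. -/
def coeffIndex {d : ℕ} (q : Fin d → ℕ) : Finset (Fin d → ℤ) :=
  Finset.Icc 0 (fun i => (q i : ℤ))

open Classical in
/-- The index set of the autocovariances: the `t ∈ [-q, q]` with `t ⪰ 0` in the
lexicographic order (first coordinate most significant). -/
def autocovIndex {d : ℕ} (q : Fin d → ℕ) : Finset (Fin d → ℤ) :=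
  (Finset.Icc (fun i => -(q i : ℤ)) (fun i => (q i : ℤ))).filter fun t => 0 ≤ toLex t

/-- The complex autocovariance map `Γ_q : ℂ^(Q+1) → ℂ^(N+1)`,
`γ(t) = ∑ a_k a_{k+t}`, the sum being over all `k` with `k` and `k + t` in `[0, q]`. -/
def autocovMap {d : ℕ} (q : Fin d → ℕ) (a : coeffIndex q → ℂ) : autocovIndex q → ℂ :=
  fun t => ∑ k : coeffIndex q, ∑ l : coeffIndex q, if l.1 = k.1 + t.1 then a k * a l else 0

/-- The autocovariance variety `MA_q`: the image of the map `Γ_q : ℙ^Q ⇢ ℙ^N`,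
`[a] ↦ [Γ_q(a)]`, defined where `Γ_q(a) ≠ 0` (which forces `a ≠ 0`). -/
def autocovVariety {d : ℕ} (q : Fin d → ℕ) : Set (Projectivization ℂ (autocovIndex q → ℂ)) :=
  {p | ∃ (a : coeffIndex q → ℂ) (h : autocovMap q a ≠ 0),
    p = Projectivization.mk ℂ (autocovMap q a) h}

/-- The affine cone over a subset of a projective space. -/
def affineCone {σ : Type*} (X : Set (Projectivization ℂ (σ → ℂ))) : Set (σ → ℂ) :=
  {x | ∀ h : x ≠ 0, Projectivization.mk ℂ x h ∈ X}

/-- The Zariski tangent space of `X ⊆ ℂ^σ` at `x`: the vectors annihilated by the differentials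
at `x` of all polynomials vanishing on `X`. -/
def zariskiTangentSpace {σ : Type*} [Fintype σ] (X : Set (σ → ℂ)) (x : σ → ℂ) :
    Submodule ℂ (σ → ℂ) where
  carrier := {v | ∀ f ∈ MvPolynomial.vanishingIdeal ℂ X,
    ∑ i, MvPolynomial.eval x (MvPolynomial.pderiv i f) * v i = 0}
  zero_mem' := by
    intro f _
    simp
  add_mem' := by
    intro v w hv hw f hf
    simp [mul_add, Finset.sum_add_distrib, hv f hf, hw f hf]
  smul_mem' := by
    intro c v hv f hf
    have h := congrArg (c * ·) (hv f hf)
    simp only [Finset.mul_sum, mul_zero] at h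
    simpa [mul_left_comm] using h

/-- `x` is a regular (nonsingular) point of the irreducible affine variety `X`: the dimension of
the tangent space at `x` is the dimension of `X`, i.e. the Krull dimension of its coordinate
ring. -/
def IsRegularPoint {σ : Type*} [Fintype σ] (X : Set (σ → ℂ)) (x : σ → ℂ) : Prop :=
  x ∈ X ∧ (Module.finrank ℂ (zariskiTangentSpace X x) : WithBot ℕ∞) =
    ringKrullDim (MvPolynomial σ ℂ ⧸ MvPolynomial.vanishingIdeal ℂ X)

/-- `x` is a critical point of the squared distance `∑ i, (x i - u i) ^ 2` to `u` on the regular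
locus of `X`. -/
def IsEDCriticalPoint {σ : Type*} [Fintype σ] (X : Set (σ → ℂ)) (u x : σ → ℂ) : Prop :=
  IsRegularPoint X x ∧ ∀ v ∈ zariskiTangentSpace X x, ∑ i, (u i - x i) * v i = 0

/-- The irreducible affine variety `X` has Euclidean distance degree `n`: for generic `u` (all `u`
outside the zero set of some nonzero polynomial) the squared distance to `u` has exactly `n`
critical points on the regular locus of `X`. -/
def HasAffineEDDegree {σ : Type*} [Fintype σ] (X : Set (σ → ℂ)) (n : ℕ) : Prop :=
  ∃ P : MvPolynomial σ ℂ, P ≠ 0 ∧ ∀ u : σ → ℂ, MvPolynomial.eval u P ≠ 0 →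
    {x | IsEDCriticalPoint X u x}.encard = n

/-- The Euclidean distance degree of an irreducible projective variety is that of its affine
cone. -/
def HasEDDegree {σ : Type*} [Fintype σ] (X : Set (Projectivization ℂ (σ → ℂ))) (n : ℕ) : Prop :=
  HasAffineEDDegree (affineCone X) n

end

/-! For `d = 1` the cone is the whole space, so the only critical point is `u` itself. A symmetric
Laurent polynomial has the form `p(z + z⁻¹)`; over `ℂ` the polynomial `p` splits, and each factor `z
+ z⁻¹ - w` equals `s²(z - r)(z⁻¹ - r)`, so the whole is `A(z)A(z⁻¹)`
(`exists_mul_inv_eq_eval_add_inv`, `range_autocovMap_of_one_dim`).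

For order `(1, 1)` put `e = a+b+c+d`, `f = a-b-c+d`, `g = a+b-c-d`, `h = a-b+c-d`. The squares of
these are linear in the autocovariances, and `gh - ef` is four times the difference `m` of the last
two. The cone is therefore the hypersurface on which `4m` is one of `±gh ± ef`, a monic quartic in
`m` that generates the vanishing ideal (`vanishingIdeal_coneSet`). A critical point is a point `x`
with nonzero gradient to which `u - x` is proportional. The pairs of a point and a normal vector are
parametrised by `a, b, c, d` and a scale `k`. Generically, critical points for `u` correspond to the
fibre over `u` of the variety whose coordinate ring is the `ℂ[u]`-subalgebra of `ℂ[a,b,c,d,k]`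
generated by the five normal coordinates `T, P, X, Y, M`.

Upper bound: fourteen identities (`ConormalRelations`) show that the `ℂ[u]`-span of sixteen
monomials in `T, P, X, Y, M` is stable under multiplication by these coordinates
(`mul_basisFamily_mem`). It contains the cone equation evaluated at `u`, because that equation
vanishes at `x` and `u - x` is linear in the coordinates. So fibres off the cone have at most
sixteen points (`encard_fibrePoints_le`).

Lower bound: one datum has sixteen explicit fibre points (`exists_specialFibre`). Hence the minimal
polynomial of a separating linear form has degree sixteen and nonzero discriminant, and wherever the
discriminant and the cone equation are nonzero the fibre has exactly sixteen points
(`exists_generic_fibrePoints`). The same result keeps the generic fibre off the zeros of a partial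
derivative, so that all its points are regular. -/

/-! ### Extension of homomorphisms and separation of points -/

open Polynomial in
/-- A ring homomorphism onto an algebraically closed field extends along an integral ring
homomorphism whose kernel it kills. -/
theorem exists_extension_of_isIntegral {S A K : Type*} [CommRing S] [CommRing A] [Field K]
    [IsAlgClosed K] (f : S →+* A) (hf : f.IsIntegral) (g : S →+* K)
    (hg : Function.Surjective g) (hker : RingHom.ker f ≤ RingHom.ker g) :
    ∃ φ : A →+* K, φ.comp f = g := by
  let := f.toAlgebra
  have : Algebra.IsIntegral S A := ⟨hf⟩
  have hmax : (RingHom.ker g).IsMaximal := RingHom.ker_isMaximal_of_surjective g hg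
  obtain ⟨Q, hQ, hQc⟩ := Ideal.exists_ideal_over_maximal_of_isIntegral (S := A) (RingHom.ker g) hker
  have hQc' : Q.comap f = RingHom.ker g := hQc
  let := Ideal.Quotient.field Q
  let j : S ⧸ RingHom.ker g →+* A ⧸ Q := Ideal.quotientMap Q f hQc'.ge
  have hj : j.IsIntegral := by
    intro x
    obtain ⟨a, rfl⟩ := Ideal.Quotient.mk_surjective x
    obtain ⟨p, hp, hpa⟩ := hf a
    refine ⟨p.map (Ideal.Quotient.mk _), hp.map _, ?_⟩
    rw [Polynomial.eval₂_map]
    have : j.comp (Ideal.Quotient.mk (RingHom.ker g)) = (Ideal.Quotient.mk Q).comp f := by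
      ext s; simp [j]
    rw [this, ← Polynomial.hom_eval₂, hpa, map_zero]
  let e := RingHom.quotientKerEquivOfSurjective hg
  let i : K →+* A ⧸ Q := j.comp e.symm.toRingHom
  have hi : i.IsIntegral := RingHom.IsIntegral.trans _ _
    (RingHom.isIntegral_of_surjective _ e.symm.surjective) hj
  -- The residue field `A ⧸ Q` is integral over the algebraically closed field `K`, hence equal to
  -- it.
  have hb := IsAlgClosed.ringHom_bijective_of_isIntegral i hi
  let E := RingEquiv.ofBijective i hb
  refine ⟨E.symm.toRingHom.comp (Ideal.Quotient.mk Q), ?_⟩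
  ext s
  have : i (g s) = Ideal.Quotient.mk Q (f s) := by
    have h1 : e.symm (g s) = Ideal.Quotient.mk _ s := by
      rw [RingEquiv.symm_apply_eq]; rfl
    simp [i, h1, j]
  have h2 : E (g s) = Ideal.Quotient.mk Q (f s) := this
  simp [← h2]

/-- Finitely many distinct vectors over an infinite field are separated by a linear form. -/
theorem exists_separating_linear_form {K ι κ : Type*} [Field K] [Infinite K] [Fintype ι] [Finite κ]
    (w : κ → ι → K) (hw : Function.Injective w) :
    ∃ c : ι → K, Function.Injective fun k => ∑ i, c i * w k i := by
  classical
  cases nonempty_fintype κ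
  -- The forms that fail to separate a given pair are a hyperplane; `P` is the product of the
  -- equations of these hyperplanes.
  let P : MvPolynomial ι K := ∏ p : {p : κ × κ // p.1 ≠ p.2},
    ∑ i, MvPolynomial.X i * MvPolynomial.C (w p.1.1 i - w p.1.2 i)
  have hP : P ≠ 0 := by
    refine Finset.prod_ne_zero_iff.2 fun p _ h0 => p.2 (hw (funext fun i => ?_))
    have := congrArg (MvPolynomial.eval (Pi.single i (1 : K))) h0
    simp only [map_sum, map_mul, MvPolynomial.eval_X, MvPolynomial.eval_C, map_zero] at this
    rw [Finset.sum_eq_single i (fun j _ hj => by simp [Pi.single_eq_of_ne hj]) (by simp)] at this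
    simpa [sub_eq_zero] using this
  obtain ⟨c, hc⟩ : ∃ c : ι → K, MvPolynomial.eval c P ≠ 0 := by
    by_contra! h
    exact hP (MvPolynomial.funext fun c => by simpa using h c)
  refine ⟨c, fun k l hkl => by_contra fun hne => ?_⟩
  rw [map_prod] at hc
  refine Finset.prod_ne_zero_iff.1 hc ⟨(k, l), hne⟩ (Finset.mem_univ _) ?_
  simp only [map_sum, map_mul, MvPolynomial.eval_X, MvPolynomial.eval_C, mul_sub,
    Finset.sum_sub_distrib]
  exact sub_eq_zero.2 hkl

/-! ### Fibres of an integral algebra over a polynomial ring -/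

section Fibre

open MvPolynomial (eval)

variable {σ ι D : Type*} [CommRing D] [Algebra (MvPolynomial σ ℂ) D]

/-- A ring homomorphism to `ℂ` lying over the point `u`. -/
def LiesOverPoint {A : Type*} [CommRing A] [Algebra (MvPolynomial σ ℂ) A] (u : σ → ℂ)
    (φ : A →+* ℂ) : Prop :=
  ∀ p : MvPolynomial σ ℂ, φ (algebraMap _ A p) = eval u p

/-- The generator `v i` of the algebra generated by the family `v`. -/
def adjoinGen (v : ι → D) (i : ι) : Algebra.adjoin (MvPolynomial σ ℂ) (Set.range v) :=
  ⟨v i, Algebra.subset_adjoin ⟨i, rfl⟩⟩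

/-- The fibre over `u` of the variety with coordinate ring `ℂ[σ][v]`, in the coordinates `v`. -/
def fibrePoints (v : ι → D) (u : σ → ℂ) : Set (ι → ℂ) :=
  {w | ∃ φ : Algebra.adjoin (MvPolynomial σ ℂ) (Set.range v) →+* ℂ,
    LiesOverPoint u φ ∧ ∀ i, φ (adjoinGen v i) = w i}

theorem mem_fibrePoints_of_hom {v : ι → D} {u : σ → ℂ} (φ : D →+* ℂ) (hφ : LiesOverPoint u φ) :
    (fun i => φ (v i)) ∈ fibrePoints v u :=
  ⟨φ.comp (Algebra.adjoin (MvPolynomial σ ℂ) (Set.range v)).val.toRingHom, fun p => hφ p,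
    fun _ => rfl⟩

variable {n : ℕ} {v : ι → D} {b : Fin n → D}

theorem mul_mem_span_of_mem_adjoin
    (hvb : ∀ i j, v i * b j ∈ Submodule.span (MvPolynomial σ ℂ) (Set.range b)) {a : D}
    (ha : a ∈ Algebra.adjoin (MvPolynomial σ ℂ) (Set.range v)) {x : D}
    (hx : x ∈ Submodule.span (MvPolynomial σ ℂ) (Set.range b)) :
    a * x ∈ Submodule.span (MvPolynomial σ ℂ) (Set.range b) := by
  induction ha using Algebra.adjoin_induction generalizing x with
  | mem y hy =>
    obtain ⟨i, rfl⟩ := hy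
    induction hx using Submodule.span_induction with
    | mem y hy => obtain ⟨j, rfl⟩ := hy; exact hvb i j
    | zero => simp
    | add y z _ _ h1 h2 => rw [mul_add]; exact add_mem h1 h2
    | smul r y _ h1 => rw [mul_smul_comm]; exact Submodule.smul_mem _ _ h1
  | algebraMap r => rw [← Algebra.smul_def]; exact Submodule.smul_mem _ _ hx
  | add y z _ _ h1 h2 => rw [add_mul]; exact add_mem (h1 hx) (h2 hx)
  | mul y z _ _ h1 h2 => rw [mul_assoc]; exact h1 (h2 hx)

/-- Cayley–Hamilton: `a` acts on the finitely generated span of `b`, which is a faithful module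
because `D` is a domain and `b j₀ ≠ 0`. -/
theorem isIntegral_of_mem_adjoin [IsDomain D]
    (hvb : ∀ i j, v i * b j ∈ Submodule.span (MvPolynomial σ ℂ) (Set.range b))
    {j₀ : Fin n} (hb : b j₀ ≠ 0) {a : D}
    (ha : a ∈ Algebra.adjoin (MvPolynomial σ ℂ) (Set.range v)) :
    IsIntegral (MvPolynomial σ ℂ) a := by
  refine isIntegral_of_smul_mem_submodule (Submodule.span (MvPolynomial σ ℂ) (Set.range b))
    ?_ ?_ a fun x hx => mul_mem_span_of_mem_adjoin hvb ha hx
  · exact (Submodule.ne_bot_iff _).2 ⟨b j₀, Submodule.subset_span ⟨j₀, rfl⟩, hb⟩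
  · exact Submodule.fg_span (Set.finite_range b)

/-- If a multiple of every element of `ℂ[σ][v]` by a fixed element `L` of `ℂ[σ]` lies in the span
of `n` elements, then the fibres over the points with `L ≠ 0` have at most `n` points. -/
theorem encard_fibrePoints_le
    (hvb : ∀ i j, v i * b j ∈ Submodule.span (MvPolynomial σ ℂ) (Set.range b))
    (hbA : ∀ j, b j ∈ Algebra.adjoin (MvPolynomial σ ℂ) (Set.range v))
    {L : MvPolynomial σ ℂ}
    (hL : algebraMap _ D L ∈ Submodule.span (MvPolynomial σ ℂ) (Set.range b))
    {u : σ → ℂ} (hu : eval u L ≠ 0) : (fibrePoints v u).encard ≤ n := by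
  by_contra! hlt
  obtain ⟨s, hs, hcard⟩ := Set.exists_subset_encard_eq (Order.add_one_le_of_lt hlt)
  have hfin : s.Finite := Set.finite_of_encard_eq_coe (k := n + 1) (by simpa using hcard)
  have := hfin.fintype
  have hn : Fintype.card s = n + 1 := by
    rw [← Nat.card_eq_fintype_card, Nat.card_coe_set_eq, Set.ncard, hcard]; rfl
  choose φ hφ hφv using fun w : s => hs w.2
  let B : Fin n → Algebra.adjoin (MvPolynomial σ ℂ) (Set.range v) := fun j => ⟨b j, hbA j⟩
  -- With `n + 1` vectors in `ℂⁿ`, some nontrivial combination of the homomorphisms kills every `b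
  -- j`. It will be shown to vanish identically, against Dedekind's independence of characters.
  have hdep : ¬ LinearIndependent ℂ (fun (w : s) (j : Fin n) => φ w (B j)) := by
    intro h
    have := h.fintype_card_le_finrank
    simp [hn] at this
  rw [Fintype.not_linearIndependent_iff] at hdep
  obtain ⟨c, hc, w₀, hw₀⟩ := hdep
  have hinj : Function.Injective fun w : s =>
      (φ w : Algebra.adjoin (MvPolynomial σ ℂ) (Set.range v) →* ℂ) := by
    intro w w' h
    ext i
    rw [← hφv w, ← hφv w']
    exact DFunLike.congr_fun h (adjoinGen v i)
  have hind := (linearIndependent_monoidHom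
    (Algebra.adjoin (MvPolynomial σ ℂ) (Set.range v)) ℂ).comp _ hinj
  rw [Fintype.linearIndependent_iff] at hind
  refine hw₀ (hind c (funext fun a => ?_) w₀)
  -- All the `φ w` restrict to evaluation at the same `u` on `ℂ[σ]`, so the relation passes from `b`
  -- to its span.
  have key : ∀ x (hx : x ∈ Submodule.span (MvPolynomial σ ℂ) (Set.range b)),
      ∃ hxA : x ∈ Algebra.adjoin (MvPolynomial σ ℂ) (Set.range v),
        ∑ w : s, c w * φ w ⟨x, hxA⟩ = 0 := by
    intro x hx
    induction hx using Submodule.span_induction with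
    | mem y hy =>
      obtain ⟨j, rfl⟩ := hy
      refine ⟨hbA j, ?_⟩
      have := congrFun hc j
      simpa [B, Finset.sum_apply] using this
    | zero =>
      refine ⟨zero_mem _, ?_⟩
      have h0 : ∀ w : s, φ w ⟨0, zero_mem _⟩ = 0 := fun w => map_zero (φ w)
      simp [h0]
    | add y z _ _ h1 h2 =>
      obtain ⟨hy, h1⟩ := h1
      obtain ⟨hz, h2⟩ := h2
      refine ⟨add_mem hy hz, ?_⟩
      have h0 : ∀ w : s, φ w ⟨y + z, add_mem hy hz⟩ = φ w ⟨y, hy⟩ + φ w ⟨z, hz⟩ :=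
        fun w => map_add (φ w) ⟨y, hy⟩ ⟨z, hz⟩
      simp [h0, mul_add, Finset.sum_add_distrib, h1, h2]
    | smul r y _ h1 =>
      obtain ⟨hy, h1⟩ := h1
      refine ⟨Subalgebra.smul_mem _ hy r, ?_⟩
      have h0 : ∀ w : s, φ w ⟨r • y, Subalgebra.smul_mem _ hy r⟩ = eval u r * φ w ⟨y, hy⟩ := by
        intro w
        rw [← hφ w r, ← map_mul]
        exact congrArg _ (Subtype.ext (Algebra.smul_def r y))
      have h2 : ∑ w : s, c w * φ w ⟨r • y, Subalgebra.smul_mem _ hy r⟩ =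
          eval u r * ∑ w : s, c w * φ w ⟨y, hy⟩ := by
        rw [Finset.mul_sum]
        exact Finset.sum_congr rfl fun w _ => by rw [h0, mul_left_comm]
      exact h2.trans (by rw [h1, mul_zero])
  obtain ⟨hxA, hx⟩ := key (a.1 * algebraMap _ D L) (mul_mem_span_of_mem_adjoin hvb a.2 hL)
  have h0 : ∀ w : s, φ w ⟨a.1 * algebraMap _ D L, hxA⟩ = φ w a * eval u L := by
    intro w
    rw [← hφ w L, ← map_mul]
    rfl
  simp only [h0, ← mul_assoc, ← Finset.sum_mul] at hx
  simpa [Finset.sum_apply] using (mul_eq_zero.1 hx).resolve_right hu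

open Polynomial in
/-- The minimal polynomial of an element of `ℂ[σ][v]`, specialised at `u`, vanishes at the values
of the element on the fibre over `u`. -/
theorem eval_map_minpoly_eq_zero {a : D} {u : σ → ℂ}
    (ha : a ∈ Algebra.adjoin (MvPolynomial σ ℂ) (Set.range v))
    {φ : Algebra.adjoin (MvPolynomial σ ℂ) (Set.range v) →+* ℂ} (hφ : LiesOverPoint u φ) :
    ((minpoly (MvPolynomial σ ℂ) a).map (eval u)).eval (φ ⟨a, ha⟩) = 0 := by
  have h1 : Polynomial.aeval (⟨a, ha⟩ : Algebra.adjoin (MvPolynomial σ ℂ) (Set.range v))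
      (minpoly (MvPolynomial σ ℂ) a) = 0 := by
    apply Subtype.ext
    have := Polynomial.aeval_algHom_apply
      (Algebra.adjoin (MvPolynomial σ ℂ) (Set.range v)).val ⟨a, ha⟩
      (minpoly (MvPolynomial σ ℂ) a)
    rw [Subalgebra.coe_val, minpoly.aeval] at this
    exact this.symm
  have h2 := congrArg φ h1
  rw [map_zero, Polynomial.aeval_def, Polynomial.hom_eval₂] at h2
  rw [Polynomial.eval_map]
  rwa [show φ.comp (algebraMap (MvPolynomial σ ℂ) _) = MvPolynomial.eval u from
    RingHom.ext hφ] at h2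

variable [IsDomain D] [FaithfulSMul (MvPolynomial σ ℂ) D]

-- Lying over. Since `ℂ[σ]` is integrally closed, the minimal polynomial generates the kernel of `X
-- ↦ a`, so sending `X` to a root `z` respects that kernel and extends along the integral map.
open Polynomial in
theorem exists_hom_of_root_minpoly
    (hint : ∀ a ∈ Algebra.adjoin (MvPolynomial σ ℂ) (Set.range v), IsIntegral (MvPolynomial σ ℂ) a)
    {a : D} (ha : a ∈ Algebra.adjoin (MvPolynomial σ ℂ) (Set.range v)) {u : σ → ℂ} {z : ℂ}
    (hz : ((minpoly (MvPolynomial σ ℂ) a).map (eval u)).eval z = 0) :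
    ∃ φ : Algebra.adjoin (MvPolynomial σ ℂ) (Set.range v) →+* ℂ,
      LiesOverPoint u φ ∧ φ ⟨a, ha⟩ = z := by
  let f : (MvPolynomial σ ℂ)[X] →+* Algebra.adjoin (MvPolynomial σ ℂ) (Set.range v) :=
    (Polynomial.aeval ⟨a, ha⟩).toRingHom
  let g : (MvPolynomial σ ℂ)[X] →+* ℂ := Polynomial.eval₂RingHom (eval u) z
  have hf : f.IsIntegral := by
    intro x
    have hx : IsIntegral (MvPolynomial σ ℂ) x :=
      (isIntegral_algHom_iff (Algebra.adjoin (MvPolynomial σ ℂ) (Set.range v)).val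
        Subtype.val_injective).1 (hint x.1 x.2)
    obtain ⟨p, hp, hpx⟩ := hx
    refine ⟨p.map Polynomial.C, hp.map _, ?_⟩
    rw [Polynomial.eval₂_map]
    rwa [show f.comp Polynomial.C = algebraMap (MvPolynomial σ ℂ) _ from
      RingHom.ext fun q => Polynomial.aeval_C _ q]
  have hg : Function.Surjective g := fun c => ⟨Polynomial.C (MvPolynomial.C c), by simp [g]⟩
  obtain ⟨φ, hφ⟩ := exists_extension_of_isIntegral f hf g hg (by
    intro p hp
    have hp' : Polynomial.aeval a p = 0 := by
      have h := congrArg Subtype.val (show f p = 0 from hp)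
      have h2 := Polynomial.aeval_algHom_apply
        (Algebra.adjoin (MvPolynomial σ ℂ) (Set.range v)).val ⟨a, ha⟩ p
      rw [Subalgebra.coe_val] at h2
      rw [h2]
      exact h
    obtain ⟨q, rfl⟩ := minpoly.isIntegrallyClosed_dvd (hint a ha) hp'
    rw [RingHom.mem_ker, map_mul]
    have : g (minpoly (MvPolynomial σ ℂ) a) = 0 := by
      rw [← hz, Polynomial.eval_map]; rfl
    rw [this, zero_mul])
  refine ⟨φ, fun p => ?_, ?_⟩
  · have := RingHom.congr_fun hφ (Polynomial.C p)
    simpa [f, g] using this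
  · have := RingHom.congr_fun hφ Polynomial.X
    simpa [f, g] using this

-- The elements `L, aL, …, aⁿL` lie in a module with `n` generators, so they are dependent;
-- cancelling `L ≠ 0` gives a polynomial of degree at most `n` that kills `a`.
open Polynomial in
theorem natDegree_minpoly_le
    (hvb : ∀ i j, v i * b j ∈ Submodule.span (MvPolynomial σ ℂ) (Set.range b))
    {L : MvPolynomial σ ℂ} (hL0 : L ≠ 0)
    (hL : algebraMap _ D L ∈ Submodule.span (MvPolynomial σ ℂ) (Set.range b))
    {a : D} (ha : a ∈ Algebra.adjoin (MvPolynomial σ ℂ) (Set.range v)) :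
    (minpoly (MvPolynomial σ ℂ) a).natDegree ≤ n := by
  have hmem : ∀ k : Fin (n + 1), a ^ (k : ℕ) * algebraMap _ D L ∈
      Submodule.span (MvPolynomial σ ℂ) (Set.range b) := fun k =>
    mul_mem_span_of_mem_adjoin hvb (pow_mem ha k) hL
  have hdep : ¬ LinearIndependent (MvPolynomial σ ℂ)
      (fun k : Fin (n + 1) => a ^ (k : ℕ) * algebraMap _ D L) := by
    intro h
    have := Fintype.ofFinite (Set.range b)
    have := linearIndependent_le_span' _ h (Set.range b) (by
      rintro _ ⟨k, rfl⟩; exact hmem k)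
    have h3 : Fintype.card (Set.range b) ≤ n := by
      simpa using Fintype.card_range_le b
    rw [Cardinal.mk_fin] at this
    have h4 : n + 1 ≤ Fintype.card (Set.range b) := by exact_mod_cast this
    omega
  rw [Fintype.not_linearIndependent_iff] at hdep
  obtain ⟨c, hc, k₀, hk₀⟩ := hdep
  let p : (MvPolynomial σ ℂ)[X] := ∑ k : Fin (n + 1), Polynomial.monomial (k : ℕ) (c k)
  have hp0 : p ≠ 0 := by
    intro h
    have := congrArg (fun q => Polynomial.coeff q k₀) h
    simp only [p, Polynomial.finsetSum_coeff, Polynomial.coeff_monomial, Polynomial.coeff_zero,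
      Fin.val_inj, Finset.sum_ite_eq', Finset.mem_univ, if_true] at this
    exact hk₀ this
  have hpa : Polynomial.aeval a p = 0 := by
    have h1 : Polynomial.aeval a p * algebraMap _ D L = 0 := by
      simpa [p, Finset.sum_mul, Polynomial.aeval_monomial, Algebra.smul_def, mul_assoc] using hc
    exact (mul_eq_zero.1 h1).resolve_right
      ((map_ne_zero_iff _ (FaithfulSMul.algebraMap_injective _ _)).2 hL0)
  have h1 := minpoly.IsIntegrallyClosed.degree_le_of_ne_zero hp0 hpa
  have h2 := Polynomial.natDegree_le_natDegree h1
  refine h2.trans (Polynomial.natDegree_sum_le_of_forall_le _ _ fun k _ => ?_)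
  exact (Polynomial.natDegree_monomial_le _).trans (Nat.lt_succ_iff.1 k.2)

open Polynomial in
/-- **Generic fibres.** Suppose that multiplication by each `v i` preserves the `ℂ[σ]`-span of
`b 1, …, b n`, that this span contains a nonzero element of `ℂ[σ]`, and that one fibre of the
variety with coordinate ring `ℂ[σ][v]` has `n` points. Then every fibre outside a hypersurface has
`n` points, and a given nonzero function on the variety has no zero on it. -/
theorem exists_generic_fibrePoints [Fintype ι]
    (hvb : ∀ i j, v i * b j ∈ Submodule.span (MvPolynomial σ ℂ) (Set.range b))
    (hbA : ∀ j, b j ∈ Algebra.adjoin (MvPolynomial σ ℂ) (Set.range v))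
    {L : MvPolynomial σ ℂ} (hL0 : L ≠ 0)
    (hL : algebraMap _ D L ∈ Submodule.span (MvPolynomial σ ℂ) (Set.range b))
    {j₀ : Fin n} (hb : b j₀ ≠ 0)
    {u₀ : σ → ℂ} (w : Fin n → ι → ℂ) (hw : Function.Injective w)
    (hwu : ∀ k, w k ∈ fibrePoints v u₀)
    (h : Algebra.adjoin (MvPolynomial σ ℂ) (Set.range v)) (h0 : h ≠ 0) :
    ∃ P : MvPolynomial σ ℂ, P ≠ 0 ∧ ∀ u, eval u P ≠ 0 → (fibrePoints v u).encard = n ∧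
      ∀ φ : Algebra.adjoin (MvPolynomial σ ℂ) (Set.range v) →+* ℂ, LiesOverPoint u φ → φ h ≠ 0 := by
  have hint : ∀ a ∈ Algebra.adjoin (MvPolynomial σ ℂ) (Set.range v),
      IsIntegral (MvPolynomial σ ℂ) a := fun a ha => isIntegral_of_mem_adjoin hvb hb ha
  obtain ⟨c, hc⟩ := exists_separating_linear_form w hw
  let l : Algebra.adjoin (MvPolynomial σ ℂ) (Set.range v) :=
    ∑ i, algebraMap (MvPolynomial σ ℂ) _ (MvPolynomial.C (c i)) * adjoinGen v i
  have hl : ∀ {u : σ → ℂ} (φ : Algebra.adjoin (MvPolynomial σ ℂ) (Set.range v) →+* ℂ),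
      LiesOverPoint u φ → φ l = ∑ i, c i * φ (adjoinGen v i) := fun φ hφ => by
    simp [l, hφ _]
  let χ := minpoly (MvPolynomial σ ℂ) l.1
  have hχm : χ.Monic := minpoly.monic (hint _ l.2)
  have hroot : ∀ k, (χ.map (eval u₀)).eval (∑ i, c i * w k i) = 0 := fun k => by
    obtain ⟨φ, hφ, hφw⟩ := hwu k
    have := eval_map_minpoly_eq_zero l.2 hφ
    rw [show (⟨l.1, l.2⟩ : Algebra.adjoin (MvPolynomial σ ℂ) (Set.range v)) = l from rfl,
      hl φ hφ] at this
    simpa [hφw] using this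
  have hdeg : ∀ u : σ → ℂ, (χ.map (eval u)).natDegree = χ.natDegree := fun u =>
    hχm.natDegree_map _
  -- The `n` known points give distinct roots of a polynomial of degree at most `n`; so the degree
  -- is `n` and all roots are simple.
  have hsep₀ : (χ.map (eval u₀)).Separable ∧ χ.natDegree = n := by
    have hne : χ.map (eval u₀) ≠ 0 := (hχm.map _).ne_zero
    have hle : Finset.univ.image (fun k => ∑ i, c i * w k i) ⊆ (χ.map (eval u₀)).roots.toFinset := by
      intro z hz
      obtain ⟨k, -, rfl⟩ := Finset.mem_image.1 hz
      simpa [hne] using hroot k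
    have hcard := Finset.card_le_card hle
    rw [Finset.card_image_of_injective _ hc, Finset.card_univ, Fintype.card_fin] at hcard
    have h1 := Multiset.toFinset_card_le (χ.map (eval u₀)).roots
    have h2 := Polynomial.card_roots' (χ.map (eval u₀))
    have h3 := natDegree_minpoly_le hvb hL0 hL l.2
    rw [hdeg] at h2
    have h4 : χ.natDegree = n := le_antisymm h3 (hcard.trans (h1.trans h2))
    refine ⟨?_, h4⟩
    rw [← Polynomial.nodup_roots_iff_of_splits hne (IsAlgClosed.splits _),
      ← Multiset.toFinset_card_eq_card_iff_nodup]
    omega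
  have hderiv : ∀ u : σ → ℂ, eval u (χ.resultant χ.derivative χ.natDegree (χ.natDegree - 1)) =
      (χ.map (eval u)).resultant (χ.map (eval u)).derivative χ.natDegree (χ.natDegree - 1) :=
    fun u => by rw [Polynomial.derivative_map, Polynomial.resultant_map_map]
  -- As `χ` is monic in characteristic zero, the formal degrees in the resultant stay the true ones
  -- after specialisation.
  have hsep : ∀ u : σ → ℂ,
      eval u (χ.resultant χ.derivative χ.natDegree (χ.natDegree - 1)) ≠ 0 ↔
        (χ.map (eval u)).Separable := fun u => by
    have hd : (χ.map (eval u)).derivative.natDegree = χ.natDegree - 1 := by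
      rw [Polynomial.natDegree_derivative, hdeg]
    rw [hderiv, Polynomial.Separable, ← hd, ← hdeg u, Ne, Polynomial.resultant_eq_zero_iff]
    simp [(hχm.map (eval u)).ne_zero]
  let q := minpoly (MvPolynomial σ ℂ) h.1
  -- If the constant term were zero, a factor `X` could be cancelled from the minimal polynomial,
  -- because `h ≠ 0`.
  have hq0 : q.coeff 0 ≠ 0 := by
    intro hq
    obtain ⟨q', hq'⟩ := Polynomial.X_dvd_iff.2 hq
    have hqm : q ≠ 0 := (minpoly.monic (hint _ h.2)).ne_zero
    have hq'0 : q' ≠ 0 := by rintro rfl; exact hqm (by simpa using hq')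
    have h1 : Polynomial.aeval h.1 q = 0 := minpoly.aeval _ _
    rw [hq', map_mul, Polynomial.aeval_X] at h1
    have h2 := minpoly.IsIntegrallyClosed.degree_le_of_ne_zero hq'0
      ((mul_eq_zero.1 h1).resolve_left fun h' => h0 (Subtype.ext h'))
    have h3 := Polynomial.natDegree_le_natDegree h2
    have h4 : q.natDegree = q'.natDegree + 1 := by
      rw [hq', Polynomial.natDegree_X_mul hq'0]
    exact absurd h3 (by change ¬ q.natDegree ≤ _; omega)
  -- The discriminant gives at least `n` points, `L` gives at most `n`, and the constant term of `q`
  -- keeps `h` away from zero.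
  refine ⟨χ.resultant χ.derivative χ.natDegree (χ.natDegree - 1) * (L * q.coeff 0),
    mul_ne_zero (fun h' => ?_) (mul_ne_zero hL0 hq0), fun u hu => ?_⟩
  · exact (hsep u₀).2 hsep₀.1 (by rw [h', map_zero])
  rw [map_mul, map_mul] at hu
  obtain ⟨hu1, hu2⟩ := mul_ne_zero_iff.1 hu
  obtain ⟨huL, huq⟩ := mul_ne_zero_iff.1 hu2
  refine ⟨le_antisymm (encard_fibrePoints_le hvb hbA hL huL) ?_, fun φ hφ hφ0 => huq ?_⟩
  · have hs := (hsep u).1 hu1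
    have hne : χ.map (eval u) ≠ 0 := (hχm.map _).ne_zero
    have hcard : (χ.map (eval u)).roots.toFinset.card = n := by
      rw [Multiset.toFinset_card_of_nodup (Polynomial.nodup_roots hs),
        ← (IsAlgClosed.splits (χ.map (eval u))).natDegree_eq_card_roots, hdeg, hsep₀.2]
    have hsub : ((χ.map (eval u)).roots.toFinset : Set ℂ) ⊆
        (fun x : ι → ℂ => ∑ i, c i * x i) '' fibrePoints v u := by
      intro z hz
      have hz' : (χ.map (eval u)).eval z = 0 := by simpa [hne] using hz
      obtain ⟨φ, hφ, hφz⟩ := exists_hom_of_root_minpoly hint l.2 hz'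
      exact ⟨fun i => φ (adjoinGen v i), ⟨φ, hφ, fun _ => rfl⟩, by
        rw [← hφz]; exact (hl φ hφ).symm⟩
    calc (n : ℕ∞) = ((χ.map (eval u)).roots.toFinset : Set ℂ).encard := by
          rw [Set.encard_coe_eq_coe_finsetCard, hcard]
      _ ≤ _ := Set.encard_le_encard hsub
      _ ≤ _ := Set.encard_image_le _ _
  · have := eval_map_minpoly_eq_zero h.2 hφ
    rw [show (⟨h.1, h.2⟩ : Algebra.adjoin (MvPolynomial σ ℂ) (Set.range v)) = h from rfl, hφ0,
      ← Polynomial.coeff_zero_eq_eval_zero, Polynomial.coeff_map] at this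
    exact this

end Fibre

/-! ### Reduction to sorted triples of indices -/

theorem forall_of_sorted {α : Type*} [LinearOrder α] (p : α → α → α → Prop)
    (h₁ : ∀ i j k, p i j k → p j i k) (h₂ : ∀ i j k, p i j k → p i k j)
    (h : ∀ i j k, i ≤ j → j ≤ k → p i j k) (i j k : α) : p i j k := by
  rcases le_total i j with hij | hij <;> rcases le_total j k with hjk | hjk <;>
    rcases le_total i k with hik | hik
  · exact h _ _ _ hij hjk
  · exact h _ _ _ hij hjk
  · exact h₂ _ _ _ (h _ _ _ hik hjk)
  · exact h₂ _ _ _ (h₁ _ _ _ (h _ _ _ hik hij))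
  · exact h₁ _ _ _ (h _ _ _ hij hik)
  · exact h₁ _ _ _ (h₂ _ _ _ (h _ _ _ hjk hik))
  · exact h₂ _ _ _ (h₁ _ _ _ (h₂ _ _ _ (h _ _ _ hjk hij)))
  · exact h₂ _ _ _ (h₁ _ _ _ (h₂ _ _ _ (h _ _ _ hjk hij)))

theorem forall_triple {S : Type*} [CommRing S] (p : S → Prop) {a b c d : S}
    (hTTT : p (a * a * a)) (hTTP : p (a * a * b)) (hTTX : p (a * a * c)) (hTTY : p (a * a * d))
    (hTPP : p (a * b * b)) (hTPX : p (a * b * c)) (hTPY : p (a * b * d)) (hTXX : p (a * c * c))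
    (hTXY : p (a * c * d)) (hTYY : p (a * d * d)) (hPPP : p (b * b * b)) (hPPX : p (b * b * c))
    (hPPY : p (b * b * d)) (hPXX : p (b * c * c)) (hPXY : p (b * c * d)) (hPYY : p (b * d * d))
    (hXXX : p (c * c * c)) (hXXY : p (c * c * d)) (hXYY : p (c * d * d)) (hYYY : p (d * d * d)) :
    ∀ i j k : Fin 4, p (![a, b, c, d] i * ![a, b, c, d] j * ![a, b, c, d] k) :=
  forall_of_sorted (fun i j k => p (![a, b, c, d] i * ![a, b, c, d] j * ![a, b, c, d] k))
    (fun i j k hm => by rwa [mul_comm (![a, b, c, d] j)])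
    (fun i j k hm => by rwa [mul_right_comm]) (by
    intro i j k hij hjk
    fin_cases i <;> fin_cases j <;> first
      | exact absurd hij (by decide)
      | fin_cases k <;> first
        | exact absurd hjk (by decide)
        | assumption)

/-! ### Relations of the conormal variety and cubic monomials -/

section Span

variable {σ D : Type*} [CommRing D] [Algebra (MvPolynomial σ ℂ) D]

/-- Nonzero integers are invertible in `ℂ`, so integer linear systems can be solved inside a
submodule without fractions. -/
theorem mem_of_intCast_mul_eq {N : Submodule (MvPolynomial σ ℂ) D} {x y : D} (k : ℤ) (hy : y ∈ N)
    (h : (k : D) * x = y) (hk : k ≠ 0 := by norm_num) : x ∈ N := by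
  have h1 : (MvPolynomial.C ((k : ℂ)⁻¹) : MvPolynomial σ ℂ) * (k : MvPolynomial σ ℂ) = 1 := by
    rw [← map_intCast (MvPolynomial.C : ℂ →+* MvPolynomial σ ℂ), ← map_mul,
      inv_mul_cancel₀ (by exact_mod_cast hk), map_one]
  have h2 := N.smul_mem (MvPolynomial.C ((k : ℂ)⁻¹)) hy
  rw [Algebra.smul_def, ← h, ← mul_assoc, ← map_intCast (algebraMap (MvPolynomial σ ℂ) D),
    ← map_mul, h1, map_one, one_mul] at h2
  exact h2

theorem intCast_mul_mem {N : Submodule (MvPolynomial σ ℂ) D} {x : D} (k : ℤ) (hx : x ∈ N) :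
    (k : D) * x ∈ N := by
  rw [← zsmul_eq_mul]
  exact zsmul_mem hx k

theorem algebraMap_mul_mem {N : Submodule (MvPolynomial σ ℂ) D} {x : D} (r : MvPolynomial σ ℂ)
    (hx : x ∈ N) : algebraMap _ D r * x ∈ N := by
  rw [← Algebra.smul_def]
  exact N.smul_mem r hx

/-- The equations of the conormal variety of the cone over `MA_(1,1)`. The residual `u - x` has
coordinates `4T, P, X, Y, M` dual to the coordinates `us - T, up - 2P, ux - X, uy - Y, um - 2M`
of the point `x`. -/
structure ConormalRelations (us up ux uy um : MvPolynomial σ ℂ) (T P X Y M : D) : Prop where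
  segre : 4 * T * P = X * Y
  quadric : M ^ 2 = 16 * T ^ 2 + P ^ 2 - X ^ 2 - Y ^ 2
  euler : 4 * T * (algebraMap _ D us - T) + P * (algebraMap _ D up - 2 * P) +
    X * (algebraMap _ D ux - X) + Y * (algebraMap _ D uy - Y) +
    M * (algebraMap _ D um - 2 * M) = 0
  torus₁ : Y * (algebraMap _ D us - T) + X * (algebraMap _ D up - 2 * P) +
    P * (algebraMap _ D ux - X) + 4 * T * (algebraMap _ D uy - Y) = 0
  torus₂ : X * (algebraMap _ D us - T) + Y * (algebraMap _ D up - 2 * P) +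
    4 * T * (algebraMap _ D ux - X) + P * (algebraMap _ D uy - Y) = 0
  corner₁ : M * (4 * T * (algebraMap _ D us - T) - P * (algebraMap _ D up - 2 * P)) +
    (16 * T ^ 2 - P ^ 2) * (algebraMap _ D um - 2 * M) = 0
  corner₂ : M * (X * (algebraMap _ D ux - X) - Y * (algebraMap _ D uy - Y)) -
    (X ^ 2 - Y ^ 2) * (algebraMap _ D um - 2 * M) = 0
  corner₃ : M * (Y * (algebraMap _ D us - T) + P * (algebraMap _ D ux - X)) +
    (4 * T * Y - P * X) * (algebraMap _ D um - 2 * M) = 0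
  corner₄ : M * (X * (algebraMap _ D us - T) + P * (algebraMap _ D uy - Y)) +
    (4 * T * X - P * Y) * (algebraMap _ D um - 2 * M) = 0
  mixed : M * ((algebraMap _ D us - T) * (algebraMap _ D up - 2 * P) -
      (algebraMap _ D ux - X) * (algebraMap _ D uy - Y)) +
    (algebraMap _ D um - 2 * M) * (4 * T * (algebraMap _ D up - 2 * P) +
      P * (algebraMap _ D us - T) + X * (algebraMap _ D uy - Y) +
      Y * (algebraMap _ D ux - X)) = 0
  cubic₁ : (4 * T + P + X + Y) * (2 * (algebraMap _ D um - 2 * M) ^ 2 -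
      ((algebraMap _ D us - T) ^ 2 + (algebraMap _ D up - 2 * P) ^ 2 -
        (algebraMap _ D ux - X) ^ 2 - (algebraMap _ D uy - Y) ^ 2)) =
    (4 * T - P + X - Y) * (((algebraMap _ D us - T) - (algebraMap _ D uy - Y)) ^ 2 -
      ((algebraMap _ D up - 2 * P) - (algebraMap _ D ux - X)) ^ 2)
  cubic₂ : (4 * T + P - X - Y) * (2 * (algebraMap _ D um - 2 * M) ^ 2 -
      ((algebraMap _ D us - T) ^ 2 + (algebraMap _ D up - 2 * P) ^ 2 -
        (algebraMap _ D ux - X) ^ 2 - (algebraMap _ D uy - Y) ^ 2)) =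
    (4 * T - P + X - Y) * (((algebraMap _ D us - T) + (algebraMap _ D ux - X)) ^ 2 -
      ((algebraMap _ D up - 2 * P) + (algebraMap _ D uy - Y)) ^ 2)
  cubic₃ : (4 * T - P + X - Y) * (2 * (algebraMap _ D um - 2 * M) ^ 2 -
      ((algebraMap _ D us - T) ^ 2 + (algebraMap _ D up - 2 * P) ^ 2 -
        (algebraMap _ D ux - X) ^ 2 - (algebraMap _ D uy - Y) ^ 2)) =
    (4 * T + P + X + Y) * (((algebraMap _ D us - T) + (algebraMap _ D uy - Y)) ^ 2 -
      ((algebraMap _ D up - 2 * P) + (algebraMap _ D ux - X)) ^ 2)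
  cubic₄ : (4 * T - P - X + Y) * (2 * (algebraMap _ D um - 2 * M) ^ 2 -
      ((algebraMap _ D us - T) ^ 2 + (algebraMap _ D up - 2 * P) ^ 2 -
        (algebraMap _ D ux - X) ^ 2 - (algebraMap _ D uy - Y) ^ 2)) =
    (4 * T + P + X + Y) * (((algebraMap _ D us - T) + (algebraMap _ D ux - X)) ^ 2 -
      ((algebraMap _ D up - 2 * P) + (algebraMap _ D uy - Y)) ^ 2)

/-- The span of the linear and quadratic monomials in the residual coordinates. -/
noncomputable def quadraticSpan (v : Fin 5 → D) : Submodule (MvPolynomial σ ℂ) D :=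
  Submodule.span _ (Set.range v) ⊔ Submodule.span _ (Set.range v) * Submodule.span _ (Set.range v)

namespace ConormalRelations

variable {us up ux uy um : MvPolynomial σ ℂ} {T P X Y M : D}

theorem lin_mem (v : Fin 5 → D) (i : Fin 5) :
    v i ∈ quadraticSpan (σ := σ) v :=
  Submodule.mem_sup_left (Submodule.subset_span ⟨i, rfl⟩)

theorem mul_mem {v : Fin 5 → D} {x y : D}
    (hx : x ∈ Submodule.span (MvPolynomial σ ℂ) (Set.range v))
    (hy : y ∈ Submodule.span (MvPolynomial σ ℂ) (Set.range v)) :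
    x * y ∈ quadraticSpan (σ := σ) v :=
  Submodule.mem_sup_right (Submodule.mul_mem_mul hx hy)

/-- Only the part of `h` that is cubic in the residual coordinates matters modulo `quadraticSpan`.
It is `l₁(8M² - T² - 4P² + X² + Y²) - l₂(a² - b²)`, and `hq` eliminates `M²`. -/
theorem cubic_difference_mem {v : Fin 5 → D} (hq : M ^ 2 = 16 * T ^ 2 + P ^ 2 - X ^ 2 - Y ^ 2)
    (hT : T ∈ Submodule.span (MvPolynomial σ ℂ) (Set.range v))
    (hP : P ∈ Submodule.span (MvPolynomial σ ℂ) (Set.range v))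
    (hX : X ∈ Submodule.span (MvPolynomial σ ℂ) (Set.range v))
    (hY : Y ∈ Submodule.span (MvPolynomial σ ℂ) (Set.range v))
    (hM : M ∈ Submodule.span (MvPolynomial σ ℂ) (Set.range v)) {l₁ l₂ a b : D}
    (h₁ : l₁ ∈ Submodule.span (MvPolynomial σ ℂ) (Set.range v))
    (h₂ : l₂ ∈ Submodule.span (MvPolynomial σ ℂ) (Set.range v))
    (ha : a ∈ Submodule.span (MvPolynomial σ ℂ) (Set.range v))
    (hb : b ∈ Submodule.span (MvPolynomial σ ℂ) (Set.range v)) (r s : MvPolynomial σ ℂ)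
    (h : l₁ * (2 * (algebraMap _ D um - 2 * M) ^ 2 -
      ((algebraMap _ D us - T) ^ 2 + (algebraMap _ D up - 2 * P) ^ 2 -
        (algebraMap _ D ux - X) ^ 2 - (algebraMap _ D uy - Y) ^ 2)) =
      l₂ * ((algebraMap _ D r + a) ^ 2 - (algebraMap _ D s + b) ^ 2)) :
    l₁ * (127 * T ^ 2 + 4 * P ^ 2 - 7 * X ^ 2 - 7 * Y ^ 2) - l₂ * (a ^ 2 - b ^ 2) ∈
      quadraticSpan (σ := σ) v := by
  have m₁ : algebraMap _ D um * (((8 : ℤ) : D) * M) + algebraMap _ D us * (((-2 : ℤ) : D) * T) +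
      algebraMap _ D up * (((-4 : ℤ) : D) * P) + algebraMap _ D ux * (((2 : ℤ) : D) * X) +
      algebraMap _ D uy * (((2 : ℤ) : D) * Y) ∈ Submodule.span (MvPolynomial σ ℂ) (Set.range v) :=
    add_mem (add_mem (add_mem (add_mem (algebraMap_mul_mem _ (intCast_mul_mem 8 hM))
      (algebraMap_mul_mem _ (intCast_mul_mem (-2) hT)))
      (algebraMap_mul_mem _ (intCast_mul_mem (-4) hP)))
      (algebraMap_mul_mem _ (intCast_mul_mem 2 hX))) (algebraMap_mul_mem _ (intCast_mul_mem 2 hY))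
  have m₂ : algebraMap _ D r * (((2 : ℤ) : D) * a) + algebraMap _ D s * (((-2 : ℤ) : D) * b) ∈
      Submodule.span (MvPolynomial σ ℂ) (Set.range v) :=
    add_mem (algebraMap_mul_mem _ (intCast_mul_mem 2 ha))
      (algebraMap_mul_mem _ (intCast_mul_mem (-2) hb))
  have m₃ : algebraMap _ D (us ^ 2 + up ^ 2 - ux ^ 2 - uy ^ 2 - 2 * um ^ 2) * l₁ +
      algebraMap _ D (r ^ 2 - s ^ 2) * l₂ ∈ Submodule.span (MvPolynomial σ ℂ) (Set.range v) :=
    add_mem (algebraMap_mul_mem _ h₁) (algebraMap_mul_mem _ h₂)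
  have m₄ := add_mem (add_mem (mul_mem h₁ m₁) (mul_mem h₂ m₂)) (Submodule.mem_sup_left m₃)
  refine mem_of_intCast_mul_eq 1 m₄ ?_
  simp only [map_sub, map_add, map_mul, map_pow, map_ofNat]
  push_cast
  linear_combination h - 8 * l₁ * hq

/-- This is, up to sign, the quadratic part of the relation `torus₁`; the rest of that relation is
linear over `ℂ[σ]`. -/
theorem torus₁_mem (h : ConormalRelations us up ux uy um T P X Y M) :
    5 * T * Y + 3 * P * X ∈ Submodule.span (MvPolynomial σ ℂ) (Set.range ![T, P, X, Y, M]) := by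
  have hT := Submodule.subset_span (R := MvPolynomial σ ℂ)
    (Set.mem_range_self (f := ![T, P, X, Y, M]) 0)
  have hP := Submodule.subset_span (R := MvPolynomial σ ℂ)
    (Set.mem_range_self (f := ![T, P, X, Y, M]) 1)
  have hX := Submodule.subset_span (R := MvPolynomial σ ℂ)
    (Set.mem_range_self (f := ![T, P, X, Y, M]) 2)
  have hY := Submodule.subset_span (R := MvPolynomial σ ℂ)
    (Set.mem_range_self (f := ![T, P, X, Y, M]) 3)
  refine mem_of_intCast_mul_eq 1 (add_mem (add_mem (add_mem (algebraMap_mul_mem us hY)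
    (algebraMap_mul_mem up hX)) (algebraMap_mul_mem ux hP))
    (algebraMap_mul_mem uy (intCast_mul_mem 4 hT))) ?_
  simp only [Matrix.cons_val]
  push_cast
  linear_combination -h.torus₁

theorem torus₂_mem (h : ConormalRelations us up ux uy um T P X Y M) :
    5 * T * X + 3 * P * Y ∈ Submodule.span (MvPolynomial σ ℂ) (Set.range ![T, P, X, Y, M]) := by
  have hT := Submodule.subset_span (R := MvPolynomial σ ℂ)
    (Set.mem_range_self (f := ![T, P, X, Y, M]) 0)
  have hP := Submodule.subset_span (R := MvPolynomial σ ℂ)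
    (Set.mem_range_self (f := ![T, P, X, Y, M]) 1)
  have hX := Submodule.subset_span (R := MvPolynomial σ ℂ)
    (Set.mem_range_self (f := ![T, P, X, Y, M]) 2)
  have hY := Submodule.subset_span (R := MvPolynomial σ ℂ)
    (Set.mem_range_self (f := ![T, P, X, Y, M]) 3)
  refine mem_of_intCast_mul_eq 1 (add_mem (add_mem (add_mem (algebraMap_mul_mem us hX)
    (algebraMap_mul_mem up hY)) (algebraMap_mul_mem uy hP))
    (algebraMap_mul_mem ux (intCast_mul_mem 4 hT))) ?_
  simp only [Matrix.cons_val]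
  push_cast
  linear_combination -h.torus₂

theorem euler_mem (h : ConormalRelations us up ux uy um T P X Y M) :
    36 * T ^ 2 + 4 * P ^ 2 - X ^ 2 - Y ^ 2 ∈
      Submodule.span (MvPolynomial σ ℂ) (Set.range ![T, P, X, Y, M]) := by
  have hT := Submodule.subset_span (R := MvPolynomial σ ℂ)
    (Set.mem_range_self (f := ![T, P, X, Y, M]) 0)
  have hP := Submodule.subset_span (R := MvPolynomial σ ℂ)
    (Set.mem_range_self (f := ![T, P, X, Y, M]) 1)
  have hX := Submodule.subset_span (R := MvPolynomial σ ℂ)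
    (Set.mem_range_self (f := ![T, P, X, Y, M]) 2)
  have hY := Submodule.subset_span (R := MvPolynomial σ ℂ)
    (Set.mem_range_self (f := ![T, P, X, Y, M]) 3)
  have hM := Submodule.subset_span (R := MvPolynomial σ ℂ)
    (Set.mem_range_self (f := ![T, P, X, Y, M]) 4)
  refine mem_of_intCast_mul_eq 1 (add_mem (add_mem (add_mem (add_mem
    (algebraMap_mul_mem us (intCast_mul_mem 4 hT)) (algebraMap_mul_mem up hP))
    (algebraMap_mul_mem ux hX)) (algebraMap_mul_mem uy hY)) (algebraMap_mul_mem um hM)) ?_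
  simp only [Matrix.cons_val]
  push_cast
  linear_combination -h.euler - 2 * h.quadric

/-- The cubic monomials not involving the last coordinate reduce to lower degree. -/
theorem cubic_mem (h : ConormalRelations us up ux uy um T P X Y M) :
    ∀ i j k : Fin 4, ![T, P, X, Y] i * ![T, P, X, Y] j * ![T, P, X, Y] k ∈
      quadraticSpan (σ := σ) ![T, P, X, Y, M] := by
  set N := quadraticSpan (σ := σ) ![T, P, X, Y, M] with hN
  set V := Submodule.span (MvPolynomial σ ℂ) (Set.range ![T, P, X, Y, M]) with hV
  have hT : T ∈ V := Submodule.subset_span ⟨0, rfl⟩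
  have hP : P ∈ V := Submodule.subset_span ⟨1, rfl⟩
  have hX : X ∈ V := Submodule.subset_span ⟨2, rfl⟩
  have hY : Y ∈ V := Submodule.subset_span ⟨3, rfl⟩
  have hM : M ∈ V := Submodule.subset_span ⟨4, rfl⟩
  have hVV : ∀ {x y}, x ∈ V → y ∈ V → x * y ∈ N := fun hx hy => mul_mem hx hy
  have r₁ : ∀ {x}, x ∈ V → x * (5 * T * Y + 3 * P * X) ∈ N := fun hx => hVV hx h.torus₁_mem
  have r₂ : ∀ {x}, x ∈ V → x * (5 * T * X + 3 * P * Y) ∈ N := fun hx => hVV hx h.torus₂_mem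
  have r₀ : ∀ {x}, x ∈ V → x * (36 * T ^ 2 + 4 * P ^ 2 - X ^ 2 - Y ^ 2) ∈ N :=
    fun hx => hVV hx h.euler_mem
  have c₁ := cubic_difference_mem (us := us) (up := up) (ux := ux)
    (uy := uy) (um := um) h.quadric hT hP hX hY hM
    (add_mem (add_mem (add_mem (intCast_mul_mem 4 hT) hP) hX) hY)
    (sub_mem (add_mem (sub_mem (intCast_mul_mem 4 hT) hP) hX) hY)
    (sub_mem hY hT) (sub_mem hX (intCast_mul_mem 2 hP)) (us - uy) (up - ux)
    (by push_cast [map_sub]; linear_combination h.cubic₁)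
  have c₂ := cubic_difference_mem (us := us) (up := up) (ux := ux)
    (uy := uy) (um := um) h.quadric hT hP hX hY hM
    (sub_mem (sub_mem (add_mem (intCast_mul_mem 4 hT) hP) hX) hY)
    (sub_mem (add_mem (sub_mem (intCast_mul_mem 4 hT) hP) hX) hY)
    (neg_mem (add_mem hX hT)) (neg_mem (add_mem hY (intCast_mul_mem 2 hP))) (us + ux) (up + uy)
    (by push_cast [map_add]; linear_combination h.cubic₂)
  have c₃ := cubic_difference_mem (us := us) (up := up) (ux := ux)
    (uy := uy) (um := um) h.quadric hT hP hX hY hM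
    (sub_mem (add_mem (sub_mem (intCast_mul_mem 4 hT) hP) hX) hY)
    (add_mem (add_mem (add_mem (intCast_mul_mem 4 hT) hP) hX) hY)
    (neg_mem (add_mem hY hT)) (neg_mem (add_mem hX (intCast_mul_mem 2 hP))) (us + uy) (up + ux)
    (by push_cast [map_add]; linear_combination h.cubic₃)
  have c₄ := cubic_difference_mem (us := us) (up := up) (ux := ux)
    (uy := uy) (um := um) h.quadric hT hP hX hY hM
    (add_mem (sub_mem (sub_mem (intCast_mul_mem 4 hT) hP) hX) hY)
    (add_mem (add_mem (add_mem (intCast_mul_mem 4 hT) hP) hX) hY)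
    (neg_mem (add_mem hX hT)) (neg_mem (add_mem hY (intCast_mul_mem 2 hP))) (us + ux) (up + uy)
    (by push_cast [map_add]; linear_combination h.cubic₄)
  -- There are twenty relations for the twenty cubic monomials in four variables: four multiples of
  -- `segre`, twelve of the quadrics in `r₀`, `r₁`, `r₂`, and the four cubics `c₁` to `c₄`. The
  -- integers below solve this linear system.
  have hPXY : P * X * Y ∈ N := mem_of_intCast_mul_eq 64
    (add_mem (add_mem (add_mem (add_mem (add_mem (add_mem (add_mem (add_mem c₁
      c₂)
      c₃)
      c₄)
      (intCast_mul_mem (-56) (r₀ hT)))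
      (intCast_mul_mem (-8) (r₁ hP)))
      (intCast_mul_mem 12 (r₁ hY)))
      (intCast_mul_mem 4 (r₂ hT)))
      (intCast_mul_mem 12 (r₂ hX)))
    (by push_cast; linear_combination 24 * P * h.segre)
  have hPXX : P * X * X ∈ N := mem_of_intCast_mul_eq 768
    (add_mem (add_mem (add_mem (add_mem (add_mem (add_mem (add_mem (intCast_mul_mem (-5) c₁)
      (intCast_mul_mem (-5) c₂))
      (intCast_mul_mem 5 c₃))
      (intCast_mul_mem 5 c₄))
      (intCast_mul_mem 20 (r₁ hT)))
      (intCast_mul_mem 196 (r₁ hX)))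
      (intCast_mul_mem (-40) (r₂ hP)))
      (intCast_mul_mem (-60) (r₂ hY)))
    (by push_cast; linear_combination 640 * T * h.segre)
  have hPPX : P * P * X ∈ N := mem_of_intCast_mul_eq 768
    (add_mem (add_mem (add_mem (add_mem (add_mem (add_mem (add_mem (add_mem (intCast_mul_mem (-5) c₁)
      (intCast_mul_mem 5 c₂))
      (intCast_mul_mem (-5) c₃))
      (intCast_mul_mem 5 c₄))
      (intCast_mul_mem 120 (r₀ hX)))
      (intCast_mul_mem 136 (r₁ hP)))
      (intCast_mul_mem (-20) (r₁ hY)))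
      (intCast_mul_mem (-340) (r₂ hT)))
      (intCast_mul_mem 20 (r₂ hX)))
    (by push_cast; linear_combination 40 * Y * h.segre)
  have hPPY : P * P * Y ∈ N := mem_of_intCast_mul_eq 768
    (add_mem (add_mem (add_mem (add_mem (add_mem (add_mem (add_mem (add_mem (intCast_mul_mem (-5) c₁)
      (intCast_mul_mem 5 c₂))
      (intCast_mul_mem 5 c₃))
      (intCast_mul_mem (-5) c₄))
      (intCast_mul_mem 120 (r₀ hY)))
      (intCast_mul_mem (-340) (r₁ hT)))
      (intCast_mul_mem (-20) (r₁ hX)))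
      (intCast_mul_mem 136 (r₂ hP)))
      (intCast_mul_mem 20 (r₂ hY)))
    (by push_cast; linear_combination 40 * X * h.segre)
  have hTPP : T * P * P ∈ N := mem_of_intCast_mul_eq 4
    hPXY
    (by push_cast; linear_combination P * h.segre)
  have hTXX : T * X * X ∈ N := mem_of_intCast_mul_eq 5
    (add_mem (r₂ hX)
      (intCast_mul_mem (-3) hPXY))
    (by push_cast; ring)
  have hTYY : T * Y * Y ∈ N := mem_of_intCast_mul_eq 5
    (add_mem (r₁ hY)
      (intCast_mul_mem (-3) hPXY))
    (by push_cast; ring)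
  have hTTT : T * T * T ∈ N := mem_of_intCast_mul_eq 36
    (add_mem (add_mem (add_mem (r₀ hT)
      (intCast_mul_mem (-4) hTPP))
      hTXX)
      hTYY)
    (by push_cast; ring)
  have hTXY : T * X * Y ∈ N := mem_of_intCast_mul_eq 5
    (add_mem (r₁ hX)
      (intCast_mul_mem (-3) hPXX))
    (by push_cast; ring)
  have hPYY : P * Y * Y ∈ N := mem_of_intCast_mul_eq 3
    (add_mem (r₂ hY)
      (intCast_mul_mem (-5) hTXY))
    (by push_cast; ring)
  have hTTP : T * T * P ∈ N := mem_of_intCast_mul_eq 4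
    hTXY
    (by push_cast; linear_combination T * h.segre)
  have hPPP : P * P * P ∈ N := mem_of_intCast_mul_eq 4
    (add_mem (add_mem (add_mem (r₀ hP)
      (intCast_mul_mem (-36) hTTP))
      hPXX)
      hPYY)
    (by push_cast; ring)
  have hTPY : T * P * Y ∈ N := mem_of_intCast_mul_eq 5
    (add_mem (r₁ hP)
      (intCast_mul_mem (-3) hPPX))
    (by push_cast; ring)
  have hTPX : T * P * X ∈ N := mem_of_intCast_mul_eq 5
    (add_mem (r₂ hP)
      (intCast_mul_mem (-3) hPPY))
    (by push_cast; ring)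
  have hXYY : X * Y * Y ∈ N := mem_of_intCast_mul_eq 1
    (intCast_mul_mem 4 hTPY)
    (by push_cast; linear_combination -Y * h.segre)
  have hXXY : X * X * Y ∈ N := mem_of_intCast_mul_eq 1
    (intCast_mul_mem 4 hTPX)
    (by push_cast; linear_combination -X * h.segre)
  have hTTX : T * T * X ∈ N := mem_of_intCast_mul_eq 5
    (add_mem (r₂ hT)
      (intCast_mul_mem (-3) hTPY))
    (by push_cast; ring)
  have hTTY : T * T * Y ∈ N := mem_of_intCast_mul_eq 5
    (add_mem (r₁ hT)
      (intCast_mul_mem (-3) hTPX))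
    (by push_cast; ring)
  have hXXX : X * X * X ∈ N := mem_of_intCast_mul_eq 1
    (add_mem (add_mem (add_mem (intCast_mul_mem (-1) (r₀ hX))
      (intCast_mul_mem 36 hTTX))
      (intCast_mul_mem 4 hPPX))
      (intCast_mul_mem (-1) hXYY))
    (by push_cast; ring)
  have hYYY : Y * Y * Y ∈ N := mem_of_intCast_mul_eq 1
    (add_mem (add_mem (add_mem (intCast_mul_mem (-1) (r₀ hY))
      (intCast_mul_mem 36 hTTY))
      (intCast_mul_mem 4 hPPY))
      (intCast_mul_mem (-1) hXXY))
    (by push_cast; ring)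
  exact forall_triple (· ∈ N) hTTT hTTP hTTX hTTY hTPP hTPX hTPY hTXX hTXY hTYY
    hPPP hPPX hPPY hPXX hPXY hPYY hXXX hXXY hXYY hYYY

end ConormalRelations

end Span

/-! ### Stability of the span of sixteen monomials -/

section Span

variable {σ D : Type*} [CommRing D] [Algebra (MvPolynomial σ ℂ) D]

namespace ConormalRelations

variable {us up ux uy um : MvPolynomial σ ℂ} {T P X Y M : D}

/-- Monomials in the residual coordinates spanning, over `ℂ[σ]`, the maximal ideal at the origin of
the coordinate ring of the conormal variety. -/
def basisFamily (T P X Y M : D) : Fin 16 → D :=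
  ![T, P, X, Y, M, T * T, P * P, X * X, X * Y, P * X, P * Y, M * T, M * P, M * X, M * Y, M ^ 3]

/-- The span of the linear and quadratic monomials and of `M ^ 3`. -/
noncomputable def residualSpan (T P X Y M : D) : Submodule (MvPolynomial σ ℂ) D :=
  quadraticSpan ![T, P, X, Y, M] ⊔ Submodule.span _ {M ^ 3}

theorem span_family_eq :
    Submodule.span (MvPolynomial σ ℂ) (Set.range ![T, P, X, Y, M]) =
      Submodule.span (MvPolynomial σ ℂ) (Set.range ![T, P, X, Y]) ⊔
        Submodule.span (MvPolynomial σ ℂ) {M} := by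
  rw [← Submodule.span_union]
  congr 1
  ext x
  simp only [Matrix.range_cons, Matrix.range_empty, Set.union_empty, Set.mem_union,
    Set.mem_singleton_iff]
  tauto

theorem mul_quad_mem (h : ConormalRelations us up ux uy um T P X Y M) :
    ∀ i j : Fin 4, M * (![T, P, X, Y] i * ![T, P, X, Y] j) ∈
      residualSpan (σ := σ) T P X Y M := by
  set N := residualSpan (σ := σ) T P X Y M with hN
  set V := Submodule.span (MvPolynomial σ ℂ) (Set.range ![T, P, X, Y, M]) with hV
  have hT : T ∈ V := Submodule.subset_span ⟨0, rfl⟩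
  have hP : P ∈ V := Submodule.subset_span ⟨1, rfl⟩
  have hX : X ∈ V := Submodule.subset_span ⟨2, rfl⟩
  have hY : Y ∈ V := Submodule.subset_span ⟨3, rfl⟩
  have hM : M ∈ V := Submodule.subset_span ⟨4, rfl⟩
  have hV₁ : ∀ {x}, x ∈ V → x ∈ N := fun hx =>
    Submodule.mem_sup_left (Submodule.mem_sup_left hx)
  have hVV : ∀ {x y}, x ∈ V → y ∈ V → x * y ∈ N := fun hx hy =>
    Submodule.mem_sup_left (mul_mem hx hy)
  have hMMM : M ^ 3 ∈ N := Submodule.mem_sup_right (Submodule.mem_span_singleton_self _)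
  -- Modulo `M ^ 3`, ten relations determine the ten products of `M` with a quadratic monomial: `ha`
  -- to `hg`, `mixed`, and the multiples by `M` of `segre` and `quadric`.
  have ha : M * (36 * T ^ 2 - 4 * P ^ 2) ∈ N := by
    refine mem_of_intCast_mul_eq 1 (add_mem (add_mem (algebraMap_mul_mem us
      (intCast_mul_mem 4 (hVV hM hT))) (algebraMap_mul_mem (-up) (hVV hM hP)))
      (algebraMap_mul_mem um (sub_mem (intCast_mul_mem 16 (hVV hT hT)) (hVV hP hP)))) ?_
    push_cast [map_neg]
    linear_combination -h.corner₁
  have hb : M * (X ^ 2 - Y ^ 2) ∈ N := by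
    refine mem_of_intCast_mul_eq 1 (add_mem (add_mem (algebraMap_mul_mem (-ux) (hVV hM hX))
      (algebraMap_mul_mem uy (hVV hM hY)))
      (algebraMap_mul_mem um (sub_mem (hVV hX hX) (hVV hY hY)))) ?_
    push_cast [map_neg]
    linear_combination h.corner₂
  have hc := hVV hM h.euler_mem
  have hd := hVV hM h.torus₁_mem
  have he := hVV hM h.torus₂_mem
  have hf : M * (9 * T * Y - P * X) ∈ N := by
    refine mem_of_intCast_mul_eq 1 (add_mem (add_mem (algebraMap_mul_mem us (hVV hM hY))
      (algebraMap_mul_mem ux (hVV hM hP)))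
      (algebraMap_mul_mem um (sub_mem (intCast_mul_mem 4 (hVV hT hY)) (hVV hP hX)))) ?_
    push_cast
    linear_combination -h.corner₃
  have hg : M * (9 * T * X - P * Y) ∈ N := by
    refine mem_of_intCast_mul_eq 1 (add_mem (add_mem (algebraMap_mul_mem us (hVV hM hX))
      (algebraMap_mul_mem uy (hVV hM hP)))
      (algebraMap_mul_mem um (sub_mem (intCast_mul_mem 4 (hVV hT hX)) (hVV hP hY)))) ?_
    push_cast
    linear_combination -h.corner₄
  -- The cubic part of `mixed` is `20MTP + 3MXY`, which `segre` turns into `8MXY`.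
  have hMXY : M * (X * Y) ∈ N := by
    have m₁ := algebraMap_mul_mem (ux * uy - us * up) (hV₁ hM)
    have m₂ := algebraMap_mul_mem us (intCast_mul_mem 4 (hVV hM hP))
    have m₃ := algebraMap_mul_mem up (intCast_mul_mem 9 (hVV hM hT))
    have m₄ := algebraMap_mul_mem ux (hVV hM hY)
    have m₅ := algebraMap_mul_mem uy (hVV hM hX)
    have m₆ := algebraMap_mul_mem um (add_mem (intCast_mul_mem 9 (hVV hT hP))
      (intCast_mul_mem 2 (hVV hX hY)))
    have m₇ := algebraMap_mul_mem (um * up) (intCast_mul_mem (-4) (hV₁ hT))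
    have m₈ := algebraMap_mul_mem (um * us) (intCast_mul_mem (-1) (hV₁ hP))
    have m₉ := algebraMap_mul_mem (um * uy) (intCast_mul_mem (-1) (hV₁ hX))
    have m₀ := algebraMap_mul_mem (um * ux) (intCast_mul_mem (-1) (hV₁ hY))
    refine mem_of_intCast_mul_eq 8 (add_mem (add_mem (add_mem (add_mem (add_mem (add_mem (add_mem
      (add_mem (add_mem m₁ m₂) m₃) m₄) m₅) m₆) m₇) m₈) m₉) m₀) ?_
    push_cast [map_mul, map_sub]
    linear_combination h.mixed - 5 * M * h.segre
  have hMTP : M * (T * P) ∈ N := mem_of_intCast_mul_eq 4 hMXY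
    (by push_cast; linear_combination M * h.segre)
  have hMTT : M * (T * T) ∈ N := mem_of_intCast_mul_eq 188
    (add_mem (add_mem (intCast_mul_mem (-4) hMMM) (intCast_mul_mem 3 ha)) (intCast_mul_mem 4 hc))
    (by push_cast; linear_combination 4 * M * h.quadric)
  have hMPP : M * (P * P) ∈ N := mem_of_intCast_mul_eq 4
    (sub_mem (intCast_mul_mem 36 hMTT) ha) (by push_cast; ring)
  have hMXX : M * (X * X) ∈ N := mem_of_intCast_mul_eq 2
    (sub_mem (add_mem (add_mem hb (intCast_mul_mem 36 hMTT)) (intCast_mul_mem 4 hMPP)) hc)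
    (by push_cast; ring)
  have hMYY : M * (Y * Y) ∈ N := mem_of_intCast_mul_eq 1 (sub_mem hMXX hb) (by push_cast; ring)
  have hMTY : M * (T * Y) ∈ N := mem_of_intCast_mul_eq 32 (add_mem hd (intCast_mul_mem 3 hf))
    (by push_cast; ring)
  have hMTX : M * (T * X) ∈ N := mem_of_intCast_mul_eq 32 (add_mem he (intCast_mul_mem 3 hg))
    (by push_cast; ring)
  have hMPX : M * (P * X) ∈ N := mem_of_intCast_mul_eq 1 (sub_mem (intCast_mul_mem 9 hMTY) hf)
    (by push_cast; ring)
  have hMPY : M * (P * Y) ∈ N := mem_of_intCast_mul_eq 1 (sub_mem (intCast_mul_mem 9 hMTX) hg)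
    (by push_cast; ring)
  clear_value N V
  intro i j
  wlog hij : i ≤ j generalizing i j
  · rw [mul_comm (![T, P, X, Y] i)]
    exact this j i (le_of_not_ge hij)
  fin_cases i <;> fin_cases j <;> first
    | exact absurd hij (by decide)
    | with_reducible simpa using ‹_›

theorem mul_M_sq_mem (h : ConormalRelations us up ux uy um T P X Y M) (i : Fin 4) :
    ![T, P, X, Y] i * M ^ 2 ∈ quadraticSpan (σ := σ) ![T, P, X, Y, M] := by
  have c := h.cubic_mem i
  refine mem_of_intCast_mul_eq 1 (sub_mem (sub_mem (add_mem (intCast_mul_mem 16 (c 0 0)) (c 1 1))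
    (c 2 2)) (c 3 3)) ?_
  rw [h.quadric]
  simp only [Matrix.cons_val]
  push_cast
  ring

/-- Split a cubic monomial by its degree in `M`. Degrees zero and two reduce to `quadraticSpan`;
degrees one and three are where `M ^ 3` is needed. -/
theorem span_mul_span_mul_span_le (h : ConormalRelations us up ux uy um T P X Y M) :
    Submodule.span (MvPolynomial σ ℂ) (Set.range ![T, P, X, Y, M]) *
      Submodule.span (MvPolynomial σ ℂ) (Set.range ![T, P, X, Y, M]) *
        Submodule.span (MvPolynomial σ ℂ) (Set.range ![T, P, X, Y, M]) ≤
      residualSpan (σ := σ) T P X Y M := by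
  rw [span_family_eq]
  set W := Submodule.span (MvPolynomial σ ℂ) (Set.range ![T, P, X, Y]) with hW
  set S := Submodule.span (MvPolynomial σ ℂ) {M} with hS
  have h₁ : W * W * W ≤ residualSpan T P X Y M := by
    rw [hW, Submodule.span_mul_span, Submodule.span_mul_span, Submodule.span_le]
    rintro _ ⟨_, ⟨_, ⟨i, rfl⟩, _, ⟨j, rfl⟩, rfl⟩, _, ⟨k, rfl⟩, rfl⟩
    exact Submodule.mem_sup_left (h.cubic_mem i j k)
  have h₂ : W * W * S ≤ residualSpan T P X Y M := by
    rw [hW, hS, Submodule.span_mul_span, Submodule.span_mul_span, Submodule.span_le]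
    rintro _ ⟨_, ⟨_, ⟨i, rfl⟩, _, ⟨j, rfl⟩, rfl⟩, _, rfl, rfl⟩
    beta_reduce
    rw [mul_comm]
    exact h.mul_quad_mem i j
  have h₃ : W * S * S ≤ residualSpan T P X Y M := by
    rw [hW, hS, Submodule.span_mul_span, Submodule.span_mul_span, Submodule.span_le]
    rintro _ ⟨_, ⟨_, ⟨i, rfl⟩, _, rfl, rfl⟩, _, rfl, rfl⟩
    refine Submodule.mem_sup_left ?_
    have := h.mul_M_sq_mem i
    rwa [sq, ← mul_assoc] at this
  have h₄ : S * S * S ≤ residualSpan T P X Y M := by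
    rw [hS, Submodule.span_mul_span, Submodule.span_mul_span, Submodule.span_le]
    rintro _ ⟨_, ⟨_, rfl, _, rfl, rfl⟩, _, rfl, rfl⟩
    refine Submodule.mem_sup_right (Submodule.mem_span_singleton.2 ⟨1, ?_⟩)
    rw [one_smul]
    ring
  have e₁ : W * S * W = W * W * S := by rw [mul_assoc, mul_comm S W, mul_assoc]
  have e₂ : S * W * W = W * W * S := by rw [mul_assoc, mul_comm S]
  have e₃ : S * W * S = W * S * S := by rw [mul_comm S W]
  have e₄ : S * S * W = W * S * S := by rw [mul_comm, mul_assoc]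
  simp only [Submodule.mul_sup, Submodule.sup_mul, sup_le_iff, e₁, e₂, e₃, e₄]
  exact ⟨⟨⟨h₁, h₂⟩, h₂, h₃⟩, ⟨h₂, h₃⟩, h₃, h₄⟩

theorem mul_mem_residualSpan_of_mem_quadraticSpan
    (h : ConormalRelations us up ux uy um T P X Y M) {v x : D}
    (hv : v ∈ Submodule.span (MvPolynomial σ ℂ) (Set.range ![T, P, X, Y, M]))
    (hx : x ∈ quadraticSpan (σ := σ) ![T, P, X, Y, M]) :
    v * x ∈ residualSpan (σ := σ) T P X Y M := by
  obtain ⟨y, hy, z, hz, rfl⟩ := Submodule.mem_sup.1 hx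
  rw [mul_add]
  refine add_mem (Submodule.mem_sup_left (mul_mem hv hy)) (h.span_mul_span_mul_span_le ?_)
  rw [mul_comm v z]
  exact Submodule.mul_mem_mul hz hv

theorem mul_mem_residualSpan (h : ConormalRelations us up ux uy um T P X Y M) (i : Fin 5) {x : D}
    (hx : x ∈ residualSpan (σ := σ) T P X Y M) :
    ![T, P, X, Y, M] i * x ∈ residualSpan (σ := σ) T P X Y M := by
  have hV : ∀ i : Fin 5, ![T, P, X, Y, M] i ∈
      Submodule.span (MvPolynomial σ ℂ) (Set.range ![T, P, X, Y, M]) := fun i =>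
    Submodule.subset_span ⟨i, rfl⟩
  have hlow : ∀ j : Fin 4, ![T, P, X, Y] j * M ^ 3 ∈ residualSpan (σ := σ) T P X Y M := by
    intro j
    rw [pow_succ' M 2, mul_left_comm]
    exact h.mul_mem_residualSpan_of_mem_quadraticSpan (hV 4) (h.mul_M_sq_mem j)
  -- By `quadric`, `M⁴` is a combination of the products `v · (v · M²)` with `v` among `T, P, X, Y`,
  -- and the inner factor already lies in `quadraticSpan`.
  have htop : M * M ^ 3 ∈ residualSpan (σ := σ) T P X Y M := by
    have c : ∀ j : Fin 5, ∀ k : Fin 4, ![T, P, X, Y, M] j * (![T, P, X, Y] k * M ^ 2) ∈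
        residualSpan (σ := σ) T P X Y M := fun j k =>
      h.mul_mem_residualSpan_of_mem_quadraticSpan (hV j) (h.mul_M_sq_mem k)
    refine mem_of_intCast_mul_eq 1 (sub_mem (sub_mem (add_mem (intCast_mul_mem 16 (c 0 0)) (c 1 1))
      (c 2 2)) (c 3 3)) ?_
    simp only [Matrix.cons_val]
    push_cast
    linear_combination M ^ 2 * h.quadric
  obtain ⟨y, hy, z, hz, rfl⟩ := Submodule.mem_sup.1 hx
  obtain ⟨r, rfl⟩ := Submodule.mem_span_singleton.1 hz
  rw [mul_add, mul_smul_comm]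
  refine add_mem (h.mul_mem_residualSpan_of_mem_quadraticSpan (hV i) hy)
    (Submodule.smul_mem _ _ ?_)
  refine Fin.lastCases htop (fun j => ?_) i
  have : ![T, P, X, Y, M] j.castSucc = ![T, P, X, Y] j := by fin_cases j <;> rfl
  rw [this]
  exact hlow j

/-- The count: five linear monomials; fifteen quadratic ones less the five quadratic relations
`segre`, `quadric`, `euler`, `torus₁`, `torus₂`; and `M ^ 3`. This makes `5 + 10 + 1 = 16`. -/
theorem residualSpan_eq (h : ConormalRelations us up ux uy um T P X Y M) :
    residualSpan (σ := σ) T P X Y M =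
      Submodule.span (MvPolynomial σ ℂ) (Set.range (basisFamily T P X Y M)) := by
  have hV : ∀ i : Fin 5, ![T, P, X, Y, M] i ∈
      Submodule.span (MvPolynomial σ ℂ) (Set.range ![T, P, X, Y, M]) := fun i =>
    Submodule.subset_span ⟨i, rfl⟩
  apply le_antisymm
  · set B := Submodule.span (MvPolynomial σ ℂ) (Set.range (basisFamily T P X Y M)) with hB
    have hb : ∀ i, basisFamily T P X Y M i ∈ B := fun i => Submodule.subset_span ⟨i, rfl⟩
    have hVB : Submodule.span (MvPolynomial σ ℂ) (Set.range ![T, P, X, Y, M]) ≤ B := by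
      rw [Submodule.span_le]
      rintro _ ⟨i, rfl⟩
      fin_cases i
      exacts [hb 0, hb 1, hb 2, hb 3, hb 4]
    have hTP : T * P ∈ B := mem_of_intCast_mul_eq 4 (hb 8)
      (by simp only [basisFamily, Matrix.cons_val]; push_cast; linear_combination h.segre)
    have hTX : T * X ∈ B := mem_of_intCast_mul_eq 5
      (sub_mem (hVB h.torus₂_mem) (intCast_mul_mem 3 (hb 10)))
      (by simp only [basisFamily, Matrix.cons_val]; push_cast; ring)
    have hTY : T * Y ∈ B := mem_of_intCast_mul_eq 5
      (sub_mem (hVB h.torus₁_mem) (intCast_mul_mem 3 (hb 9)))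
      (by simp only [basisFamily, Matrix.cons_val]; push_cast; ring)
    have hYY : Y * Y ∈ B := mem_of_intCast_mul_eq 1
      (sub_mem (sub_mem (add_mem (intCast_mul_mem 36 (hb 5)) (intCast_mul_mem 4 (hb 6))) (hb 7))
        (hVB h.euler_mem))
      (by simp only [basisFamily, Matrix.cons_val]; push_cast; ring)
    have hMM : M * M ∈ B := mem_of_intCast_mul_eq 1
      (sub_mem (sub_mem (add_mem (intCast_mul_mem 16 (hb 5)) (hb 6)) (hb 7)) hYY)
      (by simp only [basisFamily, Matrix.cons_val]; push_cast; linear_combination h.quadric)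
    refine sup_le (sup_le hVB ?_) ?_
    · have key : ∀ i j : Fin 5, i ≤ j → ![T, P, X, Y, M] i * ![T, P, X, Y, M] j ∈ B := by
        have hPX : P * X ∈ B := hb 9
        have hPY : P * Y ∈ B := hb 10
        have hXY : X * Y ∈ B := hb 8
        have hTM : T * M ∈ B := mul_comm M T ▸ hb 11
        have hPM : P * M ∈ B := mul_comm M P ▸ hb 12
        have hXM : X * M ∈ B := mul_comm M X ▸ hb 13
        have hYM : Y * M ∈ B := mul_comm M Y ▸ hb 14
        have hTT : T * T ∈ B := hb 5
        have hPP : P * P ∈ B := hb 6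
        have hXX : X * X ∈ B := hb 7
        clear_value B
        intro i j hij
        fin_cases i <;> fin_cases j <;> first
          | exact absurd hij (by decide)
          | assumption
      rw [Submodule.span_mul_span, Submodule.span_le]
      rintro _ ⟨_, ⟨i, rfl⟩, _, ⟨j, rfl⟩, rfl⟩
      rcases le_total i j with hij | hij
      · exact key i j hij
      · change ![T, P, X, Y, M] i * ![T, P, X, Y, M] j ∈ B
        rw [mul_comm]
        exact key j i hij
    · rw [Submodule.span_singleton_le_iff_mem]
      exact hb 15
  · rw [Submodule.span_le]
    rintro _ ⟨i, rfl⟩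
    have h₁ : ∀ i, ![T, P, X, Y, M] i ∈ residualSpan (σ := σ) T P X Y M := fun i =>
      Submodule.mem_sup_left (lin_mem _ i)
    have h₂ : ∀ i j, ![T, P, X, Y, M] i * ![T, P, X, Y, M] j ∈ residualSpan (σ := σ) T P X Y M :=
      fun i j => Submodule.mem_sup_left (mul_mem (hV i) (hV j))
    fin_cases i
    exacts [h₁ 0, h₁ 1, h₁ 2, h₁ 3, h₁ 4, h₂ 0 0, h₂ 1 1, h₂ 2 2, h₂ 2 3, h₂ 1 2, h₂ 1 3, h₂ 4 0,
      h₂ 4 1, h₂ 4 2, h₂ 4 3, Submodule.mem_sup_right (Submodule.mem_span_singleton_self _)]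

theorem mul_basisFamily_mem (h : ConormalRelations us up ux uy um T P X Y M) (i : Fin 5)
    (j : Fin 16) : ![T, P, X, Y, M] i * basisFamily T P X Y M j ∈
      Submodule.span (MvPolynomial σ ℂ) (Set.range (basisFamily T P X Y M)) := by
  have hj : basisFamily T P X Y M j ∈
      Submodule.span (MvPolynomial σ ℂ) (Set.range (basisFamily T P X Y M)) :=
    Submodule.subset_span ⟨j, rfl⟩
  rw [← h.residualSpan_eq] at hj ⊢
  exact h.mul_mem_residualSpan i hj

theorem basisFamily_mem_adjoin (j : Fin 16) : basisFamily T P X Y M j ∈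
    Algebra.adjoin (MvPolynomial σ ℂ) (Set.range ![T, P, X, Y, M]) := by
  have hV : ∀ i : Fin 5, ![T, P, X, Y, M] i ∈
      Algebra.adjoin (MvPolynomial σ ℂ) (Set.range ![T, P, X, Y, M]) := fun i =>
    Algebra.subset_adjoin ⟨i, rfl⟩
  have h₂ : ∀ i j : Fin 5, ![T, P, X, Y, M] i * ![T, P, X, Y, M] j ∈
      Algebra.adjoin (MvPolynomial σ ℂ) (Set.range ![T, P, X, Y, M]) := fun i j =>
    Subalgebra.mul_mem _ (hV i) (hV j)
  fin_cases j
  exacts [hV 0, hV 1, hV 2, hV 3, hV 4, h₂ 0 0, h₂ 1 1, h₂ 2 2, h₂ 2 3, h₂ 1 2, h₂ 1 3, h₂ 4 0,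
    h₂ 4 1, h₂ 4 2, h₂ 4 3, Subalgebra.pow_mem _ (hV 4) 3]

end ConormalRelations

end Span

/-! ### Parametrisation of the conormal variety -/

section Conormal

open MvPolynomial (eval aeval)

/-- The autocovariances of the coefficients `a = a₀₀`, `b = a₀₁`, `c = a₁₀`, `d = a₁₁`, at the lags
`(0,0)`, `(0,1)`, `(1,0)`, `(1,1)`, `(1,-1)`. -/
def covariancePoint {S : Type*} [CommRing S] (a b c d : S) : Fin 5 → S :=
  ![a ^ 2 + b ^ 2 + c ^ 2 + d ^ 2, a * b + c * d, a * c + b * d, a * d, b * c]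

/-- The coordinates `T, P, X, Y, M` of a normal vector of the autocovariance cone at
`covariancePoint a b c d`. -/
def normalCoords {S : Type*} [CommRing S] (a b c d : S) : Fin 5 → S :=
  ![(a * c - b * d) * (a * b - c * d), (a ^ 2 - d ^ 2) ^ 2 - (b ^ 2 - c ^ 2) ^ 2,
    2 * (b * d - a * c) * (a ^ 2 - d ^ 2 + b ^ 2 - c ^ 2),
    2 * (a * b - c * d) * (b ^ 2 - c ^ 2 - a ^ 2 + d ^ 2),
    (a + b + c + d) * (a + d - b - c) * (a - d + b - c) * (a - d - b + c)]

/-- The vector with coordinates `T, P, X, Y, M`, expressed in the lag coordinates. -/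
def lagVector {S : Type*} [CommRing S] (v : Fin 5 → S) : Fin 5 → S :=
  ![2 * v 0, v 2, v 3, v 1 - v 4, v 1 + v 4]

/-- The equation of the autocovariance cone. -/
noncomputable def conePoly : MvPolynomial (Fin 5) ℂ :=
  (.X 1 * .X 2 - .X 3 * .X 0) * (.X 1 * .X 2 - .X 4 * .X 0) +
    (.X 1 ^ 2 + .X 2 ^ 2 - 4 * .X 3 * .X 4) * (.X 4 - .X 3) ^ 2

theorem aeval_conePoly {S : Type*} [CommRing S] [Algebra ℂ S] (x : Fin 5 → S) :
    aeval x conePoly = (x 1 * x 2 - x 3 * x 0) * (x 1 * x 2 - x 4 * x 0) +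
      (x 1 ^ 2 + x 2 ^ 2 - 4 * x 3 * x 4) * (x 4 - x 3) ^ 2 := by
  simp [conePoly]

theorem aeval_covariancePoint_conePoly {S : Type*} [CommRing S] [Algebra ℂ S] (a b c d : S) :
    aeval (covariancePoint a b c d) conePoly = 0 := by
  rw [aeval_conePoly]
  simp only [covariancePoint, Matrix.cons_val]
  ring

/-- The gradient of the equation of the autocovariance cone. -/
def coneGradient {S : Type*} [CommRing S] (x : Fin 5 → S) : Fin 5 → S :=
  ![-(x 3 * (x 1 * x 2 - x 4 * x 0)) - x 4 * (x 1 * x 2 - x 3 * x 0),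
    x 2 * (2 * (x 1 * x 2) - x 3 * x 0 - x 4 * x 0) + 2 * x 1 * (x 4 - x 3) ^ 2,
    x 1 * (2 * (x 1 * x 2) - x 3 * x 0 - x 4 * x 0) + 2 * x 2 * (x 4 - x 3) ^ 2,
    -(x 0 * (x 1 * x 2 - x 4 * x 0)) - 4 * x 4 * (x 4 - x 3) ^ 2 -
      2 * (x 1 ^ 2 + x 2 ^ 2 - 4 * x 3 * x 4) * (x 4 - x 3),
    -(x 0 * (x 1 * x 2 - x 3 * x 0)) - 4 * x 3 * (x 4 - x 3) ^ 2 +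
      2 * (x 1 ^ 2 + x 2 ^ 2 - 4 * x 3 * x 4) * (x 4 - x 3)]

theorem aeval_pderiv_conePoly {S : Type*} [CommRing S] [Algebra ℂ S] (x : Fin 5 → S) (i : Fin 5) :
    aeval x (MvPolynomial.pderiv i conePoly) = coneGradient x i := by
  have h4 : ∀ i, MvPolynomial.pderiv i (4 : MvPolynomial (Fin 5) ℂ) = 0 := fun i => by
    exact_mod_cast (MvPolynomial.pderiv i : Derivation ℂ (MvPolynomial (Fin 5) ℂ) _).map_natCast 4
  fin_cases i <;>
    simp [conePoly, coneGradient, MvPolynomial.pderiv_X, h4] <;> ring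

/-- The gradient of the equation is proportional to the normal vector. -/
theorem two_mul_coneGradient_covariancePoint {S : Type*} [CommRing S] (a b c d : S) (i : Fin 5) :
    2 * coneGradient (covariancePoint a b c d) i =
      (a * d - b * c) * lagVector (normalCoords a b c d) i := by
  fin_cases i <;>
    simp only [coneGradient, covariancePoint, lagVector, normalCoords, Fin.isValue, Fin.mk_one,
      Fin.zero_eta, Fin.reduceFinMk, Matrix.cons_val] <;>
    ring

/-- The parameter ring of the conormal variety of the autocovariance cone: polynomials in the
coefficients `a, b, c, d` and in the scaling `k` of the normal vector. -/
def ConormalRing : Type := MvPolynomial (Fin 5) ℂ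

namespace ConormalRing

noncomputable instance : CommRing ConormalRing :=
  inferInstanceAs (CommRing (MvPolynomial (Fin 5) ℂ))

instance : IsDomain ConormalRing := inferInstanceAs (IsDomain (MvPolynomial (Fin 5) ℂ))

noncomputable instance : Algebra ℂ ConormalRing :=
  inferInstanceAs (Algebra ℂ (MvPolynomial (Fin 5) ℂ))

/-- The parameters `a, b, c, d, k`. -/
noncomputable def param (i : Fin 5) : ConormalRing := (MvPolynomial.X i : MvPolynomial (Fin 5) ℂ)

/-- The generic point of the cone. -/
noncomputable def point : Fin 5 → ConormalRing :=
  covariancePoint (param 0) (param 1) (param 2) (param 3)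

/-- The generic normal vector. -/
noncomputable def normal (i : Fin 5) : ConormalRing :=
  param 4 * normalCoords (param 0) (param 1) (param 2) (param 3) i

/-- The variables of `ℂ[u]` act as point plus normal vector. A separate type is needed because the
polynomial ring already is an algebra over itself by the identity. -/
noncomputable instance : Algebra (MvPolynomial (Fin 5) ℂ) ConormalRing :=
  (aeval fun i => point i + lagVector normal i : MvPolynomial (Fin 5) ℂ →ₐ[ℂ] ConormalRing).toAlgebra

theorem algebraMap_apply (p : MvPolynomial (Fin 5) ℂ) :
    algebraMap (MvPolynomial (Fin 5) ℂ) ConormalRing p =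
      aeval (fun i => point i + lagVector normal i) p := rfl

instance : IsScalarTower ℂ (MvPolynomial (Fin 5) ℂ) ConormalRing :=
  IsScalarTower.of_algebraMap_eq fun c => by
    rw [algebraMap_apply, MvPolynomial.algebraMap_eq, MvPolynomial.aeval_C]

theorem algebraMap_X (i : Fin 5) :
    algebraMap (MvPolynomial (Fin 5) ℂ) ConormalRing (.X i) = point i + lagVector normal i := by
  rw [algebraMap_apply, MvPolynomial.aeval_X]

/-- Evaluation of the parameters. -/
noncomputable def evalHom (θ : Fin 5 → ℂ) : ConormalRing →ₐ[ℂ] ℂ :=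
  (aeval θ : MvPolynomial (Fin 5) ℂ →ₐ[ℂ] ℂ)

theorem evalHom_param (θ : Fin 5 → ℂ) (i : Fin 5) : evalHom θ (param i) = θ i :=
  MvPolynomial.aeval_X (R := ℂ) θ i

theorem evalHom_eq_eval (θ : Fin 5 → ℂ) (p : MvPolynomial (Fin 5) ℂ) :
    evalHom θ p = eval θ p :=
  DFunLike.congr_fun (MvPolynomial.coe_aeval_eq_eval θ) p

theorem ext_evalHom {p q : ConormalRing} (h : ∀ θ, evalHom θ p = evalHom θ q) : p = q :=
  MvPolynomial.funext (R := ℂ) (σ := Fin 5) fun θ =>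
    (evalHom_eq_eval θ p).symm.trans ((h θ).trans (evalHom_eq_eval θ q))

theorem evalHom_point (θ : Fin 5 → ℂ) (i : Fin 5) :
    evalHom θ (point i) = covariancePoint (θ 0) (θ 1) (θ 2) (θ 3) i := by
  fin_cases i <;> simp [point, covariancePoint, evalHom_param]

theorem evalHom_normal (θ : Fin 5 → ℂ) (i : Fin 5) :
    evalHom θ (normal i) = θ 4 * normalCoords (θ 0) (θ 1) (θ 2) (θ 3) i := by
  fin_cases i <;> simp [normal, normalCoords, evalHom_param, map_ofNat]

theorem map_lagVector {S S' : Type*} [CommRing S] [CommRing S'] (φ : S →+* S') (v : Fin 5 → S)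
    (i : Fin 5) : φ (lagVector v i) = lagVector (fun j => φ (v j)) i := by
  fin_cases i <;> simp [lagVector, map_ofNat]

theorem evalHom_algebraMap_X (θ : Fin 5 → ℂ) (i : Fin 5) :
    evalHom θ (algebraMap (MvPolynomial (Fin 5) ℂ) ConormalRing (.X i)) =
      covariancePoint (θ 0) (θ 1) (θ 2) (θ 3) i +
        lagVector (fun j => θ 4 * normalCoords (θ 0) (θ 1) (θ 2) (θ 3) j) i := by
  rw [algebraMap_X, map_add, evalHom_point]
  congr 1
  refine (map_lagVector (evalHom θ).toRingHom normal i).trans ?_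
  congr 1
  funext j
  exact evalHom_normal θ j

theorem evalHom_algebraMap_C (θ : Fin 5 → ℂ) (c : ℂ) :
    evalHom θ (algebraMap (MvPolynomial (Fin 5) ℂ) ConormalRing (.C c)) = c := by
  rw [algebraMap_apply, MvPolynomial.aeval_C]
  exact (evalHom θ).commutes c

-- The five linear forms in `u` are half the variance, the sum of the last two lags, the lags
-- `(0,1)` and `(1,0)`, and the difference of the last two. In these coordinates every relation is a
-- polynomial identity in the parameters.
set_option maxHeartbeats 1000000 in
theorem conormalRelations : ConormalRelations (σ := Fin 5) (D := ConormalRing)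
    (.C (1 / 2) * .X 0) (.X 3 + .X 4) (.X 1) (.X 2) (.X 4 - .X 3)
    (normal 0) (normal 1) (normal 2) (normal 3) (normal 4) := by
  constructor <;> refine ext_evalHom fun θ => ?_ <;>
    simp only [map_add, map_sub, map_mul, map_pow, map_zero, map_ofNat, evalHom_algebraMap_X,
      evalHom_algebraMap_C, evalHom_normal, covariancePoint, normalCoords, lagVector,
      Matrix.cons_val] <;>
    ring

end ConormalRing

end Conormal

/-! ### Integrality over the data and algebraic independence -/

section Conormal

open MvPolynomial (eval aeval)

namespace ConormalRing

/-- The residual coordinates. -/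
noncomputable def resid : Fin 5 → ConormalRing :=
  ![normal 0, normal 1, normal 2, normal 3, normal 4]

theorem resid_eq : resid = normal := by
  funext i
  fin_cases i <;> rfl

/-- The spanning family of the residual ideal. -/
noncomputable def basis : Fin 16 → ConormalRing :=
  ConormalRelations.basisFamily (normal 0) (normal 1) (normal 2) (normal 3) (normal 4)

theorem resid_mul_basis_mem (i : Fin 5) (j : Fin 16) : resid i * basis j ∈
    Submodule.span (MvPolynomial (Fin 5) ℂ) (Set.range basis) :=
  conormalRelations.mul_basisFamily_mem i j

theorem basis_mem_adjoin (j : Fin 16) :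
    basis j ∈ Algebra.adjoin (MvPolynomial (Fin 5) ℂ) (Set.range resid) :=
  ConormalRelations.basisFamily_mem_adjoin j

theorem resid_mem_adjoin (i : Fin 5) :
    normal i ∈ Algebra.adjoin (MvPolynomial (Fin 5) ℂ) (Set.range resid) := by
  rw [resid_eq]
  exact Algebra.subset_adjoin ⟨i, rfl⟩

theorem normal_mem_span (i : Fin 5) :
    normal i ∈ Submodule.span (MvPolynomial (Fin 5) ℂ) (Set.range basis) := by
  have h : ∀ j, basis j ∈ Submodule.span (MvPolynomial (Fin 5) ℂ) (Set.range basis) := fun j =>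
    Submodule.subset_span ⟨j, rfl⟩
  fin_cases i
  exacts [h 0, h 1, h 2, h 3, h 4]

theorem lagVector_mem {S : Type*} [CommRing S] {R : Type*} [CommRing R] [Algebra R S]
    (N : Submodule R S) {v : Fin 5 → S} (hv : ∀ i, v i ∈ N) (i : Fin 5) : lagVector v i ∈ N := by
  have h2 : 2 * v 0 ∈ N := by
    rw [two_mul]
    exact add_mem (hv 0) (hv 0)
  fin_cases i
  exacts [h2, hv 2, hv 3, sub_mem (hv 1) (hv 4), add_mem (hv 1) (hv 4)]

theorem point_eq (i : Fin 5) : point i =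
    algebraMap (MvPolynomial (Fin 5) ℂ) ConormalRing (.X i) - lagVector normal i := by
  rw [algebraMap_X, add_sub_cancel_right]

theorem point_mem_adjoin (i : Fin 5) :
    point i ∈ Algebra.adjoin (MvPolynomial (Fin 5) ℂ) (Set.range resid) := by
  rw [point_eq]
  exact sub_mem (Subalgebra.algebraMap_mem _ _)
    (lagVector_mem (Subalgebra.toSubmodule (Algebra.adjoin _ (Set.range resid)))
      resid_mem_adjoin i)

theorem aeval_point_mem_adjoin (p : MvPolynomial (Fin 5) ℂ) :
    aeval point p ∈ Algebra.adjoin (MvPolynomial (Fin 5) ℂ) (Set.range resid) := by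
  induction p using MvPolynomial.induction_on with
  | C c =>
    rw [MvPolynomial.aeval_C, IsScalarTower.algebraMap_apply ℂ (MvPolynomial (Fin 5) ℂ)]
    exact Subalgebra.algebraMap_mem _ _
  | add p q hp hq =>
    rw [map_add]
    exact add_mem hp hq
  | mul_X p i hp =>
    rw [map_mul, MvPolynomial.aeval_X]
    exact mul_mem hp (point_mem_adjoin i)

/-- Since `u - x` is linear in the residual coordinates, `p(u) - p(x)` lies in the ideal that they
generate, and the span absorbs multiplication by the subalgebra. -/
theorem algebraMap_sub_aeval_point_mem (p : MvPolynomial (Fin 5) ℂ) :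
    algebraMap _ ConormalRing p - aeval point p ∈
      Submodule.span (MvPolynomial (Fin 5) ℂ) (Set.range basis) := by
  induction p using MvPolynomial.induction_on with
  | C c =>
    rw [MvPolynomial.aeval_C, algebraMap_apply, MvPolynomial.aeval_C, sub_self]
    exact zero_mem _
  | add p q hp hq =>
    rw [map_add, map_add, add_sub_add_comm]
    exact add_mem hp hq
  | mul_X p i hp =>
    have h : algebraMap _ ConormalRing (p * .X i) - aeval point (p * .X i) =
        (MvPolynomial.X i : MvPolynomial (Fin 5) ℂ) • (algebraMap _ ConormalRing p - aeval point p) +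
          aeval point p * lagVector normal i := by
      rw [map_mul, map_mul, MvPolynomial.aeval_X, Algebra.smul_def, point_eq]
      ring
    rw [h]
    exact add_mem (Submodule.smul_mem _ _ hp) (mul_mem_span_of_mem_adjoin resid_mul_basis_mem
      (aeval_point_mem_adjoin p) (lagVector_mem _ normal_mem_span i))

theorem algebraMap_conePoly_mem : algebraMap _ ConormalRing conePoly ∈
    Submodule.span (MvPolynomial (Fin 5) ℂ) (Set.range basis) := by
  have := algebraMap_sub_aeval_point_mem conePoly
  rwa [point, aeval_covariancePoint_conePoly, sub_zero] at this

theorem conePoly_ne_zero : conePoly ≠ 0 := fun h => by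
  have := aeval_conePoly (![0, 1, 0, 0, 1] : Fin 5 → ℂ)
  rw [h] at this
  simp at this

theorem ne_zero_of_evalHom {p : ConormalRing} (θ : Fin 5 → ℂ) (h : evalHom θ p ≠ 0) : p ≠ 0 :=
  fun hp => h (by rw [hp, map_zero])

theorem basis_zero_ne_zero : basis 0 ≠ 0 := by
  refine ne_zero_of_evalHom ![1, 2, 3, 4, 1] ?_
  change evalHom _ (normal 0) ≠ 0
  rw [evalHom_normal]
  simp only [normalCoords, Matrix.cons_val]
  norm_num

theorem aeval_point_pderiv_ne_zero :
    aeval point (MvPolynomial.pderiv 0 conePoly) ≠ (0 : ConormalRing) := by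
  refine ne_zero_of_evalHom ![1, 2, 3, 5, 1] ?_
  rw [aeval_pderiv_conePoly]
  simp only [coneGradient, Matrix.cons_val, map_sub, map_neg, map_mul, evalHom_point,
    covariancePoint]
  norm_num

theorem isIntegral_of_mem {p : ConormalRing}
    (hp : p ∈ Algebra.adjoin (MvPolynomial (Fin 5) ℂ) (Set.range resid)) :
    IsIntegral (MvPolynomial (Fin 5) ℂ) p :=
  isIntegral_of_mem_adjoin resid_mul_basis_mem basis_zero_ne_zero hp

/-- The squares of the four sign combinations `e, f, g, h` are integer combinations of the
coordinates of the point, which are integral; each parameter is a signed quarter sum of `e, f, g,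
h`. -/
theorem isIntegral_param (i : Fin 4) : IsIntegral (MvPolynomial (Fin 5) ℂ) (param i.castSucc) := by
  have hp : ∀ i, IsIntegral (MvPolynomial (Fin 5) ℂ) (point i) := fun i =>
    isIntegral_of_mem (point_mem_adjoin i)
  have sq : ∀ q r : ConormalRing, q ^ 2 = r → IsIntegral (MvPolynomial (Fin 5) ℂ) r →
      IsIntegral (MvPolynomial (Fin 5) ℂ) q := fun q r h hr => .of_pow two_pos (h ▸ hr)
  have htwo : IsIntegral (MvPolynomial (Fin 5) ℂ) (2 : ConormalRing) := by
    exact_mod_cast isIntegral_intCast (R := MvPolynomial (Fin 5) ℂ) (B := ConormalRing) 2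
  have h₁ := sq (param 0 + param 1 + param 2 + param 3)
    (point 0 + 2 * (point 1 + point 2 + point 3 + point 4))
    (by simp only [point, covariancePoint, Matrix.cons_val]; ring)
    ((hp 0).add (htwo.mul ((((hp 1).add (hp 2)).add (hp 3)).add (hp 4))))
  have h₂ := sq (param 0 - param 1 - param 2 + param 3)
    (point 0 + 2 * (point 3 + point 4 - point 1 - point 2))
    (by simp only [point, covariancePoint, Matrix.cons_val]; ring)
    ((hp 0).add (htwo.mul ((((hp 3).add (hp 4)).sub (hp 1)).sub (hp 2))))
  have h₃ := sq (param 0 + param 1 - param 2 - param 3)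
    (point 0 + 2 * (point 1 - point 2 - point 3 - point 4))
    (by simp only [point, covariancePoint, Matrix.cons_val]; ring)
    ((hp 0).add (htwo.mul ((((hp 1).sub (hp 2)).sub (hp 3)).sub (hp 4))))
  have h₄ := sq (param 0 - param 1 + param 2 - param 3)
    (point 0 + 2 * (point 2 - point 1 - point 3 - point 4))
    (by simp only [point, covariancePoint, Matrix.cons_val]; ring)
    ((hp 0).add (htwo.mul ((((hp 2).sub (hp 1)).sub (hp 3)).sub (hp 4))))
  have quarter : ∀ q r : ConormalRing, 4 * q = r → IsIntegral (MvPolynomial (Fin 5) ℂ) r →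
      IsIntegral (MvPolynomial (Fin 5) ℂ) q := by
    rintro q r rfl hr
    have : q = algebraMap (MvPolynomial (Fin 5) ℂ) ConormalRing (.C (1 / 4)) * (4 * q) := by
      have h4 : algebraMap (MvPolynomial (Fin 5) ℂ) ConormalRing (.C (1 / 4)) * 4 = 1 := by
        rw [← map_ofNat (algebraMap (MvPolynomial (Fin 5) ℂ) ConormalRing) 4, ← map_mul,
          ← map_ofNat (MvPolynomial.C (R := ℂ)) 4, ← map_mul]
        norm_num
      rw [← mul_assoc, h4, one_mul]
    rw [this]
    exact isIntegral_algebraMap.mul hr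
  fin_cases i
  · exact quarter _ _ (by simp only [Fin.castSucc]; ring!) (((h₁.add h₂).add h₃).add h₄)
  · exact quarter _ _ (by simp only [Fin.castSucc]; ring!) (((h₁.sub h₂).add h₃).sub h₄)
  · exact quarter _ _ (by simp only [Fin.castSucc]; ring!) (((h₁.sub h₂).sub h₃).add h₄)
  · exact quarter _ _ (by simp only [Fin.castSucc]; ring!) (((h₁.add h₂).sub h₃).sub h₄)

/-- The images of the variables of `ℂ[u]`. -/
noncomputable def datum (i : Fin 5) : ConormalRing :=
  algebraMap (MvPolynomial (Fin 5) ℂ) ConormalRing (.X i)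

theorem isAlgebraic_of_isIntegral {p : ConormalRing} (hp : IsIntegral (MvPolynomial (Fin 5) ℂ) p) :
    IsAlgebraic (Algebra.adjoin ℂ (Set.range datum)) p := by
  have hmem : ∀ q : MvPolynomial (Fin 5) ℂ,
      algebraMap _ ConormalRing q ∈ Algebra.adjoin ℂ (Set.range datum) := by
    intro q
    induction q using MvPolynomial.induction_on with
    | C c =>
      rw [algebraMap_apply, MvPolynomial.aeval_C]
      exact Subalgebra.algebraMap_mem _ _
    | add p q hp hq =>
      rw [map_add]
      exact add_mem hp hq
    | mul_X p i hp =>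
      rw [map_mul]
      exact mul_mem hp (Algebra.subset_adjoin ⟨i, rfl⟩)
  let g : MvPolynomial (Fin 5) ℂ →+* Algebra.adjoin ℂ (Set.range datum) :=
    (algebraMap _ ConormalRing).codRestrict _ hmem
  obtain ⟨q, hq, hqp⟩ := hp
  have : IsIntegral (Algebra.adjoin ℂ (Set.range datum)) p := by
    refine ⟨q.map g, hq.map g, ?_⟩
    rw [Polynomial.eval₂_map]
    exact hqp
  exact this.isAlgebraic

/-- For the scale, `k · efgh` is a residual coordinate, hence integral, and `efgh` is nonzero and
algebraic. -/
theorem isAlgebraic_param (i : Fin 5) :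
    IsAlgebraic (Algebra.adjoin ℂ (Set.range datum)) (param i) := by
  have h := fun i => isAlgebraic_of_isIntegral (isIntegral_param i)
  refine Fin.lastCases ?_ h i
  have hM : IsAlgebraic (Algebra.adjoin ℂ (Set.range datum)) (normal 4) :=
    isAlgebraic_of_isIntegral (isIntegral_of_mem (resid_mem_adjoin 4))
  have hN : IsAlgebraic (Algebra.adjoin ℂ (Set.range datum))
      (normalCoords (param 0) (param 1) (param 2) (param 3) 4) := by
    simp only [normalCoords, Matrix.cons_val]
    exact (((((h 0).add (h 1)).add (h 2)).add (h 3)).mul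
      ((((h 0).add (h 3)).sub (h 1)).sub (h 2))).mul
      ((((h 0).sub (h 3)).add (h 1)).sub (h 2)) |>.mul ((((h 0).sub (h 3)).sub (h 1)).add (h 2))
  refine IsAlgebraic.of_mul (mem_nonZeroDivisors_of_ne_zero ?_) hN ?_
  -- The fourth entry is `5`, since `1 - 2 - 3 + 4 = 0` would kill a factor.
  · refine ne_zero_of_evalHom ![1, 2, 3, 5, 1] ?_
    simp only [normalCoords, Matrix.cons_val, map_sub, map_add, map_mul, evalHom_param]
    norm_num
  · rw [mul_comm]
    exact hM

instance : Algebra.IsAlgebraic (Algebra.adjoin ℂ (Set.range datum)) ConormalRing := by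
  refine ⟨fun p => ?_⟩
  induction p using MvPolynomial.induction_on (R := ℂ) (σ := Fin 5) with
  | C c =>
    exact isAlgebraic_algebraMap (R := Algebra.adjoin ℂ (Set.range datum)) (A := ConormalRing)
      (algebraMap ℂ _ c)
  | add p q hp hq => exact hp.add hq
  | mul_X p i hp => exact hp.mul (isAlgebraic_param i)

/-- A ring of transcendence degree five is algebraic over the subalgebra generated by the five data,
so these are algebraically independent. -/
instance : FaithfulSMul (MvPolynomial (Fin 5) ℂ) ConormalRing := by
  rw [faithfulSMul_iff_algebraMap_injective]
  have h : IsTranscendenceBasis ℂ datum := by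
    refine Algebra.IsAlgebraic.isTranscendenceBasis_of_le_trdeg_of_finite ℂ datum ?_
    have : Algebra.trdeg ℂ ConormalRing = _ := MvPolynomial.trdeg_of_isDomain (ι := Fin 5) (S := ℂ)
    rw [this]
    simp
  have h' := h.1
  rw [algebraicIndependent_iff_injective_aeval] at h'
  convert h' using 1
  funext p
  rw [algebraMap_apply]
  congr 2
  funext i
  exact (algebraMap_X i).symm

end ConormalRing

end Conormal

/-! ### Recovery of the parameters and a fibre with sixteen points -/

section Conormal

open MvPolynomial (eval aeval)

theorem covariancePoint_of_squares {s x y p m e f g h : ℂ} (he : e ^ 2 = 2 * (x + y + s + p))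
    (hf : f ^ 2 = 2 * (s + p - x - y)) (hg : g ^ 2 = 2 * (x - y + s - p))
    (hh : h ^ 2 = 2 * (s - p - x + y)) (hm : g * h - e * f = 4 * m) :
    covariancePoint ((e + f + g + h) / 4) ((e - f + g - h) / 4) ((e - f - g + h) / 4)
      ((e + f - g - h) / 4) = ![2 * s, x, y, (p - m) / 2, (p + m) / 2] := by
  funext i
  fin_cases i <;> simp only [covariancePoint, Fin.isValue, Fin.mk_one, Fin.zero_eta,
    Fin.reduceFinMk, Matrix.cons_val]
  · linear_combination (he + hf + hg + hh) / 4
  · linear_combination (he - hf + hg - hh) / 8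
  · linear_combination (he - hf - hg + hh) / 8
  · linear_combination (he + hf - hg - hh) / 16 - hm / 8
  · linear_combination (he + hf - hg - hh) / 16 + hm / 8

/-- A pair of a point of the cone and a normal vector is determined by equations in the open set
where the square roots in the parametrisation do not vanish. -/
theorem exists_params_of_relations {s p x y m T P X Y M : ℂ} (segre : 4 * T * P = X * Y)
    (quadric : M ^ 2 = 16 * T ^ 2 + P ^ 2 - X ^ 2 - Y ^ 2)
    (euler : 4 * T * s + P * p + X * x + Y * y + M * m = 0)
    (torus₁ : Y * s + X * p + P * x + 4 * T * y = 0)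
    (torus₂ : X * s + Y * p + 4 * T * x + P * y = 0)
    (hE : x + y + s + p ≠ 0) (hG : x - y + s - p ≠ 0) (hM : M ≠ 0) :
    ∃ a b c d k : ℂ,
      covariancePoint a b c d = ![2 * s, x, y, (p - m) / 2, (p + m) / 2] ∧
      ∀ i, k * normalCoords a b c d i = ![T, P, X, Y, M] i := by
  obtain ⟨e, he⟩ := IsAlgClosed.exists_pow_nat_eq (2 * (x + y + s + p)) two_pos
  obtain ⟨g, hg⟩ := IsAlgClosed.exists_pow_nat_eq (2 * (x - y + s - p)) two_pos
  -- In the parametrisation the four forms are `k f²gh`, `k e²gh`, `-k efh²`, `-k efg²`, and `M = k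
  -- efgh`; the identities below are read off from this.
  have hAB : (4 * T + P + X + Y) * (4 * T + P - X - Y) = M ^ 2 := by
    linear_combination 2 * segre - quadric
  have hCD : (4 * T - P + X - Y) * (4 * T - P - X + Y) = M ^ 2 := by
    linear_combination -2 * segre - quadric
  have hEF : (4 * T + P + X + Y) * (x + y + s + p) = (4 * T + P - X - Y) * (s + p - x - y) := by
    linear_combination 2 * torus₁ + 2 * torus₂
  have hGH : (4 * T - P + X - Y) * (x - y + s - p) = (4 * T - P - X + Y) * (s - p - x + y) := by
    linear_combination 2 * torus₂ - 2 * torus₁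
  have hEG : (4 * T + P + X + Y) * (x + y + s + p) + (4 * T - P + X - Y) * (x - y + s - p) +
      2 * (M * m) = 0 := by
    linear_combination 2 * euler + 2 * torus₂
  have hM2 : M ^ 2 ≠ 0 := pow_ne_zero 2 hM
  have hA : 4 * T + P + X + Y ≠ 0 := left_ne_zero_of_mul (hAB ▸ hM2)
  have hB : 4 * T + P - X - Y ≠ 0 := right_ne_zero_of_mul (hAB ▸ hM2)
  have hC : 4 * T - P + X - Y ≠ 0 := left_ne_zero_of_mul (hCD ▸ hM2)
  have hD : 4 * T - P - X + Y ≠ 0 := right_ne_zero_of_mul (hCD ▸ hM2)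
  have he0 : e ≠ 0 := fun h => hE (by rw [h] at he; linear_combination -he / 2)
  have hg0 : g ≠ 0 := fun h => hG (by rw [h] at hg; linear_combination -hg / 2)
  generalize hA' : 4 * T + P + X + Y = A at *
  generalize hB' : 4 * T + P - X - Y = B at *
  generalize hC' : 4 * T - P + X - Y = C at *
  generalize hD' : 4 * T - P - X + Y = D at *
  -- Only `e` and `g` are free square roots: the ratios `f / e = A / M` and `h / g = -C / M` force
  -- the other two.
  obtain ⟨f, hf⟩ : ∃ f, f * M = A * e := ⟨A * e / M, by field_simp⟩
  obtain ⟨h, hh⟩ : ∃ h, h * M = -(C * g) := ⟨-(C * g) / M, by field_simp⟩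
  have hf0 : f ≠ 0 := left_ne_zero_of_mul (hf ▸ mul_ne_zero hA he0)
  have hh0 : h ≠ 0 := left_ne_zero_of_mul (hh ▸ neg_ne_zero.2 (mul_ne_zero hC hg0))
  have hff : f ^ 2 = 2 * (s + p - x - y) := by
    apply mul_left_cancel₀ (mul_ne_zero hM2 hB)
    linear_combination B * (f * M + A * e) * hf + B * A ^ 2 * he + 2 * A * hAB * (x + y + s + p) +
      2 * M ^ 2 * hEF
  have hhh : h ^ 2 = 2 * (s - p - x + y) := by
    apply mul_left_cancel₀ (mul_ne_zero hM2 hD)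
    linear_combination D * (h * M - C * g) * hh + D * C ^ 2 * hg + 2 * C * hCD * (x - y + s - p) +
      2 * M ^ 2 * hGH
  have hm : g * h - e * f = 4 * m := by
    apply mul_left_cancel₀ hM
    linear_combination g * hh - e * hf - C * hg - A * he - 2 * hEG
  obtain ⟨k, hk⟩ : ∃ k, k * (e * f * g * h) = M := ⟨M / (e * f * g * h), by field_simp⟩
  have kA : k * (f ^ 2 * g * h) = A := by
    apply mul_left_cancel₀ he0
    linear_combination f * hk + hf
  have kB : k * (e ^ 2 * g * h) = B := by
    apply mul_left_cancel₀ (mul_ne_zero hf0 hM)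
    linear_combination e * M * hk - e * hAB - B * hf
  have kC : k * (e * f * h ^ 2) = -C := by
    apply mul_left_cancel₀ hg0
    linear_combination h * hk + hh
  have kD : k * (e * f * g ^ 2) = -D := by
    apply mul_left_cancel₀ (mul_ne_zero hh0 hM)
    linear_combination g * M * hk - g * hCD + D * hh
  refine ⟨(e + f + g + h) / 4, (e - f + g - h) / 4, (e - f - g + h) / 4, (e + f - g - h) / 4, k,
    covariancePoint_of_squares he hff hg hhh hm, fun i => ?_⟩
  fin_cases i <;> simp only [normalCoords, Fin.isValue, Fin.mk_one, Fin.zero_eta,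
    Fin.reduceFinMk, Matrix.cons_val]
  · linear_combination (kA + kB - kC - kD - hA' - hB' - hC' - hD') / 16
  · linear_combination (kA + kB + kC + kD - hA' - hB' + hC' + hD') / 4
  · linear_combination (kA - kB - kC + kD - hA' + hB' - hC' + hD') / 4
  · linear_combination (kA - kB + kC - kD - hA' + hB' + hC' - hD') / 4
  · linear_combination hk

namespace ConormalRing

theorem liesOverPoint_evalHom {θ u : Fin 5 → ℂ}
    (h : ∀ i, u i = covariancePoint (θ 0) (θ 1) (θ 2) (θ 3) i +
      lagVector (fun j => θ 4 * normalCoords (θ 0) (θ 1) (θ 2) (θ 3) j) i) :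
    LiesOverPoint u (evalHom θ : ConormalRing →+* ℂ) := by
  intro p
  induction p using MvPolynomial.induction_on with
  | C c => exact (evalHom_algebraMap_C θ c).trans (MvPolynomial.eval_C c).symm
  | add p q hp hq => rw [map_add, map_add, hp, hq, map_add]
  | mul_X p i hp =>
    rw [map_mul, map_mul, hp, map_mul, MvPolynomial.eval_X, h i]
    congr 1
    exact evalHom_algebraMap_X θ i

theorem mem_fibrePoints_of_params {a b c d k : ℂ} {u w : Fin 5 → ℂ}
    (hw : ∀ i, k * normalCoords a b c d i = w i)
    (hu : ∀ i, u i = covariancePoint a b c d i + lagVector w i) : w ∈ fibrePoints resid u := by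
  have h : LiesOverPoint u (evalHom ![a, b, c, d, k] : ConormalRing →+* ℂ) := by
    refine liesOverPoint_evalHom fun i => ?_
    simp only [Matrix.cons_val, hw]
    exact hu i
  convert mem_fibrePoints_of_hom _ h using 1
  funext i
  rw [resid_eq]
  refine (hw i).symm.trans ?_
  exact (evalHom_normal ![a, b, c, d, k] i).symm

/-- A data point with a fibre of 16 points that can be written down. -/
def specialDatum : Fin 5 → ℂ := ![10, 0, 0, -1, 1]

/-- At this datum the point has `s = 5 - T`, `p = -2P`, `x = -X`, `y = -Y`, `m = 2 - 2M`. -/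
theorem mem_fibrePoints_specialDatum {T P X Y M : ℂ} (segre : 4 * T * P = X * Y)
    (quadric : M ^ 2 = 16 * T ^ 2 + P ^ 2 - X ^ 2 - Y ^ 2)
    (euler : 4 * T * (5 - T) - 2 * P ^ 2 - X ^ 2 - Y ^ 2 + M * (2 - 2 * M) = 0)
    (torus₁ : Y * (5 - T) - 3 * P * X - 4 * T * Y = 0)
    (torus₂ : X * (5 - T) - 3 * P * Y - 4 * T * X = 0)
    (hE : 5 - T - 2 * P - X - Y ≠ 0) (hG : 5 - T + 2 * P - X + Y ≠ 0) (hM : M ≠ 0) :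
    ![T, P, X, Y, M] ∈ fibrePoints resid specialDatum := by
  obtain ⟨a, b, c, d, k, h₁, h₂⟩ := exists_params_of_relations (s := 5 - T) (p := -2 * P) (x := -X)
    (y := -Y) (m := 2 - 2 * M) segre quadric (by linear_combination euler)
    (by linear_combination torus₁) (by linear_combination torus₂)
    (fun h => hE (by linear_combination h)) (fun h => hG (by linear_combination h)) hM
  refine mem_fibrePoints_of_params h₂ fun i => ?_
  rw [h₁]
  fin_cases i <;> simp only [specialDatum, lagVector, Fin.isValue, Fin.mk_one, Fin.zero_eta,
      Fin.reduceFinMk, Matrix.cons_val] <;> ring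

theorem exists_specialFibre : ∃ w : Fin 16 → Fin 5 → ℂ, Function.Injective w ∧
    ∀ k, w k ∈ fibrePoints resid specialDatum := by
  -- `12` is `16T² - M²` at `T = 1`, `M = 2`, `P = 0`; `65/64` and `105/64` are `4TP` at `(T, P) =
  -- (13/16, 5/16)` and `(7/16, 15/16)`, where `X = Y` up to sign.
  obtain ⟨α, hα⟩ := IsAlgClosed.exists_pow_nat_eq (12 : ℂ) two_pos
  obtain ⟨β, hβ⟩ := IsAlgClosed.exists_pow_nat_eq (65 / 64 : ℂ) two_pos
  obtain ⟨δ, hδ⟩ := IsAlgClosed.exists_pow_nat_eq (105 / 64 : ℂ) two_pos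
  -- numerators of `T` and `P`, signs of `X` and `Y`
  let nT : Fin 16 → ℤ := ![112, 48, 0, 0, 144, 144, 144, 144, 117, 117, 117, 117, 63, 63, 63, 63]
  let nP : Fin 16 → ℤ := ![0, 0, 8, -8, 0, 0, 0, 0, 5, 5, -5, -5, 15, 15, -15, -15]
  let sX : Fin 16 → ℤ := ![0, 0, 0, 0, 1, -1, 0, 0, 1, -1, 1, -1, 1, -1, 1, -1]
  let sY : Fin 16 → ℤ := ![0, 0, 0, 0, 0, 0, 1, -1, 1, -1, -1, 1, 1, -1, -1, 1]
  -- The numerator of `T` selects the square root that scales `X` and `Y`, so distinctness becomes a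
  -- statement about integers that `decide` settles.
  let r : ℤ → ℂ := fun n => if n = 117 then β else if n = 63 then δ else α
  let m : Fin 16 → ℂ := ![28 / 9, -4 / 3, 1 / 2, 1 / 2, 2, 2, 2, 2, 47 / 16, 47 / 16, 47 / 16,
    47 / 16, -13 / 16, -13 / 16, -13 / 16, -13 / 16]
  have hr : ∀ n, r n ≠ 0 := by
    intro n h
    simp only [r] at h
    split_ifs at h
    · rw [h] at hβ
      norm_num at hβ
    · rw [h] at hδ
      norm_num at hδ
    · rw [h] at hα
      norm_num at hα
  refine ⟨fun i => ![nT i / 144, nP i / 16, sX i * r (nT i), sY i * r (nT i), m i], ?_, ?_⟩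
  · intro i j hij
    have h₀ : (nT i / 144 : ℂ) = nT j / 144 := congrFun hij 0
    have h₁ : (nP i / 16 : ℂ) = nP j / 16 := congrFun hij 1
    have h₂ : sX i * r (nT i) = sX j * r (nT j) := congrFun hij 2
    have h₃ : sY i * r (nT i) = sY j * r (nT j) := congrFun hij 3
    have e₀ : nT i = nT j := by exact_mod_cast (div_left_inj' (by norm_num)).1 h₀
    have e₁ : nP i = nP j := by exact_mod_cast (div_left_inj' (by norm_num)).1 h₁
    rw [e₀] at h₂ h₃
    have e₂ : sX i = sX j := by exact_mod_cast mul_right_cancel₀ (hr _) h₂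
    have e₃ : sY i = sY j := by exact_mod_cast mul_right_cancel₀ (hr _) h₃
    have key : ∀ i j, nT i = nT j → nP i = nP j → sX i = sX j → sY i = sY j → i = j := by
      decide
    exact key i j e₀ e₁ e₂ e₃
  · have hβ₁ : ∀ ε : ℂ, ε ^ 2 = 1 → 57 / 16 - 2 * ε * β ≠ 0 := fun ε hε h => by
      have : (57 / 16 - 2 * ε * β) * (57 / 16 + 2 * ε * β) = 0 := by rw [h, zero_mul]
      have h' : (57 / 16 - 2 * ε * β) * (57 / 16 + 2 * ε * β) = (57 / 16) ^ 2 - 4 * (65 / 64) := by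
        linear_combination -4 * ε ^ 2 * hβ - 4 * (65 / 64) * hε
      rw [h'] at this
      norm_num at this
    have hδ₁ : ∀ ε : ℂ, ε ^ 2 = 1 → 43 / 16 - 2 * ε * δ ≠ 0 := fun ε hε h => by
      have : (43 / 16 - 2 * ε * δ) * (43 / 16 + 2 * ε * δ) = 0 := by rw [h, zero_mul]
      have h' : (43 / 16 - 2 * ε * δ) * (43 / 16 + 2 * ε * δ) =
          (43 / 16) ^ 2 - 4 * (105 / 64) := by
        linear_combination -4 * ε ^ 2 * hδ - 4 * (105 / 64) * hε
      rw [h'] at this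
      norm_num at this
    have hα₁ : ∀ ε : ℂ, ε ^ 2 = 1 → 4 - ε * α ≠ 0 := fun ε hε h => by
      have : (4 - ε * α) * (4 + ε * α) = 0 := by rw [h, zero_mul]
      have h' : (4 - ε * α) * (4 + ε * α) = 16 - 12 := by
        linear_combination -ε ^ 2 * hα - 12 * hε
      rw [h'] at this
      norm_num at this
    have hα₂ : ∀ ε : ℂ, ε ^ 2 = 1 → ![1, 0, ε * α, 0, 2] ∈ fibrePoints resid specialDatum :=
      fun ε hε => mem_fibrePoints_specialDatum (by ring)
        (by linear_combination ε ^ 2 * hα + 12 * hε) (by linear_combination -ε ^ 2 * hα - 12 * hε)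
        (by ring) (by ring) (fun h => hα₁ ε hε (by linear_combination h))
        (fun h => hα₁ ε hε (by linear_combination h)) two_ne_zero
    have hα₃ : ∀ ε : ℂ, ε ^ 2 = 1 → ![1, 0, 0, ε * α, 2] ∈ fibrePoints resid specialDatum :=
      fun ε hε => mem_fibrePoints_specialDatum (by ring)
        (by linear_combination ε ^ 2 * hα + 12 * hε) (by linear_combination -ε ^ 2 * hα - 12 * hε)
        (by ring) (by ring) (fun h => hα₁ ε hε (by linear_combination h))
        (fun h => hα₁ (-ε) (by rw [neg_sq, hε]) (by linear_combination h)) two_ne_zero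
    have hβ₂ : ∀ ε : ℂ, ε ^ 2 = 1 →
        ![13 / 16, 5 / 16, ε * β, ε * β, 47 / 16] ∈ fibrePoints resid specialDatum :=
      fun ε hε => mem_fibrePoints_specialDatum (by linear_combination -ε ^ 2 * hβ - 65 / 64 * hε)
        (by linear_combination 2 * ε ^ 2 * hβ + 65 / 32 * hε)
        (by linear_combination -2 * ε ^ 2 * hβ - 65 / 32 * hε) (by ring) (by ring)
        (fun h => hβ₁ ε hε (by linear_combination h))
        (by ring_nf; norm_num) (by norm_num)
    have hβ₃ : ∀ ε : ℂ, ε ^ 2 = 1 →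
        ![13 / 16, -5 / 16, ε * β, -ε * β, 47 / 16] ∈ fibrePoints resid specialDatum :=
      fun ε hε => mem_fibrePoints_specialDatum (by linear_combination ε ^ 2 * hβ + 65 / 64 * hε)
        (by linear_combination 2 * ε ^ 2 * hβ + 65 / 32 * hε)
        (by linear_combination -2 * ε ^ 2 * hβ - 65 / 32 * hε) (by ring) (by ring)
        (by ring_nf; norm_num) (fun h => hβ₁ ε hε (by linear_combination h)) (by norm_num)
    have hδ₂ : ∀ ε : ℂ, ε ^ 2 = 1 →
        ![7 / 16, 15 / 16, ε * δ, ε * δ, -13 / 16] ∈ fibrePoints resid specialDatum :=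
      fun ε hε => mem_fibrePoints_specialDatum (by linear_combination -ε ^ 2 * hδ - 105 / 64 * hε)
        (by linear_combination 2 * ε ^ 2 * hδ + 105 / 32 * hε)
        (by linear_combination -2 * ε ^ 2 * hδ - 105 / 32 * hε) (by ring) (by ring)
        (fun h => hδ₁ ε hε (by linear_combination h))
        (by ring_nf; norm_num) (by norm_num)
    have hδ₃ : ∀ ε : ℂ, ε ^ 2 = 1 →
        ![7 / 16, -15 / 16, ε * δ, -ε * δ, -13 / 16] ∈ fibrePoints resid specialDatum :=
      fun ε hε => mem_fibrePoints_specialDatum (by linear_combination ε ^ 2 * hδ + 105 / 64 * hε)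
        (by linear_combination 2 * ε ^ 2 * hδ + 105 / 32 * hε)
        (by linear_combination -2 * ε ^ 2 * hδ - 105 / 32 * hε) (by ring) (by ring)
        (by ring_nf; norm_num) (fun h => hδ₁ ε hε (by linear_combination h)) (by norm_num)
    have h₀ : ∀ T P M : ℂ, T * P = 0 → M ^ 2 = 16 * T ^ 2 + P ^ 2 →
        4 * T * (5 - T) - 2 * P ^ 2 + M * (2 - 2 * M) = 0 → 5 - T - 2 * P ≠ 0 →
        5 - T + 2 * P ≠ 0 → M ≠ 0 → ![T, P, 0, 0, M] ∈ fibrePoints resid specialDatum :=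
      fun T P M h₁ h₂ h₃ h₄ h₅ h₆ => mem_fibrePoints_specialDatum (by linear_combination 4 * h₁)
        (by linear_combination h₂) (by linear_combination h₃) (by ring) (by ring)
        (by simpa using h₄) (by simpa using h₅) h₆
    have of_eq : ∀ (i : Fin 16) {T P X Y M : ℂ},
        ![T, P, X, Y, M] ∈ fibrePoints resid specialDatum →
        (nT i / 144 : ℂ) = T → (nP i / 16 : ℂ) = P → sX i * r (nT i) = X → sY i * r (nT i) = Y →
        m i = M →
        ![(nT i / 144 : ℂ), nP i / 16, sX i * r (nT i), sY i * r (nT i), m i] ∈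
          fibrePoints resid specialDatum := by
      rintro i T P X Y M h rfl rfl rfl rfl rfl
      exact h
    have one : (1 : ℂ) ^ 2 = 1 := one_pow 2
    have neg : (-1 : ℂ) ^ 2 = 1 := by norm_num
    intro i
    fin_cases i
    · exact of_eq 0 (h₀ (7 / 9) 0 (28 / 9) (by norm_num) (by norm_num) (by norm_num) (by norm_num)
        (by norm_num) (by norm_num))
        (by simp only [nT, Matrix.cons_val]; norm_num)
        (by simp only [nP, Matrix.cons_val]; norm_num)
        (by simp only [sX, Matrix.cons_val]; norm_num)
        (by simp only [sY, Matrix.cons_val]; norm_num)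
        (by simp only [m, Matrix.cons_val])
    · exact of_eq 1 (h₀ (1 / 3) 0 (-4 / 3) (by norm_num) (by norm_num) (by norm_num) (by norm_num)
        (by norm_num) (by norm_num))
        (by simp only [nT, Matrix.cons_val]; norm_num)
        (by simp only [nP, Matrix.cons_val]; norm_num)
        (by simp only [sX, Matrix.cons_val]; norm_num)
        (by simp only [sY, Matrix.cons_val]; norm_num)
        (by simp only [m, Matrix.cons_val])
    · exact of_eq 2 (h₀ 0 (1 / 2) (1 / 2) (by norm_num) (by norm_num) (by norm_num) (by norm_num)
        (by norm_num) (by norm_num))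
        (by simp only [nT, Matrix.cons_val]; norm_num)
        (by simp only [nP, Matrix.cons_val]; norm_num)
        (by simp only [sX, Matrix.cons_val]; norm_num)
        (by simp only [sY, Matrix.cons_val]; norm_num)
        (by simp only [m, Matrix.cons_val])
    · exact of_eq 3 (h₀ 0 (-1 / 2) (1 / 2) (by norm_num) (by norm_num) (by norm_num) (by norm_num)
        (by norm_num) (by norm_num))
        (by simp only [nT, Matrix.cons_val]; norm_num)
        (by simp only [nP, Matrix.cons_val]; norm_num)
        (by simp only [sX, Matrix.cons_val]; norm_num)
        (by simp only [sY, Matrix.cons_val]; norm_num)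
        (by simp only [m, Matrix.cons_val])
    · exact of_eq 4 (hα₂ 1 one)
        (by simp only [nT, Matrix.cons_val]; norm_num)
        (by simp only [nP, Matrix.cons_val]; norm_num)
        (by simp only [sX, nT, r, Matrix.cons_val]; norm_num)
        (by simp only [sY, nT, r, Matrix.cons_val]; norm_num)
        (by simp only [m, Matrix.cons_val])
    · exact of_eq 5 (hα₂ (-1) neg)
        (by simp only [nT, Matrix.cons_val]; norm_num)
        (by simp only [nP, Matrix.cons_val]; norm_num)
        (by simp only [sX, nT, r, Matrix.cons_val]; norm_num)
        (by simp only [sY, nT, r, Matrix.cons_val]; norm_num)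
        (by simp only [m, Matrix.cons_val])
    · exact of_eq 6 (hα₃ 1 one)
        (by simp only [nT, Matrix.cons_val]; norm_num)
        (by simp only [nP, Matrix.cons_val]; norm_num)
        (by simp only [sX, nT, r, Matrix.cons_val]; norm_num)
        (by simp only [sY, nT, r, Matrix.cons_val]; norm_num)
        (by simp only [m, Matrix.cons_val])
    · exact of_eq 7 (hα₃ (-1) neg)
        (by simp only [nT, Matrix.cons_val]; norm_num)
        (by simp only [nP, Matrix.cons_val]; norm_num)
        (by simp only [sX, nT, r, Matrix.cons_val]; norm_num)
        (by simp only [sY, nT, r, Matrix.cons_val]; norm_num)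
        (by simp only [m, Matrix.cons_val])
    · exact of_eq 8 (hβ₂ 1 one)
        (by simp only [nT, Matrix.cons_val]; norm_num)
        (by simp only [nP, Matrix.cons_val]; norm_num)
        (by simp only [sX, nT, r, Matrix.cons_val]; norm_num)
        (by simp only [sY, nT, r, Matrix.cons_val]; norm_num)
        (by simp only [m, Matrix.cons_val])
    · exact of_eq 9 (hβ₂ (-1) neg)
        (by simp only [nT, Matrix.cons_val]; norm_num)
        (by simp only [nP, Matrix.cons_val]; norm_num)
        (by simp only [sX, nT, r, Matrix.cons_val]; norm_num)
        (by simp only [sY, nT, r, Matrix.cons_val]; norm_num)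
        (by simp only [m, Matrix.cons_val])
    · exact of_eq 10 (hβ₃ 1 one)
        (by simp only [nT, Matrix.cons_val]; norm_num)
        (by simp only [nP, Matrix.cons_val]; norm_num)
        (by simp only [sX, nT, r, Matrix.cons_val]; norm_num)
        (by simp only [sY, nT, r, Matrix.cons_val]; norm_num)
        (by simp only [m, Matrix.cons_val])
    · exact of_eq 11 (hβ₃ (-1) neg)
        (by simp only [nT, Matrix.cons_val]; norm_num)
        (by simp only [nP, Matrix.cons_val]; norm_num)
        (by simp only [sX, nT, r, Matrix.cons_val]; norm_num)
        (by simp only [sY, nT, r, Matrix.cons_val]; norm_num)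
        (by simp only [m, Matrix.cons_val])
    · exact of_eq 12 (hδ₂ 1 one)
        (by simp only [nT, Matrix.cons_val]; norm_num)
        (by simp only [nP, Matrix.cons_val]; norm_num)
        (by simp only [sX, nT, r, Matrix.cons_val]; norm_num)
        (by simp only [sY, nT, r, Matrix.cons_val]; norm_num)
        (by simp only [m, Matrix.cons_val])
    · exact of_eq 13 (hδ₂ (-1) neg)
        (by simp only [nT, Matrix.cons_val]; norm_num)
        (by simp only [nP, Matrix.cons_val]; norm_num)
        (by simp only [sX, nT, r, Matrix.cons_val]; norm_num)
        (by simp only [sY, nT, r, Matrix.cons_val]; norm_num)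
        (by simp only [m, Matrix.cons_val])
    · exact of_eq 14 (hδ₃ 1 one)
        (by simp only [nT, Matrix.cons_val]; norm_num)
        (by simp only [nP, Matrix.cons_val]; norm_num)
        (by simp only [sX, nT, r, Matrix.cons_val]; norm_num)
        (by simp only [sY, nT, r, Matrix.cons_val]; norm_num)
        (by simp only [m, Matrix.cons_val])
    · exact of_eq 15 (hδ₃ (-1) neg)
        (by simp only [nT, Matrix.cons_val]; norm_num)
        (by simp only [nP, Matrix.cons_val]; norm_num)
        (by simp only [sX, nT, r, Matrix.cons_val]; norm_num)
        (by simp only [sY, nT, r, Matrix.cons_val]; norm_num)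
        (by simp only [m, Matrix.cons_val])

/-- The generic fibre of the conormal variety over a data point has 16 points, none of which lies
over the zero locus of a partial derivative of the equation. -/
theorem exists_generic_fibre : ∃ Q : MvPolynomial (Fin 5) ℂ, Q ≠ 0 ∧ ∀ u, eval u Q ≠ 0 →
    (fibrePoints resid u).encard = 16 ∧
      ∀ φ : Algebra.adjoin (MvPolynomial (Fin 5) ℂ) (Set.range resid) →+* ℂ, LiesOverPoint u φ →
        φ ⟨_, aeval_point_mem_adjoin (MvPolynomial.pderiv 0 conePoly)⟩ ≠ 0 := by
  obtain ⟨w, hw, hwu⟩ := exists_specialFibre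
  exact exists_generic_fibrePoints resid_mul_basis_mem basis_mem_adjoin conePoly_ne_zero
    algebraMap_conePoly_mem basis_zero_ne_zero w hw hwu _
    fun h => aeval_point_pderiv_ne_zero (congrArg Subtype.val h)

end ConormalRing

end Conormal

/-! ### Dimension of a hypersurface -/

section Hypersurface

open MvPolynomial (eval aeval)

theorem ringKrullDim_mvPolynomial_complex (σ : Type*) [Finite σ] :
    ringKrullDim (MvPolynomial σ ℂ) = Nat.card σ := by
  rw [MvPolynomial.ringKrullDim_of_isNoetherianRing, ringKrullDim_eq_zero_of_field, zero_add]

/-- A nonempty affine hypersurface has codimension one. -/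
theorem ringKrullDim_quotient_span_singleton_add_one {σ : Type*} [Finite σ] {F : MvPolynomial σ ℂ}
    (hF : F ≠ 0) {x : σ → ℂ} (hx : eval x F = 0) :
    ringKrullDim (MvPolynomial σ ℂ ⧸ Ideal.span {F}) + 1 = Nat.card σ := by
  apply le_antisymm
  · rw [← ringKrullDim_mvPolynomial_complex]
    exact ringKrullDim_quotient_succ_le_of_nonZeroDivisor (mem_nonZeroDivisors_of_ne_zero hF)
  · have hfin : FiniteRingKrullDim (MvPolynomial σ ℂ) := by
      rw [finiteRingKrullDim_iff_ne_bot_and_top, ringKrullDim_mvPolynomial_complex]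
      exact ⟨WithBot.natCast_ne_bot _, fun h => ENat.natCast_ne_top _ (WithBot.coe_injective h)⟩
    -- Some maximal ideal has full height; a translation carries it to the point `x`, whose ideal
    -- contains `F`.
    obtain ⟨p, hp, hpd⟩ := Ideal.exists_isMaximal_height (R := MvPolynomial σ ℂ)
    obtain ⟨y, rfl⟩ := MvPolynomial.isMaximal_iff_eq_vanishingIdeal_singleton.1 hp
    let τ : (σ → ℂ) → MvPolynomial σ ℂ →ₐ[ℂ] MvPolynomial σ ℂ := fun c =>
      aeval fun i => .X i + .C (c i)
    have hτ : ∀ c, (τ c).comp (τ (-c)) = AlgHom.id ℂ _ := fun c => by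
      ext i
      simp [τ]
    let e : MvPolynomial σ ℂ ≃ₐ[ℂ] MvPolynomial σ ℂ := AlgEquiv.ofAlgHom (τ (x - y)) (τ (y - x))
      (by simpa using hτ (x - y)) (by simpa using hτ (y - x))
    have hcomap : (MvPolynomial.vanishingIdeal ℂ {x}).comap (e.symm : MvPolynomial σ ℂ ≃+* _) =
        MvPolynomial.vanishingIdeal ℂ {y} := by
      ext f
      simp only [Ideal.mem_comap, MvPolynomial.mem_vanishingIdeal_iff, Set.mem_singleton_iff,
        forall_eq]
      have : (aeval x : MvPolynomial σ ℂ →ₐ[ℂ] ℂ).comp (τ (y - x)) = aeval y := by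
        ext i
        simp [τ]
      rw [← this]
      rfl
    have hheight : (MvPolynomial.vanishingIdeal ℂ {x}).height =
        (MvPolynomial.vanishingIdeal ℂ {y}).height := by
      rw [← hcomap, RingEquiv.height_comap]
    have hmem : F ∈ MvPolynomial.vanishingIdeal (K := ℂ) ℂ {x} := by
      rw [MvPolynomial.mem_vanishingIdeal_iff]
      rintro _ rfl
      rwa [MvPolynomial.aeval_eq_eval]
    rw [← ringKrullDim_mvPolynomial_complex, ← hpd, ← hheight]
    exact Ideal.height_le_ringKrullDim_quotient_add_one hmem

end Hypersurface

/-! ### The cone equation as a monic quartic -/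

section Cone

open MvPolynomial (eval aeval)

open MvPolynomial in
/-- The quadratic coefficient of the cone equation as a quartic in `w - z`. -/
noncomputable def quarticCoeffTwo : MvPolynomial (Fin 4) ℂ :=
  X 1 ^ 2 + X 2 ^ 2 - X 3 ^ 2 - C (1 / 4) * X 0 ^ 2

open MvPolynomial in
/-- The constant coefficient of the cone equation as a quartic in `w - z`. -/
noncomputable def quarticCoeffZero : MvPolynomial (Fin 4) ℂ :=
  (X 1 * X 2 - C (1 / 2) * X 0 * X 3) ^ 2

open Polynomial in
/-- The cone equation as a monic quartic in `w - z` over the ring of polynomials in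
`s, x, y, z + w`. -/
noncomputable def coneQuartic : Polynomial (MvPolynomial (Fin 4) ℂ) :=
  X ^ 4 + (C quarticCoeffTwo * X ^ 2 + C quarticCoeffZero)

open Polynomial in
theorem coneQuartic_tail_degree : (C quarticCoeffTwo * X ^ 2 + C quarticCoeffZero).degree <
    ((4 : ℕ) : WithBot ℕ) := by
  refine lt_of_le_of_lt (b := ((2 : ℕ) : WithBot ℕ)) ?_ (by norm_num)
  compute_degree
  exact le_rfl

theorem coneQuartic_monic : coneQuartic.Monic :=
  Polynomial.monic_X_pow_add coneQuartic_tail_degree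

theorem coneQuartic_natDegree : coneQuartic.natDegree = 4 :=
  Polynomial.natDegree_eq_of_degree_eq_some
    (by rw [coneQuartic, Polynomial.degree_add_eq_left_of_degree_lt, Polynomial.degree_X_pow]
        rw [Polynomial.degree_X_pow]
        exact coneQuartic_tail_degree)

/-- The change of coordinates from `s, x, y, z, w` to `s, x, y, z + w` and `w - z`. -/
noncomputable def toQuarticRing : MvPolynomial (Fin 5) ℂ →ₐ[ℂ] Polynomial (MvPolynomial (Fin 4) ℂ) :=
  aeval ![.C (.X 0), .C (.X 1), .C (.X 2), .C (.C (1 / 2)) * (.C (.X 3) - .X),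
    .C (.C (1 / 2)) * (.C (.X 3) + .X)]

/-- The inverse of `toQuarticRing`. -/
noncomputable def ofQuarticRing : Polynomial (MvPolynomial (Fin 4) ℂ) →+* MvPolynomial (Fin 5) ℂ :=
  Polynomial.eval₂RingHom
    (aeval ![.X 0, .X 1, .X 2, .X 3 + .X 4] : MvPolynomial (Fin 4) ℂ →ₐ[ℂ] MvPolynomial (Fin 5) ℂ)
    (.X 4 - .X 3)

theorem ofQuarticRing_toQuarticRing (f : MvPolynomial (Fin 5) ℂ) :
    ofQuarticRing (toQuarticRing f) = f := by
  have h : ofQuarticRing.comp (toQuarticRing : MvPolynomial (Fin 5) ℂ →+* _) = RingHom.id _ := by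
    apply MvPolynomial.ringHom_ext
    · intro c
      simp [toQuarticRing, ofQuarticRing, IsScalarTower.algebraMap_apply ℂ (MvPolynomial (Fin 4) ℂ)]
    · intro i
      apply MvPolynomial.funext
      intro x
      fin_cases i <;> simp [toQuarticRing, ofQuarticRing] <;> ring
  exact DFunLike.congr_fun h f

theorem ofQuarticRing_C (r : MvPolynomial (Fin 4) ℂ) : ofQuarticRing (.C r) =
    (aeval ![.X 0, .X 1, .X 2, .X 3 + .X 4] : MvPolynomial (Fin 4) ℂ →ₐ[ℂ] MvPolynomial (Fin 5) ℂ)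
      r :=
  Polynomial.eval₂_C _ _

theorem ofQuarticRing_coneQuartic : ofQuarticRing coneQuartic = conePoly := by
  have hX : ofQuarticRing .X = .X 4 - .X 3 := Polynomial.eval₂_X _ _
  rw [coneQuartic, map_add, map_add, map_mul, map_pow, map_pow, ofQuarticRing_C, ofQuarticRing_C,
    hX]
  apply MvPolynomial.funext
  intro x
  simp [quarticCoeffTwo, quarticCoeffZero, conePoly]
  ring

theorem eval_ofQuarticRing (β : Fin 4 → ℂ) (m : ℂ) (q : Polynomial (MvPolynomial (Fin 4) ℂ)) :
    eval ![β 0, β 1, β 2, (β 3 - m) / 2, (β 3 + m) / 2] (ofQuarticRing q) =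
      (q.map (eval β)).eval m := by
  have h : (eval ![β 0, β 1, β 2, (β 3 - m) / 2, (β 3 + m) / 2]).comp ofQuarticRing =
      (Polynomial.evalRingHom m).comp (Polynomial.mapRingHom (eval β)) := by
    apply Polynomial.ringHom_ext'
    · apply MvPolynomial.ringHom_ext
      · intro c
        simp [ofQuarticRing]
      · intro i
        fin_cases i <;> simp [ofQuarticRing]
        ring
    · simp [ofQuarticRing]
      ring
  exact DFunLike.congr_fun h q

end Cone

/-! ### The image of the parametrisation and its vanishing ideal -/

section Cone

open MvPolynomial (eval aeval)

/-- The affine cone over the autocovariance variety, as a hypersurface. -/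
def coneSet : Set (Fin 5 → ℂ) := {x | eval x conePoly = 0}

theorem eval_conePoly (x : Fin 5 → ℂ) : eval x conePoly =
    (x 1 * x 2 - x 3 * x 0) * (x 1 * x 2 - x 4 * x 0) +
      (x 1 ^ 2 + x 2 ^ 2 - 4 * x 3 * x 4) * (x 4 - x 3) ^ 2 := by
  rw [← aeval_conePoly, MvPolynomial.aeval_eq_eval]

theorem eval_pderiv_conePoly (x : Fin 5 → ℂ) (i : Fin 5) :
    eval x (MvPolynomial.pderiv i conePoly) = coneGradient x i := by
  rw [← aeval_pderiv_conePoly, MvPolynomial.aeval_eq_eval]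

/-- For any square roots `e, f, g, h`, the product of `±gh ± ef - 4m` over all signs is 256 times
the cone equation; so suitable signs of `e` and `g` solve `gh - ef = 4m`. -/
theorem exists_covariancePoint_eq {x : Fin 5 → ℂ} (hx : x ∈ coneSet) :
    ∃ a b c d, covariancePoint a b c d = x := by
  obtain ⟨e, he⟩ := IsAlgClosed.exists_pow_nat_eq
    (2 * (x 1 + x 2 + x 0 / 2 + (x 3 + x 4))) two_pos
  obtain ⟨f, hf⟩ := IsAlgClosed.exists_pow_nat_eq
    (2 * (x 0 / 2 + (x 3 + x 4) - x 1 - x 2)) two_pos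
  obtain ⟨g, hg⟩ := IsAlgClosed.exists_pow_nat_eq
    (2 * (x 1 - x 2 + x 0 / 2 - (x 3 + x 4))) two_pos
  obtain ⟨h, hh⟩ := IsAlgClosed.exists_pow_nat_eq
    (2 * (x 0 / 2 - (x 3 + x 4) - x 1 + x 2)) two_pos
  have hx' := hx
  rw [coneSet, Set.mem_ofPred_eq, eval_conePoly] at hx'
  have key : ((g * h - e * f - 4 * (x 4 - x 3)) * (-g * h - -e * f - 4 * (x 4 - x 3))) *
      ((g * h - -e * f - 4 * (x 4 - x 3)) * (-g * h - e * f - 4 * (x 4 - x 3))) = 0 := by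
    have h₁ : e ^ 2 * f ^ 2 = _ := congrArg₂ (· * ·) he hf
    have h₂ : g ^ 2 * h ^ 2 = _ := congrArg₂ (· * ·) hg hh
    have h₃ : ((g * h - e * f - 4 * (x 4 - x 3)) * (-g * h - -e * f - 4 * (x 4 - x 3))) *
      ((g * h - -e * f - 4 * (x 4 - x 3)) * (-g * h - e * f - 4 * (x 4 - x 3))) =
      (16 * (x 4 - x 3) ^ 2 - g ^ 2 * h ^ 2 - e ^ 2 * f ^ 2) ^ 2 -
        4 * (e ^ 2 * f ^ 2) * (g ^ 2 * h ^ 2) := by ring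
    rw [h₃, h₁, h₂]
    linear_combination 256 * hx'
  have hx₀ : ![2 * (x 0 / 2), x 1, x 2, ((x 3 + x 4) - (x 4 - x 3)) / 2,
      ((x 3 + x 4) + (x 4 - x 3)) / 2] = x := by
    funext i
    fin_cases i <;> simp only [Fin.isValue, Fin.mk_one, Fin.zero_eta,
      Fin.reduceFinMk, Matrix.cons_val] <;> ring
  rw [← hx₀]
  have he' : (-e) ^ 2 = e ^ 2 := neg_sq e
  have hg' : (-g) ^ 2 = g ^ 2 := neg_sq g
  rcases mul_eq_zero.1 key with key | key <;> rcases mul_eq_zero.1 key with key | key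
  · exact ⟨_, _, _, _, covariancePoint_of_squares he hf hg hh (sub_eq_zero.1 key)⟩
  · exact ⟨_, _, _, _, covariancePoint_of_squares (he'.trans he) hf (hg'.trans hg) hh
      (sub_eq_zero.1 key)⟩
  · exact ⟨_, _, _, _, covariancePoint_of_squares (he'.trans he) hf hg hh (sub_eq_zero.1 key)⟩
  · exact ⟨_, _, _, _, covariancePoint_of_squares he hf (hg'.trans hg) hh (sub_eq_zero.1 key)⟩

theorem covariancePoint_mem_coneSet (a b c d : ℂ) : covariancePoint a b c d ∈ coneSet := by
  have := aeval_covariancePoint_conePoly a b c d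
  rwa [MvPolynomial.aeval_eq_eval] at this

open MvPolynomial in
/-- A polynomial that vanishes where the cone equation has a repeated root. -/
noncomputable def repeatedRootPoly : MvPolynomial (Fin 4) ℂ :=
  let s : MvPolynomial (Fin 4) ℂ := C (1 / 2) * X 0
  (X 1 + X 2 + s + X 3) * (s + X 3 - X 1 - X 2) * (X 1 - X 2 + s - X 3) * (s - X 3 - X 1 + X 2) *
    ((X 1 + X 2 + s + X 3) * (s + X 3 - X 1 - X 2) - (X 1 - X 2 + s - X 3) * (s - X 3 - X 1 + X 2))

theorem repeatedRootPoly_ne_zero : repeatedRootPoly ≠ 0 := fun h => by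
  have := congrArg (eval ![20, 1, 2, 5]) h
  simp only [repeatedRootPoly, map_mul, map_sub, map_add, MvPolynomial.eval_X, MvPolynomial.eval_C,
    Matrix.cons_val, map_zero] at this
  norm_num at this

/-- The roots of the quartic are `(±gh ± ef) / 4`, which are distinct when `efgh ≠ 0` and `(ef)² ≠
(gh)²`. -/
theorem exists_four_points {β : Fin 4 → ℂ} (hβ : eval β repeatedRootPoly ≠ 0) :
    ∃ m : Fin 4 → ℂ, Function.Injective m ∧
      ∀ i, ![β 0, β 1, β 2, (β 3 - m i) / 2, (β 3 + m i) / 2] ∈ coneSet := by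
  obtain ⟨e, he⟩ := IsAlgClosed.exists_pow_nat_eq (2 * (β 1 + β 2 + β 0 / 2 + β 3)) two_pos
  obtain ⟨f, hf⟩ := IsAlgClosed.exists_pow_nat_eq (2 * (β 0 / 2 + β 3 - β 1 - β 2)) two_pos
  obtain ⟨g, hg⟩ := IsAlgClosed.exists_pow_nat_eq (2 * (β 1 - β 2 + β 0 / 2 - β 3)) two_pos
  obtain ⟨h, hh⟩ := IsAlgClosed.exists_pow_nat_eq (2 * (β 0 / 2 - β 3 - β 1 + β 2)) two_pos
  have hne : e ^ 2 * f ^ 2 * g ^ 2 * h ^ 2 * (e ^ 2 * f ^ 2 - g ^ 2 * h ^ 2) ≠ 0 := by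
    rw [he, hf, hg, hh]
    intro h0
    apply hβ
    simp only [repeatedRootPoly, map_mul, map_sub, map_add, MvPolynomial.eval_X,
      MvPolynomial.eval_C]
    linear_combination h0 / 64
  have hef : e * f ≠ 0 := fun h0 => hne (by
    linear_combination e * f * g ^ 2 * h ^ 2 * (e ^ 2 * f ^ 2 - g ^ 2 * h ^ 2) * h0)
  have hgh : g * h ≠ 0 := fun h0 => hne (by
    linear_combination g * h * e ^ 2 * f ^ 2 * (e ^ 2 * f ^ 2 - g ^ 2 * h ^ 2) * h0)
  have hadd : e * f + g * h ≠ 0 := fun h0 => hne (by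
    linear_combination (e * f - g * h) * e ^ 2 * f ^ 2 * g ^ 2 * h ^ 2 * h0)
  have hsub : e * f - g * h ≠ 0 := fun h0 => hne (by
    linear_combination (e * f + g * h) * e ^ 2 * f ^ 2 * g ^ 2 * h ^ 2 * h0)
  have hmem : ∀ e g m : ℂ, e ^ 2 = 2 * (β 1 + β 2 + β 0 / 2 + β 3) →
      g ^ 2 = 2 * (β 1 - β 2 + β 0 / 2 - β 3) → g * h - e * f = 4 * m →
      ![β 0, β 1, β 2, (β 3 - m) / 2, (β 3 + m) / 2] ∈ coneSet := fun e g m he hg hm => by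
    have := covariancePoint_mem_coneSet ((e + f + g + h) / 4) ((e - f + g - h) / 4)
      ((e - f - g + h) / 4) ((e + f - g - h) / 4)
    rwa [covariancePoint_of_squares he hf hg hh hm, mul_div_cancel₀ _ (two_ne_zero' ℂ)] at this
  have he' : (-e) ^ 2 = e ^ 2 := neg_sq e
  have hg' : (-g) ^ 2 = g ^ 2 := neg_sq g
  refine ⟨![(g * h - e * f) / 4, (e * f - g * h) / 4, (g * h + e * f) / 4, -(g * h + e * f) / 4],
    ?_, ?_⟩
  · have key : ∀ i j : Fin 4, i < j → ![(g * h - e * f) / 4, (e * f - g * h) / 4,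
        (g * h + e * f) / 4, -(g * h + e * f) / 4] i ≠ ![(g * h - e * f) / 4, (e * f - g * h) / 4,
        (g * h + e * f) / 4, -(g * h + e * f) / 4] j := by
      intro i j hij heq
      fin_cases i <;> fin_cases j <;> first
        | exact absurd hij (by decide)
        | (simp only [Fin.isValue, Fin.mk_one, Fin.zero_eta, Fin.reduceFinMk,
            Matrix.cons_val] at heq
           first
            | exact hsub (by linear_combination 2 * heq)
            | exact hsub (by linear_combination -2 * heq)
            | exact hadd (by linear_combination 2 * heq)
            | exact hef (by linear_combination 2 * heq)
            | exact hef (by linear_combination -2 * heq)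
            | exact hgh (by linear_combination 2 * heq)
            | exact hgh (by linear_combination -2 * heq))
    intro i j hij
    rcases lt_trichotomy i j with h | h | h
    · exact absurd hij (key i j h)
    · exact h
    · exact absurd hij.symm (key j i h)
  · intro i
    fin_cases i
    · exact hmem e g ((g * h - e * f) / 4) he hg (by ring)
    · exact hmem (-e) (-g) ((e * f - g * h) / 4) (he'.trans he) (hg'.trans hg) (by ring)
    · exact hmem (-e) g ((g * h + e * f) / 4) (he'.trans he) hg (by ring)
    · exact hmem e (-g) (-(g * h + e * f) / 4) he (hg'.trans hg) (by ring)

/-- Divide by the monic quartic: the remainder has degree below four, yet has four roots over a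
generic base point, so it is zero. No irreducibility is required. -/
theorem vanishingIdeal_coneSet :
    MvPolynomial.vanishingIdeal ℂ coneSet = Ideal.span {conePoly} := by
  apply le_antisymm
  · intro f hf
    rw [MvPolynomial.mem_vanishingIdeal_iff] at hf
    have hmod : toQuarticRing f %ₘ coneQuartic = 0 := by
      have hdeg : (toQuarticRing f %ₘ coneQuartic).natDegree < 4 := by
        refine (Polynomial.natDegree_modByMonic_lt _ coneQuartic_monic fun h => ?_).trans_eq
          coneQuartic_natDegree
        have := coneQuartic_natDegree
        rw [h, Polynomial.natDegree_one] at this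
        omega
      have hβ : ∀ β, eval β repeatedRootPoly ≠ 0 →
          (toQuarticRing f %ₘ coneQuartic).map (eval β) = 0 := by
        intro β hβ
        obtain ⟨m, hm, hmem⟩ := exists_four_points hβ
        refine Polynomial.eq_zero_of_natDegree_lt_card_of_eval_eq_zero _ hm (fun i => ?_)
          (Polynomial.natDegree_map_le.trans_lt (by simpa using hdeg))
        have h := congrArg (fun q => eval ![β 0, β 1, β 2, (β 3 - m i) / 2, (β 3 + m i) / 2]
          (ofQuarticRing q)) (Polynomial.modByMonic_add_div (toQuarticRing f) coneQuartic)
        have hf' := hf _ (hmem i)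
        rw [MvPolynomial.aeval_eq_eval] at hf'
        have hF : eval _ conePoly = 0 := hmem i
        beta_reduce at h
        rwa [map_add, map_add, map_mul, map_mul, ofQuarticRing_coneQuartic,
          ofQuarticRing_toQuarticRing, hF, hf', zero_mul, add_zero, eval_ofQuarticRing] at h
      ext1 n
      rw [Polynomial.coeff_zero]
      -- The coefficient is known to vanish only off the repeated-root locus; multiplied by
      -- `repeatedRootPoly` it vanishes everywhere.
      have : (toQuarticRing f %ₘ coneQuartic).coeff n * repeatedRootPoly = 0 := by
        apply MvPolynomial.funext
        intro β
        rw [map_mul, map_zero]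
        by_cases h : eval β repeatedRootPoly = 0
        · rw [h, mul_zero]
        · rw [← Polynomial.coeff_map, hβ β h, Polynomial.coeff_zero, zero_mul]
      exact (mul_eq_zero.1 this).resolve_right repeatedRootPoly_ne_zero
    have h := congrArg ofQuarticRing (Polynomial.modByMonic_add_div (toQuarticRing f) coneQuartic)
    rw [hmod, zero_add, map_mul, ofQuarticRing_coneQuartic, ofQuarticRing_toQuarticRing] at h
    rw [← h]
    exact Ideal.mul_mem_right _ _ (Ideal.mem_span_singleton_self _)
  · rw [Ideal.span_singleton_le_iff_mem, MvPolynomial.mem_vanishingIdeal_iff]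
    intro x hx
    rw [MvPolynomial.aeval_eq_eval]
    exact hx

end Cone

/-! ### Critical points as points of the fibre -/

section Critical

open MvPolynomial (eval aeval)

theorem mem_zariskiTangentSpace_coneSet {x : Fin 5 → ℂ} (hx : x ∈ coneSet) {v : Fin 5 → ℂ} :
    v ∈ zariskiTangentSpace coneSet x ↔ ∑ i, coneGradient x i * v i = 0 := by
  change (∀ f ∈ MvPolynomial.vanishingIdeal ℂ coneSet,
    ∑ i, eval x (MvPolynomial.pderiv i f) * v i = 0) ↔ _
  rw [vanishingIdeal_coneSet]
  simp_rw [← eval_pderiv_conePoly]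
  refine ⟨fun h => h _ (Ideal.mem_span_singleton_self _), fun h f hf => ?_⟩
  obtain ⟨g, rfl⟩ := Ideal.mem_span_singleton.1 hf
  have hx' : eval x conePoly = 0 := hx
  simp only [Derivation.leibniz, smul_eq_mul, map_add, map_mul, hx', zero_mul, zero_add, mul_assoc,
    ← Finset.mul_sum, h, mul_zero]

theorem ringKrullDim_coneSet : ringKrullDim
    (MvPolynomial (Fin 5) ℂ ⧸ MvPolynomial.vanishingIdeal ℂ coneSet) = 4 := by
  have h := ringKrullDim_quotient_span_singleton_add_one ConormalRing.conePoly_ne_zero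
    (x := 0) (by rw [eval_conePoly]; simp)
  rw [vanishingIdeal_coneSet]
  generalize ringKrullDim (MvPolynomial (Fin 5) ℂ ⧸ Ideal.span {conePoly}) = d at h ⊢
  rw [Nat.card_eq_fintype_card, Fintype.card_fin] at h
  exact (ENat.WithBot.add_natCast_cancel (c := 1)).1 (h.trans (by norm_num))

theorem isRegularPoint_coneSet_iff {x : Fin 5 → ℂ} :
    IsRegularPoint coneSet x ↔ x ∈ coneSet ∧ coneGradient x ≠ 0 := by
  refine and_congr_right fun hx => ?_
  rw [ringKrullDim_coneSet]
  have hker : zariskiTangentSpace coneSet x =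
      LinearMap.ker (∑ i, coneGradient x i • (LinearMap.proj i : (Fin 5 → ℂ) →ₗ[ℂ] ℂ)) := by
    ext v
    rw [mem_zariskiTangentSpace_coneSet hx, LinearMap.mem_ker]
    simp
  set L := ∑ i, coneGradient x i • (LinearMap.proj i : (Fin 5 → ℂ) →ₗ[ℂ] ℂ) with hL
  have hrank := L.finrank_range_add_finrank_ker
  rw [Module.finrank_fin_fun] at hrank
  rw [hker]
  constructor
  · intro h h0
    have : L = 0 := by simp [hL, h0]
    rw [this, LinearMap.ker_zero, finrank_top, Module.finrank_fin_fun] at h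
    exact absurd h (by norm_num)
  · intro h
    have hL0 : L ≠ 0 := by
      intro h0
      apply h
      funext i
      have := DFunLike.congr_fun h0 (Pi.single i 1)
      simpa [hL, Pi.single_apply] using this
    have : Module.finrank ℂ (LinearMap.range L) = 1 := by
      rw [LinearMap.range_eq_top.2 (LinearMap.surjective hL0), finrank_top, Module.finrank_self]
    have h4 : Module.finrank ℂ (LinearMap.ker L) = 4 := by omega
    rw [h4]
    rfl

/-- At a regular point the tangent space is the hyperplane orthogonal to the gradient, so
criticality says that `u - x` is proportional to the gradient, i.e. that the `2 × 2` minors vanish.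
-/
theorem isEDCriticalPoint_coneSet_iff {u x : Fin 5 → ℂ} :
    IsEDCriticalPoint coneSet u x ↔ (x ∈ coneSet ∧ coneGradient x ≠ 0) ∧
      ∀ i j, (u i - x i) * coneGradient x j = (u j - x j) * coneGradient x i := by
  rw [IsEDCriticalPoint, isRegularPoint_coneSet_iff]
  refine and_congr_right fun ⟨hx, hg⟩ => ?_
  simp_rw [mem_zariskiTangentSpace_coneSet hx]
  constructor
  · intro h i j
    have := h (coneGradient x j • Pi.single i 1 - coneGradient x i • Pi.single j 1) (by
      simp [mul_sub, Finset.sum_sub_distrib, Pi.single_apply]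
      ring)
    simp [mul_sub, Finset.sum_sub_distrib, Pi.single_apply] at this
    linear_combination this
  · intro h v hv
    obtain ⟨j, hj⟩ := Function.ne_iff.1 hg
    apply mul_left_cancel₀ hj
    rw [Pi.zero_apply] at hj
    rw [mul_zero, Finset.mul_sum]
    calc ∑ i, coneGradient x j * ((u i - x i) * v i)
        = ∑ i, (u j - x j) * (coneGradient x i * v i) :=
          Finset.sum_congr rfl fun i _ => by linear_combination v i * h i j
      _ = 0 := by rw [← Finset.mul_sum, hv, mul_zero]

theorem lagVector_injective : Function.Injective (lagVector : (Fin 5 → ℂ) → Fin 5 → ℂ) := by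
  intro v w h
  have h₀ : 2 * v 0 = 2 * w 0 := congrFun h 0
  have h₁ : v 2 = w 2 := congrFun h 1
  have h₂ : v 3 = w 3 := congrFun h 2
  have h₃ : v 1 - v 4 = w 1 - w 4 := congrFun h 3
  have h₄ : v 1 + v 4 = w 1 + w 4 := congrFun h 4
  funext i
  fin_cases i <;> simp only [Fin.isValue, Fin.mk_one, Fin.zero_eta, Fin.reduceFinMk]
  · exact mul_left_cancel₀ two_ne_zero h₀
  · exact mul_left_cancel₀ (two_ne_zero' ℂ) (by linear_combination h₃ + h₄)
  · exact h₁
  · exact h₂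
  · exact mul_left_cancel₀ (two_ne_zero' ℂ) (by linear_combination h₄ - h₃)

namespace ConormalRing

theorem coe_lagVector_adjoinGen (i : Fin 5) :
    (lagVector (adjoinGen (σ := Fin 5) resid) i).1 = lagVector resid i :=
  map_lagVector (Algebra.adjoin (MvPolynomial (Fin 5) ℂ) (Set.range resid)).val.toRingHom
    (adjoinGen resid) i

theorem lagVector_resid (i : Fin 5) : lagVector resid i =
    param 4 * lagVector (normalCoords (param 0) (param 1) (param 2) (param 3)) i := by
  have h : ∀ (k : ConormalRing) (v : Fin 5 → ConormalRing),
      lagVector (fun i => k * v i) i = k * lagVector v i := fun k v => by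
    fin_cases i <;> simp [lagVector] <;> ring
  rw [resid_eq]
  exact h _ _

theorem lagVector_resid_mul_pderiv (i j : Fin 5) :
    lagVector resid i * aeval point (MvPolynomial.pderiv j conePoly) =
      lagVector resid j * aeval point (MvPolynomial.pderiv i conePoly) := by
  have h2 : (2 : ConormalRing) ≠ 0 := ne_zero_of_evalHom 0 (by rw [map_ofNat]; exact two_ne_zero)
  have h : ∀ i, 2 * coneGradient point i = (param 0 * param 3 - param 1 * param 2) *
      lagVector (normalCoords (param 0) (param 1) (param 2) (param 3)) i := fun i =>
    two_mul_coneGradient_covariancePoint (param 0) (param 1) (param 2) (param 3) i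
  rw [lagVector_resid, lagVector_resid, aeval_pderiv_conePoly, aeval_pderiv_conePoly]
  apply mul_left_cancel₀ h2
  rw [mul_left_comm, h, mul_left_comm 2, h]
  ring

/-- The value of a polynomial at the generic point of the cone, in the algebra generated by the
residual coordinates. -/
noncomputable def residEval (p : MvPolynomial (Fin 5) ℂ) :
    Algebra.adjoin (MvPolynomial (Fin 5) ℂ) (Set.range resid) :=
  ⟨aeval point p, aeval_point_mem_adjoin p⟩

theorem residEval_C (c : ℂ) :
    residEval (.C c) = algebraMap (MvPolynomial (Fin 5) ℂ) _ (.C c) := by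
  apply Subtype.ext
  change aeval point (.C c) = algebraMap (MvPolynomial (Fin 5) ℂ) ConormalRing (.C c)
  rw [algebraMap_apply, MvPolynomial.aeval_C, MvPolynomial.aeval_C]

theorem residEval_add (p q : MvPolynomial (Fin 5) ℂ) :
    residEval (p + q) = residEval p + residEval q :=
  Subtype.ext (map_add (aeval point) p q)

theorem residEval_mul (p q : MvPolynomial (Fin 5) ℂ) :
    residEval (p * q) = residEval p * residEval q :=
  Subtype.ext (map_mul (aeval point) p q)

theorem residEval_X (i : Fin 5) : residEval (.X i) =
    algebraMap (MvPolynomial (Fin 5) ℂ) _ (.X i) - lagVector (adjoinGen (σ := Fin 5) resid) i := by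
  apply Subtype.ext
  change aeval point (.X i) = algebraMap (MvPolynomial (Fin 5) ℂ) ConormalRing (.X i) -
    (lagVector (adjoinGen (σ := Fin 5) resid) i).1
  rw [coe_lagVector_adjoinGen, MvPolynomial.aeval_X, point_eq, resid_eq]

theorem residEval_conePoly : residEval conePoly = 0 :=
  Subtype.ext (aeval_covariancePoint_conePoly _ _ _ _)

theorem lagVector_adjoinGen_mul_residEval (i j : Fin 5) :
    lagVector (adjoinGen (σ := Fin 5) resid) i * residEval (MvPolynomial.pderiv j conePoly) =
      lagVector (adjoinGen (σ := Fin 5) resid) j *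
        residEval (MvPolynomial.pderiv i conePoly) := by
  apply Subtype.ext
  rw [Subalgebra.coe_mul, Subalgebra.coe_mul, coe_lagVector_adjoinGen, coe_lagVector_adjoinGen]
  exact lagVector_resid_mul_pderiv i j

/-- A homomorphism on the subalgebra need not come from values of the parameters, so the cone
equation and the proportionality are used as identities inside the subalgebra. The hypothesis `hne`
supplies regularity. -/
theorem isEDCriticalPoint_of_mem_fibrePoints {u w : Fin 5 → ℂ}
    {φ : Algebra.adjoin (MvPolynomial (Fin 5) ℂ) (Set.range resid) →+* ℂ} (hφ : LiesOverPoint u φ)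
    (hw : ∀ i, φ (adjoinGen resid i) = w i)
    (hne : φ (residEval (MvPolynomial.pderiv 0 conePoly)) ≠ 0) :
    IsEDCriticalPoint coneSet u (u - lagVector w) := by
  have hlag : ∀ i, φ (lagVector (adjoinGen resid) i) = lagVector w i := fun i => by
    rw [map_lagVector]
    simp only [hw]
  have heval : ∀ p : MvPolynomial (Fin 5) ℂ,
      φ (residEval p) = eval (u - lagVector w) p := fun p => by
    induction p using MvPolynomial.induction_on with
    | C c => rw [residEval_C, hφ, MvPolynomial.eval_C, MvPolynomial.eval_C]
    | add p q hp hq => rw [residEval_add, map_add, hp, hq, map_add]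
    | mul_X p i hp =>
      rw [residEval_mul, map_mul, hp, residEval_X, map_sub, hφ, hlag, map_mul, MvPolynomial.eval_X,
        MvPolynomial.eval_X, Pi.sub_apply]
  have hgrad : ∀ i, φ (residEval (MvPolynomial.pderiv i conePoly)) =
      coneGradient (u - lagVector w) i := fun i => by
    rw [heval, eval_pderiv_conePoly]
  rw [isEDCriticalPoint_coneSet_iff]
  refine ⟨⟨?_, fun h => hne ?_⟩, fun i j => ?_⟩
  · change eval (u - lagVector w) conePoly = 0
    rw [← heval, residEval_conePoly, map_zero]
  · rw [hgrad, h, Pi.zero_apply]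
  · have := congrArg φ (lagVector_adjoinGen_mul_residEval i j)
    rw [map_mul, map_mul, hlag, hlag, hgrad, hgrad] at this
    simpa using this

theorem exists_mem_fibrePoints_of_isEDCriticalPoint {u x : Fin 5 → ℂ}
    (h : IsEDCriticalPoint coneSet u x) : ∃ w ∈ fibrePoints resid u, u - lagVector w = x := by
  obtain ⟨⟨hx, hg⟩, hmin⟩ := isEDCriticalPoint_coneSet_iff.1 h
  obtain ⟨a, b, c, d, rfl⟩ := exists_covariancePoint_eq hx
  obtain ⟨j, hj⟩ := Function.ne_iff.1 hg
  rw [Pi.zero_apply] at hj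
  set x := covariancePoint a b c d with hxdef
  -- The gradient is `(ad - bc) / 2` times the parametrised normal, which fixes the scale.
  set k := (u j - x j) / coneGradient x j * ((a * d - b * c) / 2) with hk
  have hres : ∀ i, u i - x i = lagVector (fun i => k * normalCoords a b c d i) i := fun i => by
    have h₁ : lagVector (fun i => k * normalCoords a b c d i) i =
        k * lagVector (normalCoords a b c d) i := by
      fin_cases i <;> simp [lagVector] <;> ring
    have h₂ := two_mul_coneGradient_covariancePoint a b c d i
    rw [← hxdef] at h₂
    have h₃ : u i - x i = (u j - x j) / coneGradient x j * coneGradient x i := by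
      field_simp
      exact hmin i j
    rw [h₁, h₃, hk]
    linear_combination (u j - x j) / coneGradient x j / 2 * h₂
  refine ⟨fun i => k * normalCoords a b c d i, mem_fibrePoints_of_params (fun i => rfl)
    (fun i => ?_), ?_⟩
  · rw [← hres i]
    ring
  · funext i
    rw [Pi.sub_apply, ← hres i]
    ring

end ConormalRing

theorem hasAffineEDDegree_coneSet : HasAffineEDDegree coneSet 16 := by
  obtain ⟨Q, hQ, h⟩ := ConormalRing.exists_generic_fibre
  refine ⟨Q, hQ, fun u hu => ?_⟩
  have himage : {x | IsEDCriticalPoint coneSet u x} =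
      (fun w => u - lagVector w) '' fibrePoints ConormalRing.resid u := by
    ext x
    constructor
    · exact ConormalRing.exists_mem_fibrePoints_of_isEDCriticalPoint
    · rintro ⟨w, ⟨φ, hφ, hw⟩, rfl⟩
      exact ConormalRing.isEDCriticalPoint_of_mem_fibrePoints hφ hw ((h u hu).2 φ hφ)
  rw [himage, Function.Injective.encard_image, (h u hu).1]
  · rfl
  · exact fun v w hvw => lagVector_injective (sub_right_injective hvw)

end Critical

/-! ### Invariance under relabelling of coordinates -/

section Reindex

open MvPolynomial (eval aeval rename)

variable {σ τ : Type*} (e : σ ≃ τ) (X : Set (σ → ℂ))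

/-- The set `X ⊆ ℂ^σ` in coordinates indexed by `τ`. -/
def reindexSet : Set (τ → ℂ) := {y | y ∘ e ∈ X}

theorem rename_mem_vanishingIdeal_reindexSet_iff {f : MvPolynomial σ ℂ} :
    rename e f ∈ MvPolynomial.vanishingIdeal ℂ (reindexSet e X) ↔
      f ∈ MvPolynomial.vanishingIdeal ℂ X := by
  simp only [MvPolynomial.mem_vanishingIdeal_iff, MvPolynomial.aeval_rename]
  refine ⟨fun h x hx => ?_, fun h y hy => h _ hy⟩
  have hx' : (x ∘ e.symm) ∘ e = x := by
    funext i
    simp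
  have := h (x ∘ e.symm) (show (x ∘ e.symm) ∘ e ∈ X by rwa [hx'])
  rwa [hx'] at this

variable [Fintype σ] [Fintype τ]

theorem mem_zariskiTangentSpace_reindexSet_iff {y v : τ → ℂ} :
    v ∈ zariskiTangentSpace (reindexSet e X) y ↔ v ∘ e ∈ zariskiTangentSpace X (y ∘ e) := by
  change (∀ f ∈ MvPolynomial.vanishingIdeal ℂ (reindexSet e X),
    ∑ i, eval y (MvPolynomial.pderiv i f) * v i = 0) ↔
      ∀ f ∈ MvPolynomial.vanishingIdeal ℂ X,
        ∑ i, eval (y ∘ e) (MvPolynomial.pderiv i f) * (v ∘ e) i = 0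
  have h : ∀ f : MvPolynomial σ ℂ, ∑ i, eval y (MvPolynomial.pderiv i (rename e f)) * v i =
      ∑ i, eval (y ∘ e) (MvPolynomial.pderiv i f) * (v ∘ e) i := fun f => by
    rw [← Equiv.sum_comp e]
    refine Finset.sum_congr rfl fun i _ => ?_
    rw [MvPolynomial.pderiv_rename e.injective, MvPolynomial.eval_rename]
    rfl
  constructor
  · intro hv f hf
    rw [← h]
    exact hv _ ((rename_mem_vanishingIdeal_reindexSet_iff e X).2 hf)
  · intro hv f hf
    obtain ⟨g, rfl⟩ := (MvPolynomial.renameEquiv ℂ e).surjective f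
    exact (h g).trans (hv g ((rename_mem_vanishingIdeal_reindexSet_iff e X).1 hf))

theorem isRegularPoint_reindexSet_iff {y : τ → ℂ} :
    IsRegularPoint (reindexSet e X) y ↔ IsRegularPoint X (y ∘ e) := by
  have hrank : Module.finrank ℂ (zariskiTangentSpace (reindexSet e X) y) =
      Module.finrank ℂ (zariskiTangentSpace X (y ∘ e)) := by
    have : zariskiTangentSpace (reindexSet e X) y = (zariskiTangentSpace X (y ∘ e)).comap
        (LinearEquiv.funCongrLeft ℂ ℂ e : (τ → ℂ) →ₗ[ℂ] (σ → ℂ)) := by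
      ext v
      exact mem_zariskiTangentSpace_reindexSet_iff e X
    rw [this]
    exact ((LinearEquiv.funCongrLeft ℂ ℂ e).ofSubmodule' _).finrank_eq
  have hdim : ringKrullDim
      (MvPolynomial τ ℂ ⧸ MvPolynomial.vanishingIdeal ℂ (reindexSet e X)) =
      ringKrullDim (MvPolynomial σ ℂ ⧸ MvPolynomial.vanishingIdeal ℂ X) := by
    refine (ringKrullDim_eq_of_ringEquiv (Ideal.quotientEquiv _ _
      (MvPolynomial.renameEquiv ℂ e).toRingEquiv ?_)).symm
    ext f
    obtain ⟨g, rfl⟩ := (MvPolynomial.renameEquiv ℂ e).surjective f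
    refine (rename_mem_vanishingIdeal_reindexSet_iff e X).trans ?_
    refine ⟨fun hg => Ideal.mem_map_of_mem _ hg, fun h => ?_⟩
    obtain ⟨x, hx, hxg⟩ := (Ideal.mem_map_of_equiv (MvPolynomial.renameEquiv ℂ e).toRingEquiv _).1 h
    rwa [← (MvPolynomial.renameEquiv ℂ e).injective hxg]
  rw [IsRegularPoint, IsRegularPoint, hrank, hdim]
  rfl

theorem isEDCriticalPoint_reindexSet_iff {u y : τ → ℂ} :
    IsEDCriticalPoint (reindexSet e X) u y ↔ IsEDCriticalPoint X (u ∘ e) (y ∘ e) := by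
  rw [IsEDCriticalPoint, IsEDCriticalPoint, isRegularPoint_reindexSet_iff]
  refine and_congr_right fun _ => ?_
  simp_rw [mem_zariskiTangentSpace_reindexSet_iff]
  rw [(e.arrowCongr (Equiv.refl ℂ)).surjective.forall]
  refine forall_congr' fun v => ?_
  have hv : e.arrowCongr (Equiv.refl ℂ) v ∘ e = v := by
    funext i
    simp
  rw [hv, ← Equiv.sum_comp e]
  simp

theorem HasAffineEDDegree.reindexSet {X : Set (σ → ℂ)} {n : ℕ} (h : HasAffineEDDegree X n) :
    HasAffineEDDegree (reindexSet e X) n := by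
  obtain ⟨P, hP, h⟩ := h
  refine ⟨rename e P, fun h0 => hP (MvPolynomial.rename_injective _ e.injective ?_),
    fun u hu => ?_⟩
  · rw [h0, map_zero]
  · rw [MvPolynomial.eval_rename] at hu
    rw [← h _ hu]
    simp_rw [isEDCriticalPoint_reindexSet_iff]
    exact Set.encard_preimage_of_bijective (e.arrowCongr (Equiv.refl ℂ)).symm.bijective
      {x | IsEDCriticalPoint X (u ∘ e) x}

end Reindex

/-! ### The affine cone as an image -/

section AffineCone

theorem autocovMap_smul {d : ℕ} (q : Fin d → ℕ) (c : ℂ) (a : coeffIndex q → ℂ) :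
    autocovMap q (c • a) = c ^ 2 • autocovMap q a := by
  funext t
  simp only [autocovMap, Pi.smul_apply, smul_eq_mul, Finset.mul_sum, mul_ite, mul_zero]
  refine Finset.sum_congr rfl fun k _ => Finset.sum_congr rfl fun l _ => ?_
  split_ifs
  · ring
  · rfl

/-- The map is homogeneous of degree two and every complex scalar is a square, so its image is
already closed under scaling. -/
theorem affineCone_autocovVariety {d : ℕ} (q : Fin d → ℕ) :
    affineCone (autocovVariety q) = Set.range (autocovMap q) := by
  ext x
  constructor
  · intro hx
    by_cases h : x = 0
    · refine ⟨0, ?_⟩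
      have := autocovMap_smul q 0 0
      simpa [h] using this
    · obtain ⟨a, ha, hxa⟩ := hx h
      obtain ⟨c, hc⟩ := (Projectivization.mk_eq_mk_iff' ℂ _ _ h ha).1 hxa
      obtain ⟨s, rfl⟩ := IsAlgClosed.exists_pow_nat_eq c two_pos
      exact ⟨s • a, by rw [autocovMap_smul, hc]⟩
  · rintro ⟨a, rfl⟩ h
    exact ⟨a, h, rfl⟩

end AffineCone

/-! ### Order `(1, 1)` in coordinates -/

section Square

/-- The coefficients of a moving average polynomial of order `(1, 1)`. -/
def squareCoeff (i : Fin 4) : Fin 2 → ℤ := ![![0, 0], ![0, 1], ![1, 0], ![1, 1]] i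

/-- The nonnegative lags of a moving average polynomial of order `(1, 1)`. -/
def squareLag (i : Fin 5) : Fin 2 → ℤ := ![![0, 0], ![0, 1], ![1, 0], ![1, 1], ![1, -1]] i

theorem mem_coeffIndex_one_one {t : Fin 2 → ℤ} :
    t ∈ coeffIndex ![1, 1] ↔ ∃ i, squareCoeff i = t := by
  rw [coeffIndex, Finset.mem_Icc, Pi.le_def, Pi.le_def]
  constructor
  · rintro ⟨h₁, h₂⟩
    have h₁₀ : 0 ≤ t 0 := h₁ 0
    have h₁₁ : 0 ≤ t 1 := h₁ 1
    have h₂₀ : t 0 ≤ 1 := h₂ 0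
    have h₂₁ : t 1 ≤ 1 := h₂ 1
    have ht : t = ![t 0, t 1] := by
      funext i
      fin_cases i <;> rfl
    rw [ht]
    generalize t 0 = x at *
    generalize t 1 = y at *
    interval_cases x <;> interval_cases y
    exacts [⟨0, rfl⟩, ⟨1, rfl⟩, ⟨2, rfl⟩, ⟨3, rfl⟩]
  · rintro ⟨i, rfl⟩
    revert i
    decide

theorem toLex_nonneg_iff {t : Fin 2 → ℤ} : 0 ≤ toLex t ↔ 0 < t 0 ∨ t 0 = 0 ∧ 0 ≤ t 1 := by
  rw [le_iff_lt_or_eq]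
  constructor
  · rintro (⟨i, hi, hlt⟩ | h)
    · fin_cases i
      · exact Or.inl hlt
      · exact Or.inr ⟨(hi 0 (by decide)).symm, le_of_lt hlt⟩
    · have : t = 0 := h.symm
      simp [this]
  · rintro (h | ⟨h₀, h₁⟩)
    · exact Or.inl ⟨0, fun j hj => absurd hj (Fin.not_lt_zero j), h⟩
    · rcases h₁.lt_or_eq with h₁ | h₁
      · refine Or.inl ⟨1, fun j hj => ?_, h₁⟩
        obtain rfl : j = 0 := by omega
        exact h₀.symm
      · refine Or.inr ?_
        change 0 = t
        funext i
        fin_cases i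
        exacts [h₀.symm, h₁]

theorem mem_autocovIndex_one_one {t : Fin 2 → ℤ} :
    t ∈ autocovIndex ![1, 1] ↔ ∃ i, squareLag i = t := by
  rw [autocovIndex, Finset.mem_filter, Finset.mem_Icc, Pi.le_def, Pi.le_def, toLex_nonneg_iff]
  constructor
  · rintro ⟨⟨h₁, h₂⟩, h₃⟩
    have h₁₀ : -1 ≤ t 0 := h₁ 0
    have h₁₁ : -1 ≤ t 1 := h₁ 1
    have h₂₀ : t 0 ≤ 1 := h₂ 0
    have h₂₁ : t 1 ≤ 1 := h₂ 1
    have ht : t = ![t 0, t 1] := by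
      funext i
      fin_cases i <;> rfl
    rw [ht]
    generalize t 0 = x at *
    generalize t 1 = y at *
    interval_cases x <;> interval_cases y <;> first
      | exact absurd h₃ (by decide)
      | exact ⟨0, rfl⟩
      | exact ⟨1, rfl⟩
      | exact ⟨2, rfl⟩
      | exact ⟨3, rfl⟩
      | exact ⟨4, rfl⟩
  · rintro ⟨i, rfl⟩
    revert i
    decide

/-- The enumeration of the coefficient index set. -/
noncomputable def squareCoeffEquiv : Fin 4 ≃ coeffIndex ![1, 1] :=
  Equiv.ofBijective (fun i => ⟨squareCoeff i, mem_coeffIndex_one_one.2 ⟨i, rfl⟩⟩)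
    ⟨fun i j h => by
      have : ∀ i j, squareCoeff i = squareCoeff j → i = j := by decide
      exact this i j (congrArg Subtype.val h),
    fun t => by
      obtain ⟨i, hi⟩ := mem_coeffIndex_one_one.1 t.2
      exact ⟨i, Subtype.ext hi⟩⟩

/-- The enumeration of the lags. -/
noncomputable def squareLagEquiv : Fin 5 ≃ autocovIndex ![1, 1] :=
  Equiv.ofBijective (fun i => ⟨squareLag i, mem_autocovIndex_one_one.2 ⟨i, rfl⟩⟩)
    ⟨fun i j h => by
      have : ∀ i j, squareLag i = squareLag j → i = j := by decide
      exact this i j (congrArg Subtype.val h),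
    fun t => by
      obtain ⟨i, hi⟩ := mem_autocovIndex_one_one.1 t.2
      exact ⟨i, Subtype.ext hi⟩⟩

theorem autocovMap_one_one (a : coeffIndex ![1, 1] → ℂ) (i : Fin 5) :
    autocovMap ![1, 1] a (squareLagEquiv i) =
      covariancePoint (a (squareCoeffEquiv 0)) (a (squareCoeffEquiv 1)) (a (squareCoeffEquiv 2))
        (a (squareCoeffEquiv 3)) i := by
  have h : autocovMap ![1, 1] a (squareLagEquiv i) = ∑ k : Fin 4, ∑ l : Fin 4,
      if squareCoeff l = squareCoeff k + squareLag i then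
        a (squareCoeffEquiv k) * a (squareCoeffEquiv l) else 0 := by
    rw [autocovMap, ← Equiv.sum_comp squareCoeffEquiv]
    refine Finset.sum_congr rfl fun k _ => ?_
    rw [← Equiv.sum_comp squareCoeffEquiv]
    rfl
  rw [h]
  generalize squareCoeffEquiv = e
  fin_cases i <;> simp [Fin.sum_univ_four, squareCoeff, squareLag, covariancePoint]
  ring

theorem range_autocovMap_one_one :
    Set.range (autocovMap ![1, 1]) = reindexSet squareLagEquiv coneSet := by
  ext y
  constructor
  · rintro ⟨a, rfl⟩
    have : autocovMap ![1, 1] a ∘ squareLagEquiv = _ := funext (autocovMap_one_one a)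
    change autocovMap ![1, 1] a ∘ squareLagEquiv ∈ coneSet
    rw [this]
    exact covariancePoint_mem_coneSet _ _ _ _
  · intro hy
    obtain ⟨a, b, c, d, h⟩ := exists_covariancePoint_eq hy
    refine ⟨![a, b, c, d] ∘ squareCoeffEquiv.symm, ?_⟩
    rw [← squareLagEquiv.surjective.injective_comp_right.eq_iff, ← h]
    funext i
    exact (autocovMap_one_one _ i).trans (by simp)

theorem hasEDDegree_autocovVariety_one_one : HasEDDegree (autocovVariety ![1, 1]) 16 := by
  rw [HasEDDegree, affineCone_autocovVariety, range_autocovMap_one_one]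
  exact hasAffineEDDegree_coneSet.reindexSet squareLagEquiv

end Square

/-! ### The univariate case -/

section Univariate

open Polynomial

theorem exists_mul_inv_eq_eval_add_inv (p : ℂ[X]) : ∃ A : ℂ[X], A.natDegree ≤ p.natDegree ∧
    ∀ z : ℂ, z ≠ 0 → A.eval z * A.eval z⁻¹ = p.eval (z + z⁻¹) := by
  induction hn : p.natDegree generalizing p with
  | zero =>
    obtain ⟨c, rfl⟩ := natDegree_eq_zero.1 hn
    obtain ⟨s, hs⟩ := IsAlgClosed.exists_pow_nat_eq c two_pos
    exact ⟨C s, by simp, fun z _ => by rw [eval_C, eval_C, eval_C, ← hs, sq]⟩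
  | succ n ih =>
    obtain ⟨w, hw⟩ := IsAlgClosed.exists_root p (by
      rw [degree_eq_natDegree (by rintro rfl; simp at hn), hn]
      exact_mod_cast n.succ_ne_zero)
    obtain ⟨p, rfl⟩ := dvd_iff_isRoot.2 hw
    have hp : p ≠ 0 := by
      rintro rfl
      simp at hn
    rw [natDegree_mul (X_sub_C_ne_zero w) hp, natDegree_X_sub_C, add_comm] at hn
    obtain ⟨A, hA, h⟩ := ih p (by omega)
    obtain ⟨r, hr⟩ := IsAlgClosed.exists_pow_nat_eq (w ^ 2 / 4 - 1) two_pos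
    -- If `ρ² - wρ + 1 = 0` and `s²ρ = -1`, then `s²(z - ρ)(z⁻¹ - ρ) = z + z⁻¹ - w`; here `ρ = w / 2
    -- + r`.
    obtain ⟨s, hs⟩ := IsAlgClosed.exists_pow_nat_eq (-(w / 2 + r)⁻¹) two_pos
    have hr' : (w / 2 + r) ^ 2 - w * (w / 2 + r) + 1 = 0 := by linear_combination hr
    generalize w / 2 + r = r at hr' hs
    have hr0 : r ≠ 0 := by
      rintro rfl
      simp at hr'
    have hs' : s ^ 2 * r = -1 := by
      rw [hs]
      field_simp
    refine ⟨C s * (X - C r) * A, ?_, fun z hz => ?_⟩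
    · refine natDegree_mul_le.trans ?_
      have : (C s * (X - C r)).natDegree ≤ 1 := by
        refine (natDegree_C_mul_le _ _).trans ?_
        rw [natDegree_X_sub_C]
      omega
    · have hzz : z * z⁻¹ = 1 := mul_inv_cancel₀ hz
      simp only [eval_mul, eval_C, eval_sub, eval_X]
      rw [← h z hz]
      linear_combination A.eval z * A.eval z⁻¹ *
        (s ^ 2 * hzz + s ^ 2 * hr' - (z + z⁻¹ - w) * hs')

/-- These are rescaled Chebyshev polynomials, built by their recursion. -/
theorem exists_eval_add_inv_eq_pow_add_inv_pow (t : ℕ) : ∃ p : ℂ[X], p.natDegree ≤ t ∧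
    ∀ z : ℂ, z ≠ 0 → p.eval (z + z⁻¹) = z ^ t + z⁻¹ ^ t := by
  induction t using Nat.twoStepInduction with
  | zero => exact ⟨C 2, by simp, fun z _ => by norm_num⟩
  | one => exact ⟨X, by simp, fun z _ => by simp⟩
  | more t h₀ h₁ =>
    obtain ⟨p, hp, hp'⟩ := h₀
    obtain ⟨q, hq, hq'⟩ := h₁
    refine ⟨X * q - p, (natDegree_sub_le _ _).trans (max_le ?_ (by omega)), fun z hz => ?_⟩
    · refine natDegree_mul_le.trans ?_
      rw [natDegree_X]
      omega
    · have hzz : z * z⁻¹ = 1 := mul_inv_cancel₀ hz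
      rw [eval_sub, eval_mul, eval_X, hp' z hz, hq' z hz]
      linear_combination (z ^ t + z⁻¹ ^ t) * hzz

theorem exists_autocorrelation_eq (n : ℕ) (c : ℕ → ℂ) : ∃ a : ℕ → ℂ, ∀ t ≤ n,
    ∑ k ∈ Finset.range (n + 1), ∑ l ∈ Finset.range (n + 1),
      (if l = k + t then a k * a l else 0) = c t := by
  choose p hp hp' using exists_eval_add_inv_eq_pow_add_inv_pow
  -- The constant term is halved because `z ^ t + z⁻¹ ^ t` is `2` at `t = 0`.
  let c' : ℕ → ℂ := fun t => if t = 0 then c 0 / 2 else c t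
  let P : ℂ[X] := ∑ t ∈ Finset.range (n + 1), C (c' t) * p t
  have hP : P.natDegree ≤ n := natDegree_sum_le_of_forall_le _ _ fun t ht =>
    (natDegree_C_mul_le _ _).trans ((hp t).trans (Nat.lt_succ_iff.1 (Finset.mem_range.1 ht)))
  obtain ⟨A, hA, h⟩ := exists_mul_inv_eq_eval_add_inv P
  have hAn : A.natDegree < n + 1 := Nat.lt_succ_of_le (hA.trans hP)
  refine ⟨A.coeff, fun t ht => ?_⟩
  -- This is `A(z)A(z⁻¹) = P(z + z⁻¹)` multiplied by `zⁿ`, which makes both sides polynomials; lag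
  -- `t` is then the coefficient at `n + t`.
  have hpoly : ∑ k ∈ Finset.range (n + 1), ∑ l ∈ Finset.range (n + 1),
      C (A.coeff k * A.coeff l) * X ^ (n + l - k) =
      ∑ t ∈ Finset.range (n + 1), C (c' t) * (X ^ (n + t) + X ^ (n - t)) := by
    refine eq_of_infinite_eval_eq _ _ ((Set.finite_singleton (0 : ℂ)).infinite_compl.mono
      fun z hz => ?_)
    have hz : z ≠ 0 := hz
    change eval z _ = eval z _
    simp only [eval_finsetSum, eval_mul, eval_C, eval_add, eval_pow, eval_X]
    have hpow : ∀ i j, j ≤ n → z ^ (n + i - j) = z ^ n * (z ^ i * z⁻¹ ^ j) := fun i j hj => by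
      rw [inv_pow, ← mul_assoc, ← pow_add, ← pow_sub₀ _ hz (by omega)]
    calc _ = z ^ n * (A.eval z⁻¹ * A.eval z) := by
          rw [eval_eq_sum_range' hAn, eval_eq_sum_range' hAn, Finset.sum_mul_sum, Finset.mul_sum]
          refine Finset.sum_congr rfl fun k hk => ?_
          rw [Finset.mul_sum]
          refine Finset.sum_congr rfl fun l _ => ?_
          rw [hpow l k (Nat.lt_succ_iff.1 (Finset.mem_range.1 hk))]
          ring
      _ = z ^ n * P.eval (z + z⁻¹) := by rw [mul_comm (A.eval _), h z hz]
      _ = _ := by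
          rw [eval_finsetSum, Finset.mul_sum]
          refine Finset.sum_congr rfl fun t ht => ?_
          have := hpow 0 t (Nat.lt_succ_iff.1 (Finset.mem_range.1 ht))
          rw [add_zero] at this
          rw [eval_mul, eval_C, hp' t z hz, this]
          ring
  have hcoeff := congrArg (coeff · (n + t)) hpoly
  simp only [finsetSum_coeff, coeff_C_mul, coeff_add, coeff_X_pow] at hcoeff
  calc _ = ∑ k ∈ Finset.range (n + 1), ∑ l ∈ Finset.range (n + 1),
        A.coeff k * A.coeff l * (if n + t = n + l - k then 1 else 0) := by
        refine Finset.sum_congr rfl fun k hk => Finset.sum_congr rfl fun l _ => ?_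
        have hk := Finset.mem_range.1 hk
        have : n + t = n + l - k ↔ l = k + t := by omega
        simp only [this]
        split_ifs <;> simp
    _ = _ := hcoeff
    _ = ∑ s ∈ Finset.range (n + 1),
          ((if s = t then c' t else 0) + if s = 0 then (if t = 0 then c' 0 else 0) else 0) := by
        refine Finset.sum_congr rfl fun s hs => ?_
        have hs := Finset.mem_range.1 hs
        have h₁ : n + t = n + s ↔ s = t := by omega
        have h₂ : n + t = n - s ↔ s = 0 ∧ t = 0 := by omega
        simp only [h₁, h₂]
        rcases eq_or_ne s t with rfl | hst
        · rcases eq_or_ne s 0 with rfl | hs0 <;> simp [*]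
          ring
        · rcases eq_or_ne s 0 with rfl | hs0
          · simp [hst, hst.symm]
          · simp [hst, hs0]
    _ = c t := by
        rw [Finset.sum_add_distrib, Finset.sum_ite_eq', Finset.sum_ite_eq',
          if_pos (Finset.mem_range.2 (Nat.lt_succ_of_le ht)),
          if_pos (Finset.mem_range.2 n.succ_pos)]
        rcases eq_or_ne t 0 with rfl | ht0
        · simp [c']
        · simp [c', ht0]

theorem range_autocovMap_of_one_dim (q : Fin 1 → ℕ) :
    Set.range (autocovMap q) = Set.univ := by
  refine Set.eq_univ_of_forall fun γ => ?_
  have hmem : ∀ k : ℕ, k ≤ q 0 → (fun _ => (k : ℤ)) ∈ coeffIndex q := fun k hk => by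
    rw [coeffIndex, Finset.mem_Icc, Pi.le_def, Pi.le_def]
    refine ⟨fun i => Int.natCast_nonneg k, fun i => ?_⟩
    rw [Subsingleton.elim i 0]
    exact_mod_cast hk
  have hcoeff : ∀ k : coeffIndex q, 0 ≤ k.1 0 ∧ k.1 0 ≤ q 0 := fun k => by
    have h := Finset.mem_Icc.1 k.2
    exact ⟨h.1 0, h.2 0⟩
  have hlag : ∀ t : autocovIndex q, 0 ≤ t.1 0 ∧ t.1 0 ≤ q 0 := fun t => by
    have h := Finset.mem_filter.1 t.2
    exact ⟨Pi.lex_le_iff_of_unique.1 h.2, (Finset.mem_Icc.1 h.1).2 0⟩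
  obtain ⟨a, ha⟩ := exists_autocorrelation_eq (q 0) fun t =>
    if h : (fun _ => (t : ℤ)) ∈ autocovIndex q then γ ⟨_, h⟩ else 0
  refine ⟨fun k => a (k.1 0).toNat, funext fun t => ?_⟩
  have hsum : ∀ f : ℕ → ℂ, ∑ k : coeffIndex q, f (k.1 0).toNat =
      ∑ k ∈ Finset.range (q 0 + 1), f k := fun f => by
    refine Finset.sum_bij (fun k _ => (k.1 0).toNat) ?_ ?_ ?_ fun _ _ => rfl
    · intro k _
      have := hcoeff k
      rw [Finset.mem_range]
      omega
    · intro k _ l _ hkl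
      have h₁ := hcoeff k
      have h₂ := hcoeff l
      apply Subtype.ext
      funext i
      rw [Subsingleton.elim i 0]
      omega
    · intro k hk
      exact ⟨⟨_, hmem k (Nat.lt_succ_iff.1 (Finset.mem_range.1 hk))⟩, Finset.mem_univ _,
        Int.toNat_natCast k⟩
  have ht := hlag t
  have htc : (fun _ => ((t.1 0).toNat : ℤ)) = t.1 := by
    funext i
    rw [Subsingleton.elim i 0]
    omega
  have := ha (t.1 0).toNat (by omega)
  simp only [htc, t.2, dif_pos] at this
  rw [← hsum fun k => ∑ l ∈ Finset.range (q 0 + 1),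
    if l = k + (t.1 0).toNat then a k * a l else 0] at this
  rw [← this, autocovMap]
  refine Finset.sum_congr rfl fun k _ => ?_
  rw [← hsum fun l => if l = (k.1 0).toNat + (t.1 0).toNat then a (k.1 0).toNat * a l else 0]
  refine Finset.sum_congr rfl fun l _ => ?_
  have h₁ := hcoeff k
  have h₂ := hcoeff l
  refine if_congr ?_ rfl rfl
  rw [funext_iff, Fin.forall_fin_one, Pi.add_apply]
  omega

/-- Every vector is tangent, so criticality forces `u - x = 0`; no datum has to be excluded. -/
theorem hasAffineEDDegree_univ (σ : Type*) [Fintype σ] :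
    HasAffineEDDegree (Set.univ : Set (σ → ℂ)) 1 := by
  classical
  have hI : MvPolynomial.vanishingIdeal ℂ (Set.univ : Set (σ → ℂ)) = ⊥ := by
    rw [eq_bot_iff]
    intro f hf
    rw [Ideal.mem_bot]
    apply MvPolynomial.funext
    intro x
    have := MvPolynomial.mem_vanishingIdeal_iff.1 hf x (Set.mem_univ x)
    rwa [MvPolynomial.aeval_eq_eval] at this
  have hT : ∀ x v : σ → ℂ, v ∈ zariskiTangentSpace Set.univ x := fun x v f hf => by
    rw [hI, Ideal.mem_bot] at hf
    simp [hf]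
  have hreg : ∀ x : σ → ℂ, IsRegularPoint Set.univ x := fun x => by
    refine ⟨Set.mem_univ x, ?_⟩
    have hTop : zariskiTangentSpace Set.univ x = ⊤ := eq_top_iff.2 fun v _ => hT x v
    rw [hTop, finrank_top, Module.finrank_fintype_fun_eq_card, hI,
      ringKrullDim_eq_of_ringEquiv (RingEquiv.quotientBot (MvPolynomial σ ℂ)),
      ringKrullDim_mvPolynomial_complex, Nat.card_eq_fintype_card]
  refine ⟨1, one_ne_zero, fun u _ => ?_⟩
  have : {x | IsEDCriticalPoint Set.univ u x} = {u} := by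
    ext x
    refine ⟨fun h => ?_, ?_⟩
    · funext i
      have := h.2 (Pi.single i 1) (hT x _)
      simp only [Pi.single_apply, mul_ite, mul_one, mul_zero, Finset.sum_ite_eq',
        Finset.mem_univ, if_true] at this
      exact (sub_eq_zero.1 this).symm
    · rintro rfl
      exact ⟨hreg x, fun v _ => by simp⟩
  rw [this, Set.encard_singleton]
  rfl

theorem hasEDDegree_autocovVariety_of_one_dim (q : Fin 1 → ℕ) :
    HasEDDegree (autocovVariety q) 1 := by
  rw [HasEDDegree, affineCone_autocovVariety, range_autocovMap_of_one_dim]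
  exact hasAffineEDDegree_univ _

end Univariate

theorem proposition5p1 :
    (∀ q : Fin 1 → ℕ, HasEDDegree (autocovVariety q) 1) ∧
      HasEDDegree (autocovVariety (![1, 1] : Fin 2 → ℕ)) 16 :=
  ⟨hasEDDegree_autocovVariety_of_one_dim, hasEDDegree_autocovVariety_one_one⟩
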